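/- Let $(B,g_B)$ and $(F_1,g_{F_1}),\dots,(F_m,g_{F_m})$ be finite-dimensional smooth pseudo-Riemannian manifolds, let $b_i:B\times F_i\to(0,\infty)$ be smooth, and let $M=B\times_{b_1}F_1\times\cdots\times_{b_m}F_m$ be the multiply twisted product, i.e. $B\times F_1\times\cdots\times F_m$ with the metric $g=g_B\oplus b_1^2g_{F_1}\oplus\cdots\oplus b_m^2g_{F_m}$. Put $n=\dim B$, $l_i=\dim F_i$, $\overline n=\dim M=n+\sum_i l_i$. Let $P$ be a smooth vector field on $B$ (also regarded as a vector field on $M$), $\pi=g(\cdot,P)$, $\lambda_1,\lambda_2\in\mathbb R$, $\nabla$ the Levi-Civita connection of $g$, and $$\overline\nabla_XY=\nabla_XY+\lambda_1\pi(Y)X-\lambda_2\,g(X,Y)P .$$ The curvature of a connection $\nabla$ is $R(X,Y)=\nabla_X\nabla_Y-\nabla_Y\nabla_X-\nabla_{[X,Y]}$, and its Ricci tensor is $Ric(X,Y)=\sum_k\varepsilon_k\langle R(X,E_k)Y,E_k\rangle$ for an orthonormal base $E_k$, $\varepsilon_k=\langle E_k,E_k\rangle=\pm1$. Let $\overline{Ric}$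 be the Ricci tensor of $\overline\nabla$, let $\overline{Ric}^B$ be that of the connection $\nabla^B_XY+\lambda_1g_B(Y,P)X-\lambda_2g_B(X,Y)P$ on $(B,g_B)$, and let $\overline{Ric}^{F_i}$ be, at a point of $M$ with $B$-component $x$, that of the connection which $\overline\nabla$ induces (by tangential projection) on the fibre $F_i$ over $x$. Since $P$ is tangent to $B$, the latter is the Levi-Civita connection of the induced metric $b_i(x,\cdot)^2g_{F_i}$; if $b_i(x,\cdot)$ is constant on $F_i$, then $\overline{Ric}^{F_i}$ is the Ricci tensor $Ric^{F_i}$ of $(F_i,g_{F_i})$. For fixed $F_i$-component, $grad_Bb_i$, $H^{b_i}_B(X,Y)=XYb_i-(\nabla^B_XY)b_i$ and $\Delta_Bb_i=\sum_k\varepsilon_kH_B^{b_i}(E_k,E_k)$ are the gradient, Hessian and Laplacian of $b_i$ on $(B,g_B)$, and $div_BP=\sum_{k=1}^n\varepsilon_k\langle\nabla_{E_k}P,E_k\rangle$, where $E_1,\dots,E_n$ is an orthonormal base of $B$. If $X,Y$ are tangent to $B$, $V$ is tangent to $F_i$ and $W$ is tangent to $F_j$, then: (1) $\displaystyle\overline{Ric}(X,Y)=\overline{Ric}^B(X,Y)+\sum_{i=1}^m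 l_i\Big[\frac{H_B^{b_i}(X,Y)}{b_i}+\lambda_2\frac{Pb_i}{b_i}g(X,Y)+\lambda_1\lambda_2\pi(P)g(X,Y)+\lambda_1g(Y,\nabla_XP)-\lambda_1^2\pi(X)\pi(Y)\Big];$ (2) $\overline{Ric}(X,V)=\overline{Ric}(V,X)=(l_i-1)\,VX(\ln b_i)$ (with $X$ and $V$ extended to vector fields on $B$ and on $F_i$); (3) $\overline{Ric}(V,W)=0$ if $i\ne j$; (4) if $i=j$, $$\overline{Ric}(V,W)=\overline{Ric}^{F_i}(V,W)+\Big\{\frac{\Delta_Bb_i}{b_i}+(l_i-1)\frac{g_B(grad_Bb_i,grad_Bb_i)}{b_i^2}+\sum_{s\ne i}l_s\frac{g_B(grad_Bb_i,grad_Bb_s)}{b_ib_s}+[(\overline n-1)\lambda_1\lambda_2-\lambda_2^2]\pi(P)$$ $$\qquad+\lambda_2\,div_BP+\lambda_2\sum_{s\ne i}l_s\frac{Pb_s}{b_s}+[(\overline n-1)\lambda_1+(l_i-1)\lambda_2]\frac{Pb_i}{b_i}\Big\}g(V,W).$$ -/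

import Mathlib

open scoped Manifold ContDiff

noncomputable section

namespace QuarterSymmetric

/-! ### Linear algebra of a scalar product -/

section ScalarProduct

variable {E : Type*} [NormedAddCommGroup E] [NormedSpace ℝ E]

/-- The vector metrically dual to the covector `η`: for a nondegenerate `G` on a finite-dimensional
space it is the unique `v` with `G v w = η w` for all `w`. -/
def sharp (G : E →L[ℝ] E →L[ℝ] ℝ) (η : E →L[ℝ] ℝ) : E := G.inverse η

/-- The trace of a bilinear expression `T` with respect to `G`, that is `G^{jk} T_{jk}`. It equals
`∑ ε_k T (E_k, E_k)` for each `G`-orthonormal base `E_k` with `ε_k = G (E_k, E_k)`, see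
`metricTrace_eq_sum_orthonormal`. -/
def metricTrace [FiniteDimensional ℝ E] (G : E →L[ℝ] E →L[ℝ] ℝ) (T : E → E → ℝ) : ℝ :=
  ∑ k, T (Module.finBasis ℝ E k)
    (sharp G (LinearMap.toContinuousLinearMap ((Module.finBasis ℝ E).coord k)))

theorem metricTrace_eq_sum_orthonormal [FiniteDimensional ℝ E] {κ : Type*} [Fintype κ]
    [DecidableEq κ] (G : E →L[ℝ] E →L[ℝ] ℝ) (T : E →ₗ[ℝ] E →ₗ[ℝ] ℝ)
    (e : Module.Basis κ ℝ E) (ε : κ → ℝ) (hε : ∀ k, ε k = 1 ∨ ε k = -1)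
    (he : ∀ j k, G (e j) (e k) = if j = k then ε k else 0) :
    metricTrace G (fun v w => T v w) = ∑ k, ε k * T (e k) (e k) := by
  have hε2 : ∀ k, ε k * ε k = 1 := fun k => by rcases hε k with h | h <;> simp [h]
  -- an explicit inverse of `G`
  have hinj : Function.Injective (G : E →L[ℝ] E →L[ℝ] ℝ) := by
    rw [injective_iff_map_eq_zero]
    intro v hv
    apply e.ext_elem
    intro k
    have h1 : G v (e k) = 0 := by simp [hv]
    rw [← e.sum_repr v] at h1
    simp only [map_sum, map_smul, sum_apply,
      smul_apply, he, smul_eq_mul, mul_ite, mul_zero,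
      Finset.sum_ite_eq', Finset.mem_univ, if_true] at h1
    have h2 := congrArg (· * ε k) h1
    simp only [mul_assoc, hε2, mul_one, zero_mul] at h2
    simpa using h2
  have hsharp : ∀ η : E →L[ℝ] ℝ, sharp G η = ∑ k, (ε k * η (e k)) • e k := by
    intro η
    have hsol : G (∑ k, (ε k * η (e k)) • e k) = η := by
      apply ContinuousLinearMap.coe_injective
      apply e.ext
      intro j
      simp only [ContinuousLinearMap.coe_coe, map_sum, map_smul, sum_apply,
        smul_apply, he, smul_eq_mul, mul_ite, mul_zero,
        Finset.sum_ite_eq', Finset.mem_univ, if_true]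
      rw [mul_right_comm, hε2, one_mul]
    have hfin : Module.finrank ℝ E = Module.finrank ℝ (E →L[ℝ] ℝ) := by
      rw [← (LinearMap.toContinuousLinearMap (𝕜 := ℝ) (E := E) (F' := ℝ)).finrank_eq]
      exact (Subspace.dual_finrank_eq (K := ℝ) (V := E)).symm
    have hinv : G.IsInvertible :=
      ⟨(LinearEquiv.ofInjectiveOfFinrankEq (G : E →ₗ[ℝ] E →L[ℝ] ℝ) hinj
        hfin).toContinuousLinearEquiv, by ext; rfl⟩
    unfold sharp
    conv_lhs => rw [← hsol]
    exact hinv.inverse_apply_eq.2 rfl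
  unfold metricTrace
  simp only [hsharp, map_sum, map_smul, smul_eq_mul]
  rw [Finset.sum_comm]
  refine Finset.sum_congr rfl fun k _ => ?_
  have hk : T (e k) (e k)
      = ∑ j, (Module.finBasis ℝ E).repr (e k) j * T (Module.finBasis ℝ E j) (e k) := by
    have h := congrArg (fun v => T v (e k)) ((Module.finBasis ℝ E).sum_repr (e k))
    simp only [map_sum, map_smul, LinearMap.sum_apply, LinearMap.smul_apply, smul_eq_mul] at h
    exact h.symm
  rw [hk, Finset.mul_sum]
  refine Finset.sum_congr rfl fun j _ => ?_
  simp [mul_assoc]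

end ScalarProduct

/-! ### Connections and curvature in one coordinate system

`G u` are the metric coefficients at the coordinate point `u : E`; vector fields are maps `E → E`. -/

section Coordinates

variable {E : Type*} [NormedAddCommGroup E] [NormedSpace ℝ E]

/-- The Christoffel symbols of `G`: `2 G(Γ(v,w), z) = ∂_v G(w,z) + ∂_w G(v,z) - ∂_z G(v,w)`. -/
def christoffel (G : E → E →L[ℝ] E →L[ℝ] ℝ) (u v w : E) : E :=
  sharp (G u) ((1 / 2 : ℝ) •
    (fderiv ℝ G u v w + fderiv ℝ G u w v - ((fderiv ℝ G u).flip v).flip w))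

/-- The Levi-Civita connection `∇_X Y` of `G`. -/
def leviCivita (G : E → E →L[ℝ] E →L[ℝ] ℝ) (X Y : E → E) : E → E := fun u =>
  fderiv ℝ Y u (X u) + christoffel G u (X u) (Y u)

/-- The connection `∇̄_X Y = ∇_X Y + λ₁ π(Y) X - λ₂ g(X, Y) P`, where `π = g(·, P)`. -/
def quarterSymmetric (G : E → E →L[ℝ] E →L[ℝ] ℝ) (P : E → E) (l₁ l₂ : ℝ) (X Y : E → E) :
    E → E := fun u =>
  leviCivita G X Y u + (l₁ * G u (Y u) (P u)) • X u - (l₂ * G u (X u) (Y u)) • P u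

/-- The curvature `R(X, Y)Z = ∇_X ∇_Y Z - ∇_Y ∇_X Z - ∇_[X,Y] Z` of a connection `D`. -/
def curvature (D : (E → E) → (E → E) → (E → E)) (X Y Z : E → E) : E → E := fun u =>
  D X (D Y Z) u - D Y (D X Z) u - D (VectorField.lieBracket ℝ X Y) Z u

/-- The Ricci tensor `Ric(v, w) = ∑ ε_k ⟨R(v, E_k)w, E_k⟩` of a connection `D`. As the curvature is
a tensor, vectors may be extended to constant coordinate fields. -/
def ricci [FiniteDimensional ℝ E] (G : E → E →L[ℝ] E →L[ℝ] ℝ)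
    (D : (E → E) → (E → E) → (E → E)) (u v w : E) : ℝ :=
  metricTrace (G u) fun z z' => G u (curvature D (fun _ => v) (fun _ => z) (fun _ => w) u) z'

/-- The Hessian `H^f(v, w) = v w f - (∇_v w) f` of a function `f`; vectors are extended to constant
coordinate fields. -/
def hessian (G : E → E →L[ℝ] E →L[ℝ] ℝ) (f : E → ℝ) (u v w : E) : ℝ :=
  fderiv ℝ (fun u' => fderiv ℝ f u' w) u v
    - fderiv ℝ f u (leviCivita G (fun _ => v) (fun _ => w) u)

end Coordinates

/-! ### Tensors at a point of a manifold without boundary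

They are computed in the preferred chart at `p`, through which Mathlib identifies `T_p M` with the
model space `E`; hence a tangent vector at `p` is its own coordinate vector. -/

section Manifold

variable {E : Type*} [NormedAddCommGroup E] [NormedSpace ℝ E]
  {H : Type*} [TopologicalSpace H] (I : ModelWithCorners ℝ E H)
  {M : Type*} [TopologicalSpace M] [ChartedSpace H M]

variable (M) in
/-- A field of bilinear forms on the tangent spaces. -/
abbrev BilinField : Type _ :=
  ∀ p : M, TangentSpace I p →L[ℝ] TangentSpace I p →L[ℝ] ℝ

variable (M) in
/-- A smooth pseudo-Riemannian metric (of any signature). -/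
structure PseudoRiemannianMetric [IsManifold I ∞ M] where
  /-- The scalar product on each tangent space. -/
  val : BilinField I M
  symm : ∀ (p : M) (v w : TangentSpace I p), val p v w = val p w v
  nondegenerate : ∀ (p : M) (v : TangentSpace I p), (∀ w, val p v w = 0) → v = 0
  contMDiff : ContMDiff I (I.prod 𝓘(ℝ, E →L[ℝ] E →L[ℝ] ℝ)) ∞
    (fun p ↦ Bundle.TotalSpace.mk' (E →L[ℝ] E →L[ℝ] ℝ)
      (E := fun p : M ↦ TangentSpace I p →L[ℝ] TangentSpace I p →L[ℝ] ℝ) p (val p))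

variable {I}

/-- The coefficients of `g` in the chart at `p`: the pullback of `g` by the inverse chart. -/
def metricInChart (g : BilinField I M) (p : M) (u : E) : E →L[ℝ] E →L[ℝ] ℝ :=
  let G : E →L[ℝ] E →L[ℝ] ℝ := g ((extChartAt I p).symm u)
  let D : E →L[ℝ] E := mfderiv 𝓘(ℝ, E) I (extChartAt I p).symm u
  G.bilinearComp D D

/-- A vector field in the chart at `p`. -/
def fieldInChart (Y : ∀ q : M, TangentSpace I q) (p : M) : E → E :=
  VectorField.mpullback 𝓘(ℝ, E) I (extChartAt I p).symm Y

/-- `(∇_v Y)(p)` for the Levi-Civita connection of `g`, a tangent vector `v` at `p` and a vector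
field `Y`. -/
def leviCivitaAt (g : BilinField I M) (p : M) (v : TangentSpace I p)
    (Y : ∀ q : M, TangentSpace I q) : TangentSpace I p :=
  leviCivita (E := E) (metricInChart g p) (fun _ => v) (fieldInChart Y p) (extChartAt I p p)

/-- The Ricci tensor at `p` of the connection `∇̄_X Y = ∇_X Y + λ₁ g(Y, P) X - λ₂ g(X, Y) P`. -/
def quarterRicci [FiniteDimensional ℝ E] (g : BilinField I M) (P : ∀ q : M, TangentSpace I q)
    (l₁ l₂ : ℝ) (p : M) (v w : TangentSpace I p) : ℝ :=
  ricci (metricInChart g p)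
    (quarterSymmetric (metricInChart g p) (fieldInChart P p) l₁ l₂) (extChartAt I p p) v w

/-- The Ricci tensor at `p` of the Levi-Civita connection of `g`. -/
def leviCivitaRicci [FiniteDimensional ℝ E] (g : BilinField I M) (p : M)
    (v w : TangentSpace I p) : ℝ :=
  ricci (metricInChart g p) (leviCivita (metricInChart g p)) (extChartAt I p p) v w

/-- The Hessian of `f : M → ℝ` at `p`. -/
def hessianAt (g : BilinField I M) (f : M → ℝ) (p : M) (v w : TangentSpace I p) : ℝ :=
  hessian (metricInChart g p) (fun u => f ((extChartAt I p).symm u)) (extChartAt I p p) v w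

/-- The Laplacian of `f : M → ℝ` at `p`, the metric trace of the Hessian. -/
def laplacianAt [FiniteDimensional ℝ E] (g : BilinField I M) (f : M → ℝ) (p : M) : ℝ :=
  metricTrace (E := E) (g p) fun v w => hessianAt g f p v w

/-- The gradient of `f : M → ℝ` at `p`. -/
def gradAt (g : BilinField I M) (f : M → ℝ) (p : M) : TangentSpace I p :=
  sharp (E := E) (g p) (mvfderiv I f p)

/-- The divergence `∑ ε_k ⟨∇_{E_k} P, E_k⟩` of a vector field `P` at `p`. -/
def divAt [FiniteDimensional ℝ E] (g : BilinField I M) (P : ∀ q : M, TangentSpace I q) (p : M) :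
    ℝ :=
  metricTrace (E := E) (g p) fun v w => g p (leviCivitaAt g p v P) w

end Manifold

/-! ### Multiply twisted products -/

section Twisted

variable {ι : Type*} [Fintype ι]
  {EB : Type*} [NormedAddCommGroup EB] [NormedSpace ℝ EB]
  {B : Type*} [TopologicalSpace B] [ChartedSpace EB B]
  {EF : ι → Type*} [∀ i, NormedAddCommGroup (EF i)] [∀ i, NormedSpace ℝ (EF i)]
  {F : ι → Type*} [∀ i, TopologicalSpace (F i)] [∀ i, ChartedSpace (EF i) (F i)]

variable (EB EF) in
/-- The model of the product manifold `B × ∏ i, F i`. -/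
abbrev productModel :
    ModelWithCorners ℝ (EB × (∀ i, EF i)) (ModelProd EB (ModelPi EF)) :=
  (𝓘(ℝ, EB)).prod (ModelWithCorners.pi fun i => 𝓘(ℝ, EF i))

/-- The metric `g_B ⊕ b₁² g_{F₁} ⊕ ⋯ ⊕ b_m² g_{F_m}` on `B × ∏ i, F i`. -/
def twistedMetric (gB : BilinField 𝓘(ℝ, EB) B) (gF : ∀ i, BilinField 𝓘(ℝ, EF i) (F i))
    (b : ∀ i, B → F i → ℝ) : BilinField (productModel EB EF) (B × (∀ i, F i)) := fun p =>
  ContinuousLinearMap.bilinearComp (E := EB) (F := EB) (gB p.1)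
      (ContinuousLinearMap.fst ℝ EB (∀ i, EF i)) (ContinuousLinearMap.fst ℝ EB (∀ i, EF i))
    + ∑ i, (b i p.1 (p.2 i)) ^ 2 •
      ContinuousLinearMap.bilinearComp (E := EF i) (F := EF i) (gF i (p.2 i))
        ((ContinuousLinearMap.proj i).comp (ContinuousLinearMap.snd ℝ EB (∀ i, EF i)))
        ((ContinuousLinearMap.proj i).comp (ContinuousLinearMap.snd ℝ EB (∀ i, EF i)))

/-- The metric `b_i(x, ·)² g_{F_i}` which the product metric induces on the fibre `F i` over `x`. -/
def fibreMetric {i : ι} (gFi : BilinField 𝓘(ℝ, EF i) (F i)) (bi : B → F i → ℝ) (x : B) :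
    BilinField 𝓘(ℝ, EF i) (F i) := fun y => (bi x y) ^ 2 • gFi y

/-- A tangent vector of `B`, seen as a tangent vector of the product. -/
def liftB {p : B × (∀ i, F i)} (X : TangentSpace 𝓘(ℝ, EB) p.1) :
    TangentSpace (productModel EB EF) p :=
  ((X, 0) : EB × (∀ i, EF i))

/-- A tangent vector of `F i`, seen as a tangent vector of the product. -/
def liftF [DecidableEq ι] {p : B × (∀ i, F i)} {i : ι} (V : TangentSpace 𝓘(ℝ, EF i) (p.2 i)) :
    TangentSpace (productModel EB EF) p :=
  ((0, Pi.single i V) : EB × (∀ i, EF i))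

end Twisted

end QuarterSymmetric

end

/-! The claim is local at `p`. With `φ i = ln b_i` the metric, read in the product chart at `p`,
becomes `g_B + Σ exp(2 φ_i) g_{F_i}`, and everything turns into a computation on a vector space.
Ricci is the trace of the endomorphism `y ↦ R(x, y)z` (`metricTrace_eq_trace`), so no orthonormal
base is needed; since the trace runs over the second argument of `R`, Hessians enter with a plus
sign.

The vector field `P` is split off first. As ∇ is metric and torsion free, the curvature of `∇̄`
differs from `R` by terms algebraic in `g`, `P` and `∇P`, each a multiple of the identity, a rank
one map or a multiple of `∇P`. Tracing gives, in dimension `N` (`ricci_quarterSymmetric`), Ric̄(x,z)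
= Ric(x,z) + ((N-1)λ₁ - λ₂) g(z,∇_x P) + λ₂ g(x,z) div P + (λ₂² - (N-1)λ₁²) π(x)π(z) + ((N-1)λ₁λ₂ -
λ₂²) π(P) g(x,z). It is used on the product and on the base; the difference of the dimensions and
div P = div_B P + Σ l_i P(φ_i) account for the terms in `P` of the base formula.

For the Levi-Civita part, Koszul's identity gives the Christoffel symbols in blocks
(`christoffelL_twistedChart`): the base is totally geodesic, Γ(X,V) = X(φ_i)V, different fibres do
not interact, and Γ(V,W) on one fibre is the symbol of the metric `exp(2 φ_i(x,·)) g_{F_i}` minus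
g(V,W) grad_B φ_i. A trace sees only the diagonal blocks of `R(x,·)z` (`trace_blocks`). Apart from
the curvatures of the base and of the fibre and from ∇ grad φ_i, these are multiples of the identity
and rank one maps; an identity and a rank one map with opposite traces per unit produce the factor
l_i - 1.

The result is stated in `b_i` through b = exp φ: H^b/b = H^φ + dφ⊗dφ, grad b = b grad φ and Δb/b =
div grad φ + |grad φ|². The passage to manifolds rests on two facts: only germs of the metric and of
`P` matter, and the derivative of the inverse chart at its centre is the identity of the tangent
space. -/

noncomputable section

namespace QuarterSymmetric

open Filter Topology

set_option maxSynthPendingDepth 3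
set_option linter.unusedSectionVars false

/-! ### Musical isomorphisms and traces -/

section LinearAlgebra

variable {E : Type*} [NormedAddCommGroup E] [NormedSpace ℝ E]

theorem sharp_apply {G : E →L[ℝ] E →L[ℝ] ℝ} (hG : G.IsInvertible) (η : E →L[ℝ] ℝ) :
    G (sharp G η) = η :=
  hG.self_apply_inverse η

theorem sharp_eq {G : E →L[ℝ] E →L[ℝ] ℝ} (hG : G.IsInvertible) {η : E →L[ℝ] ℝ} {v : E}
    (h : ∀ w, G v w = η w) : sharp G η = v :=
  (hG.inverse_apply_eq).2 (ContinuousLinearMap.ext fun w => (h w).symm)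

theorem isInvertible_of_nondegenerate [FiniteDimensional ℝ E] {G : E →L[ℝ] E →L[ℝ] ℝ}
    (h : ∀ v, (∀ w, G v w = 0) → v = 0) : G.IsInvertible := by
  have hinj : Function.Injective (G : E →ₗ[ℝ] E →L[ℝ] ℝ) := by
    rw [injective_iff_map_eq_zero]
    intro v hv
    refine h v fun w => ?_
    have : G v = 0 := hv
    simp [this]
  have hfin : Module.finrank ℝ E = Module.finrank ℝ (E →L[ℝ] ℝ) := by
    rw [← (LinearMap.toContinuousLinearMap (𝕜 := ℝ) (E := E) (F' := ℝ)).finrank_eq]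
    exact (Subspace.dual_finrank_eq (K := ℝ) (V := E)).symm
  exact ⟨(LinearEquiv.ofInjectiveOfFinrankEq (G : E →ₗ[ℝ] E →L[ℝ] ℝ) hinj
    hfin).toContinuousLinearEquiv, by ext; rfl⟩

/-- The metric trace of `⟨L ·, ·⟩` is the trace of the endomorphism `L`. -/
theorem metricTrace_eq_trace [FiniteDimensional ℝ E] {G : E →L[ℝ] E →L[ℝ] ℝ}
    (hG : G.IsInvertible) (hs : ∀ v w, G v w = G w v) (L : E →ₗ[ℝ] E) :
    metricTrace G (fun v w => G (L v) w) = LinearMap.trace ℝ E L := by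
  rw [LinearMap.trace_eq_matrix_trace ℝ (Module.finBasis ℝ E), Matrix.trace]
  unfold metricTrace
  refine Finset.sum_congr rfl fun k _ => ?_
  beta_reduce
  rw [hs, sharp_apply hG]
  simp [LinearMap.toMatrix_apply]

theorem trace_smulRight [FiniteDimensional ℝ E] (η : E →ₗ[ℝ] ℝ) (v : E) :
    LinearMap.trace ℝ E (η.smulRight v) = η v := by
  simp

/-- Resolving the identity of the product into its projections writes `L` as a sum of maps that
factor through a single factor; cyclicity of the trace moves each of them onto that factor, and the
off-diagonal blocks drop out. -/
theorem trace_prod_pi {ι : Type*} [Fintype ι] [DecidableEq ι]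
    {EB : Type*} [AddCommGroup EB] [Module ℝ EB] [FiniteDimensional ℝ EB]
    {EF : ι → Type*} [∀ i, AddCommGroup (EF i)] [∀ i, Module ℝ (EF i)]
    [∀ i, FiniteDimensional ℝ (EF i)]
    (L : (EB × (∀ i, EF i)) →ₗ[ℝ] (EB × (∀ i, EF i))) :
    LinearMap.trace ℝ _ L
      = LinearMap.trace ℝ _ (LinearMap.fst ℝ EB (∀ i, EF i) ∘ₗ L ∘ₗ LinearMap.inl ℝ EB (∀ i, EF i))
        + ∑ i, LinearMap.trace ℝ _ ((LinearMap.proj i ∘ₗ LinearMap.snd ℝ EB (∀ i, EF i)) ∘ₗ L ∘ₗ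
            (LinearMap.inr ℝ EB (∀ i, EF i) ∘ₗ LinearMap.single ℝ EF i)) := by
  have h1 : L = (L ∘ₗ LinearMap.inl ℝ EB (∀ i, EF i)) ∘ₗ LinearMap.fst ℝ EB (∀ i, EF i)
      + ∑ i, (L ∘ₗ (LinearMap.inr ℝ EB (∀ i, EF i) ∘ₗ LinearMap.single ℝ EF i)) ∘ₗ
          (LinearMap.proj i ∘ₗ LinearMap.snd ℝ EB (∀ i, EF i)) := by
    refine LinearMap.ext fun v => ?_
    simp only [LinearMap.add_apply, LinearMap.sum_apply, LinearMap.comp_apply]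
    rw [← map_sum, ← map_add]
    congr 1
    refine Prod.ext (by simp [Prod.fst_sum])
      (by simp [Prod.snd_sum, LinearMap.single_apply, LinearMap.sum_single_apply])
  conv_lhs => rw [h1]
  rw [map_add, map_sum, LinearMap.trace_comp_comm']
  congr 1
  refine Finset.sum_congr rfl fun i _ => ?_
  rw [LinearMap.trace_comp_comm']

end LinearAlgebra

/-! ### Levi-Civita and quarter-symmetric curvature in one chart -/

section Chart

variable {E : Type*} [NormedAddCommGroup E] [NormedSpace ℝ E]

/-- Near `u`, the coefficients `G` are those of a pseudo-Riemannian metric of class `C²`. -/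
structure IsMetricAt (G : E → E →L[ℝ] E →L[ℝ] ℝ) (u : E) : Prop where
  symm : ∀ᶠ u' in 𝓝 u, ∀ v w, G u' v w = G u' w v
  inv : (G u).IsInvertible
  smooth : ContDiffAt ℝ 2 G u

theorem eventually_isInvertible [CompleteSpace E] {F : Type*} [NormedAddCommGroup F]
    [NormedSpace ℝ F] {X : Type*} [TopologicalSpace X] {A : X → (E →L[ℝ] F)} {u : X}
    (hA : ContinuousAt A u) (h : (A u).IsInvertible) :
    ∀ᶠ u' in 𝓝 u, (A u').IsInvertible := by
  obtain ⟨e, he⟩ := h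
  have h : ∀ᶠ a in 𝓝 (A u), a ∈ Set.range ((↑) : (E ≃L[ℝ] F) → E →L[ℝ] F) :=
    he ▸ ContinuousLinearEquiv.nhds e
  have := hA.eventually h
  filter_upwards [this] with u' hu'
  obtain ⟨e', he'⟩ := hu'
  exact ⟨e', he'⟩

namespace IsMetricAt

variable {G : E → E →L[ℝ] E →L[ℝ] ℝ} {u : E}

theorem eventually [CompleteSpace E] (hG : IsMetricAt G u) : ∀ᶠ u' in 𝓝 u, IsMetricAt G u' := by
  filter_upwards [hG.symm.eventually_nhds, hG.smooth.eventually (by simp),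
    eventually_isInvertible hG.smooth.continuousAt hG.inv] with u' h1 h2 h3
  exact ⟨h1, h3, h2⟩

theorem congr {G' : E → E →L[ℝ] E →L[ℝ] ℝ} (hG : IsMetricAt G u) (h : G' =ᶠ[𝓝 u] G) :
    IsMetricAt G' u := by
  refine ⟨?_, h.self_of_nhds ▸ hG.inv, hG.smooth.congr_of_eventuallyEq h⟩
  filter_upwards [hG.symm, h] with u' h1 h2
  rw [h2]
  exact h1

theorem symm_self (hG : IsMetricAt G u) (v w : E) : G u v w = G u w v :=
  hG.symm.self_of_nhds v w

theorem differentiableAt (hG : IsMetricAt G u) : DifferentiableAt ℝ G u :=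
  hG.smooth.differentiableAt (by simp)

theorem fderiv_apply₂ (hG : IsMetricAt G u) (x v w : E) :
    fderiv ℝ (fun u' => G u' v w) u x = fderiv ℝ G u x v w := by
  have h := (hG.differentiableAt.hasFDerivAt.clm_apply (hasFDerivAt_const v u)).clm_apply
    (hasFDerivAt_const w u)
  rw [h.fderiv]
  simp

theorem fderiv_symm (hG : IsMetricAt G u) (x v w : E) :
    fderiv ℝ G u x v w = fderiv ℝ G u x w v := by
  rw [← hG.fderiv_apply₂, ← hG.fderiv_apply₂]
  refine congrArg (fun A : E →L[ℝ] ℝ => A x) (Filter.EventuallyEq.fderiv_eq ?_)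
  filter_upwards [hG.symm] with u' h
  exact h v w

end IsMetricAt

/-- The Christoffel symbols of `G` as a continuous bilinear map. -/
def christoffelL (G : E → E →L[ℝ] E →L[ℝ] ℝ) (u : E) : E →L[ℝ] E →L[ℝ] E :=
  (ContinuousLinearMap.compL ℝ E (E →L[ℝ] ℝ) E (G u).inverse).comp
    ((1 / 2 : ℝ) • (fderiv ℝ G u + (fderiv ℝ G u).flip
      - (ContinuousLinearMap.flipₗᵢ ℝ E E ℝ :
          (E →L[ℝ] E →L[ℝ] ℝ) ≃ₗᵢ[ℝ] _).toContinuousLinearEquiv.toContinuousLinearMap.comp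
            (fderiv ℝ G u).flip))

theorem christoffelL_apply (G : E → E →L[ℝ] E →L[ℝ] ℝ) (u v w : E) :
    christoffelL G u v w = christoffel G u v w := by
  simp [christoffelL, christoffel, sharp]

theorem christoffel_congr {G G' : E → E →L[ℝ] E →L[ℝ] ℝ} {u : E} (h : G' =ᶠ[𝓝 u] G) :
    christoffel G' =ᶠ[𝓝 u] christoffel G := by
  filter_upwards [h.eventuallyEq_nhds] with u' h
  funext v w
  simp only [christoffel, h.fderiv_eq, h.self_of_nhds]

namespace IsMetricAt

variable {G : E → E →L[ℝ] E →L[ℝ] ℝ} {u : E}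

theorem differentiableAt_christoffelL [CompleteSpace E] (hG : IsMetricAt G u) :
    DifferentiableAt ℝ (christoffelL G) u := by
  have h1 : DifferentiableAt ℝ (fun u => (G u).inverse) u :=
    ((hG.inv.contDiffAt_map_inverse (n := 2)).comp u hG.smooth).differentiableAt (by simp)
  have h2 : DifferentiableAt ℝ (fderiv ℝ G) u :=
    (hG.smooth.fderiv_right (m := 1) (by norm_num)).differentiableAt (by simp)
  have h3 : DifferentiableAt ℝ (fun u => (fderiv ℝ G u).flip) u :=
    (ContinuousLinearMap.flipₗᵢ ℝ E E (E →L[ℝ] ℝ)).toContinuousLinearEquiv.differentiableAt.comp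
      u h2
  have h4 : DifferentiableAt ℝ (fun u => (ContinuousLinearMap.flipₗᵢ ℝ E E ℝ :
      (E →L[ℝ] E →L[ℝ] ℝ) ≃ₗᵢ[ℝ] _).toContinuousLinearEquiv.toContinuousLinearMap.comp
            (fderiv ℝ G u).flip) u := (differentiableAt_const _).clm_comp h3
  have h5 : DifferentiableAt ℝ
      (fun u => ContinuousLinearMap.compL ℝ E (E →L[ℝ] ℝ) E (G u).inverse) u :=
    (ContinuousLinearMap.differentiableAt _).comp u h1
  exact h5.clm_comp (((h2.add h3).sub h4).const_smul (1 / 2 : ℝ))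

theorem apply_christoffel (hG : IsMetricAt G u) (v w z : E) :
    G u (christoffel G u v w) z
      = 1 / 2 * (fderiv ℝ G u v w z + fderiv ℝ G u w v z - fderiv ℝ G u z v w) := by
  rw [christoffel, sharp_apply hG.inv]
  simp

/-- Nondegeneracy makes Koszul's identity a uniqueness test. The symbols of conformal and of twisted
metrics are found below by verifying a candidate with it. -/
theorem christoffel_eq (hG : IsMetricAt G u) {v w c : E}
    (h : ∀ z, G u c z
      = 1 / 2 * (fderiv ℝ G u v w z + fderiv ℝ G u w v z - fderiv ℝ G u z v w)) :
    christoffel G u v w = c := by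
  refine sharp_eq hG.inv fun z => ?_
  rw [h]
  simp

theorem christoffel_symm (hG : IsMetricAt G u) (v w : E) :
    christoffel G u v w = christoffel G u w v := by
  refine hG.christoffel_eq fun z => ?_
  rw [hG.apply_christoffel, hG.fderiv_symm z v w]
  ring

/-- Metric compatibility of ∇: in the sum of the two Koszul expressions all derivatives cancel
except the one along `x`. -/
theorem fderiv_eq_christoffel (hG : IsMetricAt G u) (x v w : E) :
    fderiv ℝ G u x v w = G u (christoffel G u x v) w + G u v (christoffel G u x w) := by
  rw [hG.symm_self v, hG.apply_christoffel, hG.apply_christoffel, hG.fderiv_symm x w v,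
    hG.fderiv_symm v x w, hG.fderiv_symm w x v]
  ring

end IsMetricAt

/-- The covariant derivative `v ↦ ∇_v Y` at `u`. -/
def covDeriv (G : E → E →L[ℝ] E →L[ℝ] ℝ) (Y : E → E) (u : E) : E →L[ℝ] E :=
  fderiv ℝ Y u + (christoffelL G u).flip (Y u)

theorem covDeriv_apply (G : E → E →L[ℝ] E →L[ℝ] ℝ) (Y : E → E) (u v : E) :
    covDeriv G Y u v = leviCivita G (fun _ => v) Y u := by
  simp [covDeriv, leviCivita, christoffelL_apply]

/-- The endomorphism `y ↦ R(x, y)z` for the connection with Christoffel symbols `Γ`. -/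
def curvatureEnd (Γ : E → E →L[ℝ] E →L[ℝ] E) (u x z : E) : E →L[ℝ] E :=
  (fderiv ℝ Γ u x).flip z - ((fderiv ℝ Γ u).flip x).flip z
    + (Γ u x).comp ((Γ u).flip z) - (Γ u).flip (Γ u x z)

theorem curvatureEnd_apply {Γ : E → E →L[ℝ] E →L[ℝ] E} {u : E} (hΓ : DifferentiableAt ℝ Γ u)
    (x y z : E) :
    curvatureEnd Γ u x z y = fderiv ℝ (fun u' => Γ u' y z) u x - fderiv ℝ (fun u' => Γ u' x z) u y
      + Γ u x (Γ u y z) - Γ u y (Γ u x z) := by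
  have key : ∀ a b c, fderiv ℝ (fun u' => Γ u' a b) u c = fderiv ℝ Γ u c a b := fun a b c => by
    have h := (hΓ.hasFDerivAt.clm_apply (hasFDerivAt_const a u)).clm_apply (hasFDerivAt_const b u)
    rw [h.fderiv]
    simp
  rw [key, key]
  simp [curvatureEnd]

/-- A linear projection commutes with differentiation, so one component of the curvature can be
computed from closed formulas for the same component of the symbols, as long as these hold on a
neighbourhood. -/
theorem map_curvatureEnd {Γ : E → E →L[ℝ] E →L[ℝ] E} {u : E} (hΓ : DifferentiableAt ℝ Γ u)
    {F : Type*} [NormedAddCommGroup F] [NormedSpace ℝ F] (p : E →L[ℝ] F) {x y z : E}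
    {f g : E → F} (hf : (fun u' => p (Γ u' y z)) =ᶠ[𝓝 u] f)
    (hg : (fun u' => p (Γ u' x z)) =ᶠ[𝓝 u] g) :
    p (curvatureEnd Γ u x z y)
      = fderiv ℝ f u x - fderiv ℝ g u y + p (Γ u x (Γ u y z)) - p (Γ u y (Γ u x z)) := by
  have hd : ∀ a b, DifferentiableAt ℝ (fun u' => Γ u' a b) u := fun a b =>
    (hΓ.clm_apply (differentiableAt_const a)).clm_apply (differentiableAt_const b)
  have key : ∀ a b c, p (fderiv ℝ (fun u' => Γ u' a b) u c)
      = fderiv ℝ (fun u' => p (Γ u' a b)) u c := fun a b c => by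
    have h := p.hasFDerivAt.comp u (hd a b).hasFDerivAt
    rw [show (fun u' => p (Γ u' a b)) = p ∘ fun u' => Γ u' a b from rfl, h.fderiv]
    rfl
  rw [curvatureEnd_apply hΓ, map_sub, map_add, map_sub, key, key, hf.fderiv_eq, hg.fderiv_eq]

/-- Constant fields commute. As `D` is an arbitrary operation, the vanishing of `D` along the zero
field has to be assumed. -/
theorem curvature_const (D : (E → E) → (E → E) → (E → E)) (u x y z : E)
    (h0 : D 0 (fun _ => z) u = 0) :
    curvature D (fun _ => x) (fun _ => y) (fun _ => z) u
      = D (fun _ => x) (D (fun _ => y) (fun _ => z)) u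
        - D (fun _ => y) (D (fun _ => x) (fun _ => z)) u := by
  have : VectorField.lieBracket ℝ (fun _ : E => x) (fun _ => y) = 0 := by
    funext u
    simp [VectorField.lieBracket]
  simp [curvature, this, h0]

theorem leviCivita_const (G : E → E →L[ℝ] E →L[ℝ] ℝ) (x z : E) :
    leviCivita G (fun _ => x) (fun _ => z) = fun u => christoffelL G u x z := by
  funext u
  simp [leviCivita, christoffelL_apply]

variable [FiniteDimensional ℝ E]

theorem curvature_leviCivita {G : E → E →L[ℝ] E →L[ℝ] ℝ} {u : E} (hG : IsMetricAt G u)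
    (x y z : E) :
    curvature (leviCivita G) (fun _ => x) (fun _ => y) (fun _ => z) u
      = curvatureEnd (christoffelL G) u x z y := by
  have := FiniteDimensional.complete ℝ E
  rw [curvature_const _ _ _ _ _ (by simp [leviCivita, ← christoffelL_apply]),
    curvatureEnd_apply hG.differentiableAt_christoffelL, leviCivita_const, leviCivita_const]
  simp only [leviCivita, ← christoffelL_apply]
  abel

theorem ricci_leviCivita {G : E → E →L[ℝ] E →L[ℝ] ℝ} {u : E} (hG : IsMetricAt G u) (x z : E) :
    ricci G (leviCivita G) u x z
      = LinearMap.trace ℝ E (curvatureEnd (christoffelL G) u x z).toLinearMap := by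
  rw [← metricTrace_eq_trace hG.inv hG.symm_self]
  simp only [ricci, curvature_leviCivita hG, ContinuousLinearMap.coe_coe]

/-- After expansion, metric compatibility replaces the derivatives of `G` by symbols; these complete
the derivatives of `P` to covariant ones, and what is left is antisymmetric algebra in `x` and `y`.
-/
theorem curvature_quarterSymmetric {G : E → E →L[ℝ] E →L[ℝ] ℝ} {P : E → E} {u : E}
    (hG : IsMetricAt G u) (hP : DifferentiableAt ℝ P u) (l₁ l₂ : ℝ) (x y z : E) :
    curvature (quarterSymmetric G P l₁ l₂) (fun _ => x) (fun _ => y) (fun _ => z) u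
      = curvatureEnd (christoffelL G) u x z y
        + (l₁ * G u z (covDeriv G P u x)) • y - (l₁ * G u z (covDeriv G P u y)) • x
        - (l₂ * G u y z) • covDeriv G P u x + (l₂ * G u x z) • covDeriv G P u y
        + (l₁ ^ 2 * G u z (P u)) • (G u y (P u) • x - G u x (P u) • y)
        - (l₁ * l₂ * G u (P u) (P u)) • (G u y z • x - G u x z • y)
        + (l₂ ^ 2) • ((G u y z * G u x (P u) - G u x z * G u y (P u)) • P u) := by
  have := FiniteDimensional.complete ℝ E
  have hΓ := hG.differentiableAt_christoffelL
  rw [curvature_const _ _ _ _ _ (by simp [quarterSymmetric, leviCivita, ← christoffelL_apply]),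
    curvatureEnd_apply hΓ]
  have hq : ∀ y, quarterSymmetric G P l₁ l₂ (fun _ => y) (fun _ => z)
      = fun u => christoffelL G u y z + (l₁ * G u z (P u)) • y - (l₂ * G u y z) • P u :=
    fun y => by
      funext u
      simp [quarterSymmetric, leviCivita_const]
  have hd : ∀ x y, fderiv ℝ
      (fun u => christoffelL G u y z + (l₁ * G u z (P u)) • y - (l₂ * G u y z) • P u) u x
      = fderiv ℝ (fun u' => christoffelL G u' y z) u x
        + (l₁ * (fderiv ℝ G u x z (P u) + G u z (fderiv ℝ P u x))) • y
        - ((l₂ * fderiv ℝ G u x y z) • P u + (l₂ * G u y z) • fderiv ℝ P u x) := by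
    intro x y
    have h1 : HasFDerivAt (fun u' => christoffelL G u' y z) _ u :=
      ((hΓ.clm_apply (differentiableAt_const y)).clm_apply (differentiableAt_const z)).hasFDerivAt
    have h2 := (hG.differentiableAt.hasFDerivAt.clm_apply (hasFDerivAt_const z u)).clm_apply
      hP.hasFDerivAt
    have h3 := (hG.differentiableAt.hasFDerivAt.clm_apply (hasFDerivAt_const y u)).clm_apply
      (hasFDerivAt_const z u)
    have h := (h1.add ((h2.const_mul l₁).smul_const y)).sub ((h3.const_mul l₂).smul hP.hasFDerivAt)
    have h' := h.fderiv
    simp only [Pi.add_def, Pi.sub_def, Pi.smul_def'] at h'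
    rw [h']
    simp
    module
  have hsz : ∀ v, G u v z = G u z v := fun v => hG.symm_self v z
  rw [hq, hq]
  -- Torsion-freeness: the terms G(Γ(x,y), z), which come from differentiating `G u y z` and `G u x
  -- z`, cancel under antisymmetrisation.
  have hc : christoffelL G u y x = christoffelL G u x y := by
    simp only [christoffelL_apply, hG.christoffel_symm y x]
  simp only [quarterSymmetric, leviCivita, hd, ← christoffelL_apply, covDeriv,
    hG.fderiv_eq_christoffel, map_add, map_sub, map_smul, add_apply, sub_apply,
    smul_apply, ContinuousLinearMap.flip_apply, smul_eq_mul, hc, hG.symm_self y x, hsz]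
  module

/-- Each factor N - 1 is the trace N of an identity map minus the trace of the rank one map paired
with it. The single λ₂ and λ₂² terms come from rank one maps in the directions ∇_x P and `P`, and
div P is the trace of ∇P. -/
theorem ricci_quarterSymmetric {G : E → E →L[ℝ] E →L[ℝ] ℝ} {P : E → E} {u : E}
    (hG : IsMetricAt G u) (hP : DifferentiableAt ℝ P u) (l₁ l₂ : ℝ) (x z : E) :
    ricci G (quarterSymmetric G P l₁ l₂) u x z
      = LinearMap.trace ℝ E (curvatureEnd (christoffelL G) u x z).toLinearMap
        + ((Module.finrank ℝ E - 1) * l₁ - l₂) * G u z (covDeriv G P u x)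
        + l₂ * G u x z * LinearMap.trace ℝ E (covDeriv G P u).toLinearMap
        + (l₂ ^ 2 - (Module.finrank ℝ E - 1) * l₁ ^ 2) * (G u x (P u) * G u z (P u))
        + ((Module.finrank ℝ E - 1) * l₁ * l₂ - l₂ ^ 2) * (G u (P u) (P u) * G u x z) := by
  have key : ricci G (quarterSymmetric G P l₁ l₂) u x z = metricTrace (G u) fun v w => G u
      (((curvatureEnd (christoffelL G) u x z).toLinearMap
        + (l₁ * G u z (covDeriv G P u x)) • LinearMap.id
        - l₁ • ((G u z).toLinearMap ∘ₗ (covDeriv G P u).toLinearMap).smulRight x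
        - l₂ • (G u z).toLinearMap.smulRight (covDeriv G P u x)
        + (l₂ * G u x z) • (covDeriv G P u).toLinearMap
        + (l₁ ^ 2 * G u z (P u)) • ((G u (P u)).toLinearMap.smulRight x
            - G u x (P u) • LinearMap.id)
        - (l₁ * l₂ * G u (P u) (P u)) • ((G u z).toLinearMap.smulRight x
            - G u x z • LinearMap.id)
        + (l₂ ^ 2) • ((G u x (P u) • (G u z).toLinearMap
            - G u x z • (G u (P u)).toLinearMap).smulRight (P u)) : E →ₗ[ℝ] E) v) w := by
    unfold ricci
    congr 1
    funext v w
    rw [curvature_quarterSymmetric hG hP]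
    congr 2
    simp [hG.symm_self v, mul_smul, mul_comm]
  rw [key, metricTrace_eq_trace hG.inv hG.symm_self]
  simp only [map_add, map_sub, map_smul, trace_smulRight, LinearMap.trace_id, smul_eq_mul,
    LinearMap.comp_apply, ContinuousLinearMap.coe_coe, LinearMap.sub_apply, LinearMap.smul_apply,
    hG.symm_self z x, hG.symm_self (P u) x]
  ring

end Chart

/-! ### Conformal change and pullback of scalar products -/

section Conformal

variable {E : Type*} [NormedAddCommGroup E] [NormedSpace ℝ E]

theorem hasFDerivAt_exp_smul {V : Type*} [NormedAddCommGroup V] [NormedSpace ℝ V]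
    {A : E → V} {f : E → ℝ} {u : E} (hA : DifferentiableAt ℝ A u) (hf : DifferentiableAt ℝ f u) :
    HasFDerivAt (fun u => Real.exp (2 * f u) • A u)
      (Real.exp (2 * f u) • (fderiv ℝ A u + (2 : ℝ) • (fderiv ℝ f u).smulRight (A u))) u := by
  have h := ((hf.hasFDerivAt.const_mul 2).exp).smul hA.hasFDerivAt
  refine h.congr_fderiv ?_
  ext v
  simp
  module

theorem IsMetricAt.conformal {G : E → E →L[ℝ] E →L[ℝ] ℝ} {f : E → ℝ} {u : E}
    (hG : IsMetricAt G u) (hf : ContDiffAt ℝ 2 f u) :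
    IsMetricAt (fun u => Real.exp (2 * f u) • G u) u := by
  refine ⟨?_, ?_, ?_⟩
  · filter_upwards [hG.symm] with u' h v w
    simp [h v w]
  · obtain ⟨e, he⟩ := hG.inv
    refine ⟨(ContinuousLinearEquiv.smulLeft (Units.mk0 (Real.exp (2 * f u))
      (Real.exp_ne_zero _))).trans e, ?_⟩
    ext v w
    simp [← he]
  · exact ((contDiffAt_const.mul hf).exp).smul hG.smooth

/-- Differentiating the factor exp(2f) adds 2 df ⊗ G to the derivative of the metric. The three
Koszul terms turn this into the three corrections, the last of them a gradient because its free
index sits on df. -/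
theorem IsMetricAt.christoffel_conformal {G : E → E →L[ℝ] E →L[ℝ] ℝ} {f : E → ℝ} {u : E}
    (hG : IsMetricAt G u) (hf : ContDiffAt ℝ 2 f u) (v w : E) :
    christoffel (fun u => Real.exp (2 * f u) • G u) u v w
      = christoffel G u v w + fderiv ℝ f u v • w + fderiv ℝ f u w • v
        - G u v w • sharp (G u) (fderiv ℝ f u) := by
  refine (hG.conformal hf).christoffel_eq fun z => ?_
  rw [(hasFDerivAt_exp_smul hG.differentiableAt (hf.differentiableAt (by simp))).fderiv]
  simp [hG.apply_christoffel, sharp_apply hG.inv]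
  ring

/-- The pullback of bilinear forms along `A`, as a continuous linear map. -/
def pullbackL {F : Type*} [NormedAddCommGroup F] [NormedSpace ℝ F] (A : E →L[ℝ] F) :
    (F →L[ℝ] F →L[ℝ] ℝ) →L[ℝ] (E →L[ℝ] E →L[ℝ] ℝ) :=
  (ContinuousLinearMap.flipₗᵢ ℝ E E ℝ).toContinuousLinearEquiv.toContinuousLinearMap.comp
    (((ContinuousLinearMap.compL ℝ E F (E →L[ℝ] ℝ)).flip A).comp
      ((ContinuousLinearMap.flipₗᵢ ℝ E F ℝ).toContinuousLinearEquiv.toContinuousLinearMap.comp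
        ((ContinuousLinearMap.compL ℝ E F (F →L[ℝ] ℝ)).flip A)))

theorem pullbackL_apply {F : Type*} [NormedAddCommGroup F] [NormedSpace ℝ F] (A : E →L[ℝ] F)
    (B : F →L[ℝ] F →L[ℝ] ℝ) : pullbackL A B = B.bilinearComp A A := by
  ext v w
  simp [pullbackL]

end Conformal

/-! ### The twisted metric on a product of vector spaces and its Christoffel symbols -/

section Twisted

variable {ι : Type*}
  {EB : Type*} [NormedAddCommGroup EB] [NormedSpace ℝ EB]
  {EF : ι → Type*} [∀ i, NormedAddCommGroup (EF i)] [∀ i, NormedSpace ℝ (EF i)]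

variable (EB EF) in
/-- The projection of the product to its base and the fibre of index `i`. -/
def pairProj (i : ι) : EB × (∀ i, EF i) →L[ℝ] EB × EF i :=
  (ContinuousLinearMap.fst ℝ EB (∀ i, EF i)).prod
    ((ContinuousLinearMap.proj i).comp (ContinuousLinearMap.snd ℝ EB (∀ i, EF i)))

@[simp]
theorem pairProj_apply (i : ι) (u : EB × (∀ i, EF i)) : pairProj EB EF i u = (u.1, u.2 i) := rfl

variable [Fintype ι]

/-- The coefficients of `g_B ⊕ exp(2 φ₁) g_{F₁} ⊕ ⋯ ⊕ exp(2 φ_m) g_{F_m}`. -/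
def twistedChart (GB : EB → EB →L[ℝ] EB →L[ℝ] ℝ) (GF : ∀ i, EF i → EF i →L[ℝ] EF i →L[ℝ] ℝ)
    (φ : ∀ i, EB × EF i → ℝ) (u : EB × (∀ i, EF i)) :
    EB × (∀ i, EF i) →L[ℝ] EB × (∀ i, EF i) →L[ℝ] ℝ :=
  (GB u.1).bilinearComp (ContinuousLinearMap.fst ℝ EB (∀ i, EF i))
      (ContinuousLinearMap.fst ℝ EB (∀ i, EF i))
    + ∑ i, Real.exp (2 * φ i (u.1, u.2 i)) •
      (GF i (u.2 i)).bilinearComp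
        ((ContinuousLinearMap.proj i).comp (ContinuousLinearMap.snd ℝ EB (∀ i, EF i)))
        ((ContinuousLinearMap.proj i).comp (ContinuousLinearMap.snd ℝ EB (∀ i, EF i)))

variable {GB : EB → EB →L[ℝ] EB →L[ℝ] ℝ} {GF : ∀ i, EF i → EF i →L[ℝ] EF i →L[ℝ] ℝ}
  {φ : ∀ i, EB × EF i → ℝ} {u : EB × (∀ i, EF i)}

theorem twistedChart_apply (v w : EB × (∀ i, EF i)) :
    twistedChart GB GF φ u v w = GB u.1 v.1 w.1
      + ∑ i, Real.exp (2 * φ i (u.1, u.2 i)) * GF i (u.2 i) (v.2 i) (w.2 i) := by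
  simp [twistedChart]

/-- The data of a multiply twisted product are of class `C²` near `u`. -/
structure IsTwistedAt (GB : EB → EB →L[ℝ] EB →L[ℝ] ℝ)
    (GF : ∀ i, EF i → EF i →L[ℝ] EF i →L[ℝ] ℝ) (φ : ∀ i, EB × EF i → ℝ)
    (u : EB × (∀ i, EF i)) : Prop where
  base : IsMetricAt GB u.1
  fibre : ∀ i, IsMetricAt (GF i) (u.2 i)
  smooth : ∀ i, ContDiffAt ℝ 2 (φ i) (u.1, u.2 i)

/-- The gradient of `φ i` along the base. -/
def baseGrad (GB : EB → EB →L[ℝ] EB →L[ℝ] ℝ) {V : Type*} [NormedAddCommGroup V]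
    [NormedSpace ℝ V] (f : EB × V → ℝ) (q : EB × V) : EB :=
  sharp (GB q.1) ((fderiv ℝ f q).comp (ContinuousLinearMap.inl ℝ EB V))

/-- The Christoffel symbols of the fibre metric `exp(2 f(x, ·)) G` at `q = (x, y)`. -/
def fibreChristoffel {V : Type*} [NormedAddCommGroup V]
    [NormedSpace ℝ V] (G : V → V →L[ℝ] V →L[ℝ] ℝ) (f : EB × V → ℝ) (q : EB × V) (v w : V) : V :=
  christoffelL G q.2 v w + fderiv ℝ f q (0, v) • w + fderiv ℝ f q (0, w) • v
    - G q.2 v w • sharp (G q.2) ((fderiv ℝ f q).comp (ContinuousLinearMap.inr ℝ EB V))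

/-- With the base point frozen, the fibre metric is a conformal change with exponent `f (q.1, ·)`,
whose differential is the fibre part of that of `f`. The explicit right-hand side depends on both
variables and can also be differentiated along the base. -/
theorem christoffel_fibre {V : Type*} [NormedAddCommGroup V]
    [NormedSpace ℝ V] {G : V → V →L[ℝ] V →L[ℝ] ℝ} {f : EB × V → ℝ} {q : EB × V}
    (hG : IsMetricAt G q.2) (hf : ContDiffAt ℝ 2 f q) (v w : V) :
    christoffel (fun y => Real.exp (2 * f (q.1, y)) • G y) q.2 v w
      = fibreChristoffel G f q v w := by
  have h1 : ContDiffAt ℝ 2 (fun y => f (q.1, y)) q.2 :=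
    hf.comp (f := fun y => (q.1, y)) q.2 (contDiffAt_const.prodMk contDiffAt_id)
  have h2 : fderiv ℝ (fun y => f (q.1, y)) q.2
      = (fderiv ℝ f q).comp (ContinuousLinearMap.inr ℝ EB V) :=
    ((hf.differentiableAt (by simp)).hasFDerivAt.comp (f := fun y => (q.1, y)) q.2
      (hasFDerivAt_prodMk_right q.1 q.2)).fderiv
  rw [hG.christoffel_conformal h1, h2]
  simp [fibreChristoffel, christoffelL_apply]

namespace IsTwistedAt

theorem smooth' (h : IsTwistedAt GB GF φ u) (i : ι) :
    ContDiffAt ℝ 2 (fun u : EB × (∀ i, EF i) => φ i (u.1, u.2 i)) u :=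
  (h.smooth i).comp u (pairProj EB EF i).contDiff.contDiffAt

theorem hasFDerivAt_twistedChart (h : IsTwistedAt GB GF φ u) :
    HasFDerivAt (twistedChart GB GF φ)
      ((pullbackL (ContinuousLinearMap.fst ℝ EB (∀ i, EF i))).comp
          ((fderiv ℝ GB u.1).comp (ContinuousLinearMap.fst ℝ EB (∀ i, EF i)))
        + ∑ i, (Real.exp (2 * φ i (u.1, u.2 i)) •
          ((pullbackL ((ContinuousLinearMap.proj i).comp
              (ContinuousLinearMap.snd ℝ EB (∀ i, EF i)))).comp
            ((fderiv ℝ (GF i) (u.2 i)).comp ((ContinuousLinearMap.proj i).comp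
              (ContinuousLinearMap.snd ℝ EB (∀ i, EF i))))
          + (2 : ℝ) • ((fderiv ℝ (φ i) (u.1, u.2 i)).comp (pairProj EB EF i)).smulRight
            (pullbackL ((ContinuousLinearMap.proj i).comp
              (ContinuousLinearMap.snd ℝ EB (∀ i, EF i))) (GF i (u.2 i)))))) u := by
  have h1 : HasFDerivAt (fun u : EB × (∀ i, EF i) =>
      pullbackL (ContinuousLinearMap.fst ℝ EB (∀ i, EF i)) (GB u.1)) _ u :=
    (pullbackL (ContinuousLinearMap.fst ℝ EB (∀ i, EF i))).hasFDerivAt.comp u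
      (h.base.differentiableAt.hasFDerivAt.comp u
        (ContinuousLinearMap.fst ℝ EB (∀ i, EF i)).hasFDerivAt)
  have h2 : ∀ i, HasFDerivAt (fun u : EB × (∀ i, EF i) =>
      pullbackL ((ContinuousLinearMap.proj i).comp
        (ContinuousLinearMap.snd ℝ EB (∀ i, EF i))) (GF i (u.2 i))) _ u := fun i =>
    (pullbackL ((ContinuousLinearMap.proj i).comp
        (ContinuousLinearMap.snd ℝ EB (∀ i, EF i)))).hasFDerivAt.comp u
      ((h.fibre i).differentiableAt.hasFDerivAt.comp u
        ((ContinuousLinearMap.proj i).comp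
          (ContinuousLinearMap.snd ℝ EB (∀ i, EF i))).hasFDerivAt)
  have h3 : ∀ i, HasFDerivAt (fun u : EB × (∀ i, EF i) => φ i (u.1, u.2 i))
      ((fderiv ℝ (φ i) (u.1, u.2 i)).comp (pairProj EB EF i)) u := fun i =>
    ((h.smooth i).differentiableAt (by simp)).hasFDerivAt.comp (f := pairProj EB EF i) u
      (pairProj EB EF i).hasFDerivAt
  have h4 := h1.fun_add (HasFDerivAt.fun_sum (u := Finset.univ) fun i _ =>
    hasFDerivAt_exp_smul (h2 i).differentiableAt (h3 i).differentiableAt)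
  simp only [(h2 _).fderiv, (h3 _).fderiv] at h4
  refine (h4.congr_of_eventuallyEq (Eventually.of_forall fun u' => ?_))
  simp only [twistedChart, pullbackL_apply]

theorem fderiv_twistedChart (h : IsTwistedAt GB GF φ u) (x v w : EB × (∀ i, EF i)) :
    fderiv ℝ (twistedChart GB GF φ) u x v w
      = fderiv ℝ GB u.1 x.1 v.1 w.1
        + ∑ i, Real.exp (2 * φ i (u.1, u.2 i)) *
          (fderiv ℝ (GF i) (u.2 i) (x.2 i) (v.2 i) (w.2 i)
            + 2 * fderiv ℝ (φ i) (u.1, u.2 i) (x.1, x.2 i) * GF i (u.2 i) (v.2 i) (w.2 i)) := by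
  rw [h.hasFDerivAt_twistedChart.fderiv]
  simp [pullbackL_apply, mul_assoc, mul_add]

theorem isMetricAt [FiniteDimensional ℝ EB] [∀ i, FiniteDimensional ℝ (EF i)]
    (h : IsTwistedAt GB GF φ u) : IsMetricAt (twistedChart GB GF φ) u := by
  classical
  refine ⟨?_, ?_, ?_⟩
  · have h1 : ∀ᶠ u' : EB × (∀ i, EF i) in 𝓝 u, ∀ v w, GB u'.1 v w = GB u'.1 w v :=
      continuousAt_fst.eventually h.base.symm
    have h2 : ∀ᶠ u' : EB × (∀ i, EF i) in 𝓝 u, ∀ i, ∀ v w,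
        GF i (u'.2 i) v w = GF i (u'.2 i) w v := eventually_all.2 fun i =>
      (((ContinuousLinearMap.proj i).comp
          (ContinuousLinearMap.snd ℝ EB (∀ i, EF i))).continuous.continuousAt).eventually
        (h.fibre i).symm
    filter_upwards [h1, h2] with u' h1 h2 v w
    simp only [twistedChart_apply, h1 v.1, h2 _ (v.2 _)]
  -- Testing against vectors of a single factor isolates its block, which is nondegenerate because
  -- the exponential does not vanish.
  · refine isInvertible_of_nondegenerate fun v hv => ?_
    simp only [twistedChart_apply] at hv
    refine Prod.ext (h.base.inv.injective ?_) (funext fun i => (h.fibre i).inv.injective ?_)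
    · ext w
      simpa using hv (w, 0)
    · ext w
      have := hv (0, Pi.single i w)
      rw [Finset.sum_eq_single i (fun j _ hj => by simp [hj]) (by simp)] at this
      simpa [Real.exp_ne_zero] using this
  · have h1 : ContDiffAt ℝ 2 (fun u : EB × (∀ i, EF i) =>
        pullbackL (ContinuousLinearMap.fst ℝ EB (∀ i, EF i)) (GB u.1)) u :=
      (pullbackL (ContinuousLinearMap.fst ℝ EB (∀ i, EF i))).contDiff.contDiffAt.comp u
        (h.base.smooth.comp u contDiffAt_fst)
    have h2 : ∀ i, ContDiffAt ℝ 2 (fun u : EB × (∀ i, EF i) =>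
        pullbackL ((ContinuousLinearMap.proj i).comp
          (ContinuousLinearMap.snd ℝ EB (∀ i, EF i))) (GF i (u.2 i))) u := fun i =>
      (pullbackL ((ContinuousLinearMap.proj i).comp
          (ContinuousLinearMap.snd ℝ EB (∀ i, EF i)))).contDiff.contDiffAt.comp u
        ((h.fibre i).smooth.comp u ((ContinuousLinearMap.proj i).comp
          (ContinuousLinearMap.snd ℝ EB (∀ i, EF i))).contDiff.contDiffAt)
    have h4 := h1.add (ContDiffAt.sum (s := Finset.univ) fun i _ =>
      ((contDiffAt_const (c := (2 : ℝ))).mul (h.smooth' i)).exp.smul (h2 i))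
    refine h4.congr_of_eventuallyEq (Eventually.of_forall fun u' => ?_)
    simp only [twistedChart, pullbackL_apply, Pi.smul_apply']

theorem eventually [FiniteDimensional ℝ EB] [∀ i, FiniteDimensional ℝ (EF i)]
    (h : IsTwistedAt GB GF φ u) : ∀ᶠ u' in 𝓝 u, IsTwistedAt GB GF φ u' := by
  have := FiniteDimensional.complete ℝ EB
  have := fun i => FiniteDimensional.complete ℝ (EF i)
  have h1 : ∀ᶠ u' : EB × (∀ i, EF i) in 𝓝 u, IsMetricAt GB u'.1 :=
    continuousAt_fst.eventually h.base.eventually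
  have h2 : ∀ᶠ u' : EB × (∀ i, EF i) in 𝓝 u, ∀ i, IsMetricAt (GF i) (u'.2 i) :=
    eventually_all.2 fun i => (((ContinuousLinearMap.proj i).comp
          (ContinuousLinearMap.snd ℝ EB (∀ i, EF i))).continuous.continuousAt).eventually
        (h.fibre i).eventually
  have h3 : ∀ᶠ u' : EB × (∀ i, EF i) in 𝓝 u, ∀ i, ContDiffAt ℝ 2 (φ i) (u'.1, u'.2 i) :=
    eventually_all.2 fun i => ((pairProj EB EF i).continuous.continuousAt).eventually
      ((h.smooth i).eventually (by simp))
  filter_upwards [h1, h2, h3] with u' h1 h2 h3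
  exact ⟨h1, h2, h3⟩

variable [FiniteDimensional ℝ EB] [∀ i, FiniteDimensional ℝ (EF i)]

/-- Each factor exp(2 φ_i) acts as a conformal factor on its own summand only, but its differential
also has a base part; paired with the test vector, that part is the term along `baseGrad`. -/
theorem christoffelL_twistedChart (h : IsTwistedAt GB GF φ u) (v w : EB × (∀ i, EF i)) :
    christoffelL (twistedChart GB GF φ) u v w
      = (christoffelL GB u.1 v.1 w.1
          - ∑ i, (Real.exp (2 * φ i (u.1, u.2 i)) * GF i (u.2 i) (v.2 i) (w.2 i)) •
            baseGrad GB (φ i) (u.1, u.2 i),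
        fun i => christoffelL (GF i) (u.2 i) (v.2 i) (w.2 i)
          + fderiv ℝ (φ i) (u.1, u.2 i) (v.1, v.2 i) • w.2 i
          + fderiv ℝ (φ i) (u.1, u.2 i) (w.1, w.2 i) • v.2 i
          - GF i (u.2 i) (v.2 i) (w.2 i) • sharp (GF i (u.2 i))
            ((fderiv ℝ (φ i) (u.1, u.2 i)).comp (ContinuousLinearMap.inr ℝ EB (EF i)))) := by
  rw [christoffelL_apply]
  refine h.isMetricAt.christoffel_eq fun z => ?_
  rw [twistedChart_apply]
  simp only [h.fderiv_twistedChart, map_sub, map_add, map_sum, map_smul, sub_apply, add_apply,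
    sum_apply, smul_apply, smul_eq_mul, baseGrad, sharp_apply h.base.inv,
    sharp_apply (h.fibre _).inv, christoffelL_apply, h.base.apply_christoffel,
    (h.fibre _).apply_christoffel, ContinuousLinearMap.comp_apply, ContinuousLinearMap.inl_apply,
    ContinuousLinearMap.inr_apply]
  -- The base part of the differential is produced by the gradient in the base, the fibre part by
  -- the gradient in the fibre.
  have hz : ∀ i, fderiv ℝ (φ i) (u.1, u.2 i) (z.1, z.2 i)
      = fderiv ℝ (φ i) (u.1, u.2 i) (z.1, 0) + fderiv ℝ (φ i) (u.1, u.2 i) (0, z.2 i) :=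
    fun i => by rw [← map_add]; simp
  simp only [hz]
  rw [sub_add_eq_add_sub, add_sub_assoc, ← Finset.sum_sub_distrib, add_add_add_comm,
    ← Finset.sum_add_distrib, add_sub_add_comm, ← Finset.sum_sub_distrib, mul_add,
    Finset.mul_sum]
  congr 1
  refine Finset.sum_congr rfl fun i _ => ?_
  ring

end IsTwistedAt

end Twisted

/-! ### Partial derivatives and differentiability of `sharp` -/

section PartialDerivatives

variable {E F V : Type*} [NormedAddCommGroup E] [NormedSpace ℝ E] [NormedAddCommGroup F]
  [NormedSpace ℝ F] [NormedAddCommGroup V] [NormedSpace ℝ V]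

theorem fderiv_partial_fst {Ψ : E × F → V} {q : E × F} (h : DifferentiableAt ℝ Ψ q) :
    fderiv ℝ (fun x => Ψ (x, q.2)) q.1 = (fderiv ℝ Ψ q).comp (ContinuousLinearMap.inl ℝ E F) :=
  (h.hasFDerivAt.comp (f := fun x => (x, q.2)) q.1 (hasFDerivAt_prodMk_left q.1 q.2)).fderiv

theorem fderiv_partial_snd {Ψ : E × F → V} {q : E × F} (h : DifferentiableAt ℝ Ψ q) :
    fderiv ℝ (fun y => Ψ (q.1, y)) q.2 = (fderiv ℝ Ψ q).comp (ContinuousLinearMap.inr ℝ E F) :=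
  (h.hasFDerivAt.comp (f := fun y => (q.1, y)) q.2 (hasFDerivAt_prodMk_right q.1 q.2)).fderiv

theorem differentiableAt_sharp [CompleteSpace E] {G : V → E →L[ℝ] E →L[ℝ] ℝ} {η : V → E →L[ℝ] ℝ}
    {q : V} (hG : DifferentiableAt ℝ G q) (hi : (G q).IsInvertible) (hη : DifferentiableAt ℝ η q) :
    DifferentiableAt ℝ (fun q => sharp (G q) (η q)) q := by
  have h1 : DifferentiableAt ℝ (fun q => (G q).inverse) q :=
    ((hi.contDiffAt_map_inverse (n := 1)).differentiableAt (by simp)).comp q hG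
  exact h1.clm_apply hη

end PartialDerivatives

/-! ### The fibre symbols as functions of the base point and the fibre point -/

section Pair

variable {E V : Type*} [NormedAddCommGroup E] [NormedSpace ℝ E] [NormedAddCommGroup V]
  [NormedSpace ℝ V] [FiniteDimensional ℝ E] [FiniteDimensional ℝ V]
  {GB : E → E →L[ℝ] E →L[ℝ] ℝ} {G : V → V →L[ℝ] V →L[ℝ] ℝ} {f : E × V → ℝ} {q : E × V}

theorem differentiableAt_fderiv (hf : ContDiffAt ℝ 2 f q) : DifferentiableAt ℝ (fderiv ℝ f) q :=
  (hf.fderiv_right (m := 1) (by norm_num)).differentiableAt (by simp)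

theorem differentiableAt_baseGrad (hB : IsMetricAt GB q.1) (hf : ContDiffAt ℝ 2 f q) :
    DifferentiableAt ℝ (baseGrad GB f) q := by
  have := FiniteDimensional.complete ℝ E
  exact differentiableAt_sharp (G := fun q : E × V => GB q.1)
    (hB.differentiableAt.comp q differentiableAt_fst) hB.inv
    ((differentiableAt_fderiv hf).clm_comp (differentiableAt_const _))

theorem differentiableAt_fibreChristoffel (hG : IsMetricAt G q.2) (hf : ContDiffAt ℝ 2 f q)
    (v w : V) : DifferentiableAt ℝ (fun q => fibreChristoffel G f q v w) q := by
  have := FiniteDimensional.complete ℝ V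
  have h1 := differentiableAt_fderiv hf
  have h2 : DifferentiableAt ℝ (fun q : E × V => G q.2) q :=
    hG.differentiableAt.comp q differentiableAt_snd
  have h3 : DifferentiableAt ℝ (fun q : E × V => christoffelL G q.2) q :=
    hG.differentiableAt_christoffelL.comp q differentiableAt_snd
  have h4 := differentiableAt_sharp (G := fun q : E × V => G q.2) h2 hG.inv
    (h1.clm_comp (differentiableAt_const (ContinuousLinearMap.inr ℝ E V)))
  have ha : ∀ a : V, DifferentiableAt ℝ (fun q => fderiv ℝ f q ((0, a) : E × V)) q := fun a =>
    h1.clm_apply (differentiableAt_const _)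
  exact ((((h3.clm_apply (differentiableAt_const v)).clm_apply (differentiableAt_const w)).add
    ((ha v).smul (differentiableAt_const w))).add ((ha w).smul (differentiableAt_const v))).sub
    (((h2.clm_apply (differentiableAt_const v)).clm_apply (differentiableAt_const w)).smul h4)

/-- Along the base, `G` and its symbols stay fixed and only the differential of `f` moves, so just
mixed second derivatives survive. They are the source of VX(ln b_i). -/
theorem fderiv_fibreChristoffel_base (hG : IsMetricAt G q.2) (hf : ContDiffAt ℝ 2 f q)
    (v w : V) (X : E) : fderiv ℝ (fun q => fibreChristoffel G f q v w) q (X, 0)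
      = fderiv ℝ (fderiv ℝ f) q (X, 0) (0, v) • w + fderiv ℝ (fderiv ℝ f) q (X, 0) (0, w) • v
        - G q.2 v w • sharp (G q.2)
          ((fderiv ℝ (fderiv ℝ f) q (X, 0)).comp (ContinuousLinearMap.inr ℝ E V)) := by
  have h0 := congrArg (fun A : E →L[ℝ] V => A X)
    (fderiv_partial_fst (differentiableAt_fibreChristoffel hG hf v w))
  simp only [ContinuousLinearMap.comp_apply, ContinuousLinearMap.inl_apply] at h0
  rw [← h0]
  have h1 : HasFDerivAt (fun x => fderiv ℝ f (x, q.2))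
      ((fderiv ℝ (fderiv ℝ f) q).comp (ContinuousLinearMap.inl ℝ E V)) q.1 :=
    (differentiableAt_fderiv hf).hasFDerivAt.comp (f := fun x => (x, q.2)) q.1
      (hasFDerivAt_prodMk_left q.1 q.2)
  have ha : ∀ a : V, HasFDerivAt (fun x => fderiv ℝ f (x, q.2) ((0, a) : E × V)) _ q.1 := fun a =>
    h1.clm_apply (hasFDerivAt_const _ _)
  have h2 := h1.clm_comp (hasFDerivAt_const (ContinuousLinearMap.inr ℝ E V) q.1)
  have h3 := (G q.2).inverse.hasFDerivAt.comp q.1 h2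
  have h4 := ((((hasFDerivAt_const (christoffelL G q.2 v w) q.1).fun_add
    ((ha v).smul_const w)).fun_add ((ha w).smul_const v))).fun_sub (h3.const_smul (G q.2 v w))
  rw [HasFDerivAt.fderiv (f := fun x => fibreChristoffel G f (x, q.2) v w) h4]
  simp [sharp]

theorem christoffelL_fibre (hG : IsMetricAt G q.2) (hf : ContDiffAt ℝ 2 f q) (v w : V) :
    christoffelL (fun y => Real.exp (2 * f (q.1, y)) • G y) q.2 v w
      = fibreChristoffel G f q v w := by
  rw [christoffelL_apply, christoffel_fibre hG hf]

/-- Along the fibre the base point is frozen, and the closed formula agrees with the symbols of the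
fibre metric near `q.2`. Hence the intrinsic curvature of the fibre appears in the fibre block. -/
theorem fderiv_fibreChristoffel_fibre (hG : IsMetricAt G q.2) (hf : ContDiffAt ℝ 2 f q)
    (v w a : V) : fderiv ℝ (fun q => fibreChristoffel G f q v w) q (0, a)
      = fderiv ℝ (fun y => christoffelL (fun y => Real.exp (2 * f (q.1, y)) • G y) y v w) q.2 a
      := by
  have := FiniteDimensional.complete ℝ V
  have h0 := congrArg (fun A : V →L[ℝ] V => A a)
    (fderiv_partial_snd (differentiableAt_fibreChristoffel hG hf v w))
  simp only [ContinuousLinearMap.comp_apply, ContinuousLinearMap.inr_apply] at h0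
  rw [← h0]
  refine congrArg (fun A : V →L[ℝ] V => A a) (Filter.EventuallyEq.fderiv_eq ?_)
  have h1 : ∀ᶠ y in 𝓝 q.2, ContDiffAt ℝ 2 f (q.1, y) :=
    (Continuous.prodMk_right q.1).continuousAt.eventually (hf.eventually (by simp))
  filter_upwards [hG.eventually, h1] with y h2 h3
  exact (christoffelL_fibre (q := (q.1, y)) h2 h3 v w).symm

theorem isMetricAt_fibre (hG : IsMetricAt G q.2) (hf : ContDiffAt ℝ 2 f q) :
    IsMetricAt (fun y => Real.exp (2 * f (q.1, y)) • G y) q.2 :=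
  hG.conformal (hf.comp (f := fun y => (q.1, y)) q.2 (contDiffAt_const.prodMk contDiffAt_id))

end Pair

/-! ### Block decomposition: inclusions, traces and symbols -/

section Twisted

variable {ι : Type*} [DecidableEq ι]
  {EB : Type*} [NormedAddCommGroup EB] [NormedSpace ℝ EB]
  {EF : ι → Type*} [∀ i, NormedAddCommGroup (EF i)] [∀ i, NormedSpace ℝ (EF i)]

variable (EB EF) in
/-- The inclusion of the base directions. -/
def inB : EB →L[ℝ] EB × (∀ i, EF i) := ContinuousLinearMap.inl ℝ EB (∀ i, EF i)

variable (EB EF) in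
/-- The inclusion of the directions of the fibre of index `i`. -/
def inF (i : ι) : EF i →L[ℝ] EB × (∀ i, EF i) :=
  (ContinuousLinearMap.inr ℝ EB (∀ i, EF i)).comp (ContinuousLinearMap.single ℝ EF i)

variable (EB EF) in
/-- The projection to the directions of the fibre of index `i`. -/
def prF (i : ι) : EB × (∀ i, EF i) →L[ℝ] EF i :=
  (ContinuousLinearMap.proj i).comp (ContinuousLinearMap.snd ℝ EB (∀ i, EF i))

@[simp] theorem fst_inB (X : EB) : (inB EB EF X).1 = X := rfl
@[simp] theorem snd_inB (X : EB) : (inB EB EF X).2 = 0 := rfl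
@[simp] theorem fst_inF (i : ι) (V : EF i) : (inF EB EF i V).1 = 0 := rfl
@[simp] theorem snd_inF (i : ι) (V : EF i) : (inF EB EF i V).2 = Pi.single i V := rfl
@[simp] theorem prF_apply (i : ι) (v : EB × (∀ i, EF i)) : prF EB EF i v = v.2 i := rfl

variable [Fintype ι] [FiniteDimensional ℝ EB] [∀ i, FiniteDimensional ℝ (EF i)]

/-- For a fibre only the number `t i` is fixed in advance; the endomorphism is existential, so that
a special index can be treated by cases without transporting maps between different types `EF i`. -/
theorem trace_blocks (L : EB × (∀ i, EF i) →L[ℝ] EB × (∀ i, EF i)) {LB : EB →ₗ[ℝ] EB}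
    (hB : ∀ Y, (L (inB EB EF Y)).1 = LB Y) {t : ι → ℝ}
    (hF : ∀ i, ∃ LF : EF i →ₗ[ℝ] EF i, (∀ U, (L (inF EB EF i U)).2 i = LF U) ∧
      LinearMap.trace ℝ _ LF = t i) :
    LinearMap.trace ℝ _ L.toLinearMap = LinearMap.trace ℝ _ LB + ∑ i, t i := by
  rw [trace_prod_pi]
  congr 1
  · congr 1
    exact LinearMap.ext hB
  · refine Finset.sum_congr rfl fun i _ => ?_
    obtain ⟨LF, h1, h2⟩ := hF i
    rw [← h2]
    congr 1
    exact LinearMap.ext h1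

variable {GB : EB → EB →L[ℝ] EB →L[ℝ] ℝ} {GF : ∀ i, EF i → EF i →L[ℝ] EF i →L[ℝ] ℝ}
  {φ : ∀ i, EB × EF i → ℝ} {u : EB × (∀ i, EF i)}

namespace IsTwistedAt

theorem christoffelL_inB_inB (h : IsTwistedAt GB GF φ u) (X Y : EB) :
    christoffelL (twistedChart GB GF φ) u (inB EB EF X) (inB EB EF Y)
      = inB EB EF (christoffelL GB u.1 X Y) := by
  rw [h.christoffelL_twistedChart]
  refine Prod.ext (by simp) (funext fun i => by simp)

theorem christoffelL_inB_inF (h : IsTwistedAt GB GF φ u) (X : EB) {i : ι} (V : EF i) :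
    christoffelL (twistedChart GB GF φ) u (inB EB EF X) (inF EB EF i V)
      = inF EB EF i (fderiv ℝ (φ i) (u.1, u.2 i) (X, 0) • V) := by
  rw [h.christoffelL_twistedChart]
  refine Prod.ext (by simp) (funext fun j => ?_)
  by_cases hj : j = i
  · subst hj
    simp
  · simp [hj]

theorem christoffelL_comm (h : IsTwistedAt GB GF φ u) (v w : EB × (∀ i, EF i)) :
    christoffelL (twistedChart GB GF φ) u v w = christoffelL (twistedChart GB GF φ) u w v := by
  rw [christoffelL_apply, christoffelL_apply, h.isMetricAt.christoffel_symm]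

theorem christoffelL_inF_inB (h : IsTwistedAt GB GF φ u) (X : EB) {i : ι} (V : EF i) :
    christoffelL (twistedChart GB GF φ) u (inF EB EF i V) (inB EB EF X)
      = inF EB EF i (fderiv ℝ (φ i) (u.1, u.2 i) (X, 0) • V) := by
  rw [h.christoffelL_comm, h.christoffelL_inB_inF]

/-- The Gauss formula for the fibre: the tangential part is its own connection, the normal part is
the umbilic second fundamental form. -/
theorem christoffelL_inF_inF (h : IsTwistedAt GB GF φ u) {i : ι} (V W : EF i) :
    christoffelL (twistedChart GB GF φ) u (inF EB EF i V) (inF EB EF i W)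
      = inF EB EF i (fibreChristoffel (GF i) (φ i) (u.1, u.2 i) V W)
        - (Real.exp (2 * φ i (u.1, u.2 i)) * GF i (u.2 i) V W) •
          inB EB EF (baseGrad GB (φ i) (u.1, u.2 i)) := by
  rw [h.christoffelL_twistedChart]
  refine Prod.ext ?_ (funext fun j => ?_)
  · simp only [snd_inF, fst_inF, map_zero, zero_sub, Prod.fst_sub, Prod.smul_fst, fst_inB]
    rw [Finset.sum_eq_single i (fun j _ hj => by simp [hj]) (by simp)]
    simp
  · by_cases hj : j = i
    · subst hj
      simp [fibreChristoffel]
    · simp [hj]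

theorem christoffelL_inF_inF_of_ne (h : IsTwistedAt GB GF φ u) {i j : ι} (hij : i ≠ j) (V : EF i)
    (W : EF j) :
    christoffelL (twistedChart GB GF φ) u (inF EB EF i V) (inF EB EF j W) = 0 := by
  rw [h.christoffelL_twistedChart]
  -- With both base components zero, each term of index `k` in the general formula is bilinear in
  -- the two `k`-th components, and one of these always vanishes.
  have key : ∀ k, (Pi.single i V : ∀ i, EF i) k = 0 ∨ (Pi.single j W : ∀ i, EF i) k = 0 := by
    intro k
    by_cases hk : k = i
    · right
      subst hk
      simp [hij]
    · left
      simp [hk]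
  refine Prod.ext ?_ (funext fun k => ?_)
  · simp only [snd_inF, fst_inF, map_zero, zero_sub, Prod.fst_zero, neg_eq_zero]
    refine Finset.sum_eq_zero fun k _ => ?_
    rcases key k with hk | hk <;> simp [hk]
  · have h0 : fderiv ℝ (φ k) (u.1, u.2 k) ((0, 0) : EB × EF k) = 0 := map_zero _
    rcases key k with hk | hk <;> simp [hk, h0]

end IsTwistedAt

end Twisted

/-! ### Traces of the Levi-Civita curvature, block by block -/

section TwistedCurvature

variable {ι : Type*} [DecidableEq ι]
  {EB : Type*} [NormedAddCommGroup EB] [NormedSpace ℝ EB]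
  {EF : ι → Type*} [∀ i, NormedAddCommGroup (EF i)] [∀ i, NormedSpace ℝ (EF i)]
  [Fintype ι] [FiniteDimensional ℝ EB] [∀ i, FiniteDimensional ℝ (EF i)]
  {GB : EB → EB →L[ℝ] EB →L[ℝ] ℝ} {GF : ∀ i, EF i → EF i →L[ℝ] EF i →L[ℝ] ℝ}
  {φ : ∀ i, EB × EF i → ℝ} {u : EB × (∀ i, EF i)}

theorem fderiv_base {V : Type*} [NormedAddCommGroup V] [NormedSpace ℝ V] {f : EB → V}
    (hf : DifferentiableAt ℝ f u.1) (x : EB × (∀ i, EF i)) :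
    fderiv ℝ (fun u : EB × (∀ i, EF i) => f u.1) u x = fderiv ℝ f u.1 x.1 := by
  have h := hf.hasFDerivAt.comp (f := Prod.fst) u
    (ContinuousLinearMap.fst ℝ EB (∀ i, EF i)).hasFDerivAt
  rw [show (fun u : EB × (∀ i, EF i) => f u.1) = f ∘ Prod.fst from rfl, h.fderiv]
  rfl

theorem hasFDerivAt_pair {V : Type*} [NormedAddCommGroup V] [NormedSpace ℝ V] {i : ι}
    {f : EB × EF i → V} (hf : DifferentiableAt ℝ f (u.1, u.2 i)) :
    HasFDerivAt (fun u : EB × (∀ i, EF i) => f (u.1, u.2 i))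
      ((fderiv ℝ f (u.1, u.2 i)).comp (pairProj EB EF i)) u :=
  hf.hasFDerivAt.comp (f := pairProj EB EF i) u (pairProj EB EF i).hasFDerivAt

theorem fderiv_pair {V : Type*} [NormedAddCommGroup V] [NormedSpace ℝ V] {i : ι}
    {f : EB × EF i → V} (hf : DifferentiableAt ℝ f (u.1, u.2 i)) (x : EB × (∀ i, EF i)) :
    fderiv ℝ (fun u : EB × (∀ i, EF i) => f (u.1, u.2 i)) u x
      = fderiv ℝ f (u.1, u.2 i) (x.1, x.2 i) := by
  rw [(hasFDerivAt_pair hf).fderiv]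
  rfl

theorem fderiv_slope {i : ι} (hf : ContDiffAt ℝ 2 (φ i) (u.1, u.2 i)) (v : EB × EF i) (V : EF i)
    (x : EB × (∀ i, EF i)) :
    fderiv ℝ (fun u : EB × (∀ i, EF i) => fderiv ℝ (φ i) (u.1, u.2 i) v • V) u x
      = fderiv ℝ (fderiv ℝ (φ i)) (u.1, u.2 i) (x.1, x.2 i) v • V := by
  have h1 := ((hasFDerivAt_pair (differentiableAt_fderiv hf)).clm_apply
    (hasFDerivAt_const v u)).smul_const V
  rw [h1.fderiv]
  simp

theorem christoffelL_const_differentiableAt {E : Type*} [NormedAddCommGroup E] [NormedSpace ℝ E]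
    [FiniteDimensional ℝ E] {G : E → E →L[ℝ] E →L[ℝ] ℝ} {u : E} (hG : IsMetricAt G u) (v w : E) :
    DifferentiableAt ℝ (fun u => christoffelL G u v w) u := by
  have := FiniteDimensional.complete ℝ E
  exact (hG.differentiableAt_christoffelL.clm_apply (differentiableAt_const v)).clm_apply
    (differentiableAt_const w)

namespace IsTwistedAt

theorem differentiableAt_christoffelL (h : IsTwistedAt GB GF φ u) :
    DifferentiableAt ℝ (christoffelL (twistedChart GB GF φ)) u := by
  have := FiniteDimensional.complete ℝ (EB × (∀ i, EF i))
  exact h.isMetricAt.differentiableAt_christoffelL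

/-- Being a twisted point is an open condition, so formulas proved at every twisted point hold near
`u` and may be differentiated there. -/
theorem fst_curvatureEnd (h : IsTwistedAt GB GF φ u) {x y z : EB × (∀ i, EF i)}
    {f g : EB × (∀ i, EF i) → EB}
    (hf : ∀ u, IsTwistedAt GB GF φ u → (christoffelL (twistedChart GB GF φ) u y z).1 = f u)
    (hg : ∀ u, IsTwistedAt GB GF φ u → (christoffelL (twistedChart GB GF φ) u x z).1 = g u) :
    (curvatureEnd (christoffelL (twistedChart GB GF φ)) u x z y).1
      = fderiv ℝ f u x - fderiv ℝ g u y
        + (christoffelL (twistedChart GB GF φ) u x (christoffelL (twistedChart GB GF φ) u y z)).1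
        - (christoffelL (twistedChart GB GF φ) u y
            (christoffelL (twistedChart GB GF φ) u x z)).1 :=
  map_curvatureEnd h.differentiableAt_christoffelL (ContinuousLinearMap.fst ℝ EB (∀ i, EF i))
    (h.eventually.mono hf) (h.eventually.mono hg)

theorem snd_curvatureEnd (h : IsTwistedAt GB GF φ u) {x y z : EB × (∀ i, EF i)} {i : ι}
    {f g : EB × (∀ i, EF i) → EF i}
    (hf : ∀ u, IsTwistedAt GB GF φ u → (christoffelL (twistedChart GB GF φ) u y z).2 i = f u)
    (hg : ∀ u, IsTwistedAt GB GF φ u → (christoffelL (twistedChart GB GF φ) u x z).2 i = g u) :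
    (curvatureEnd (christoffelL (twistedChart GB GF φ)) u x z y).2 i
      = fderiv ℝ f u x - fderiv ℝ g u y
        + (christoffelL (twistedChart GB GF φ) u x
            (christoffelL (twistedChart GB GF φ) u y z)).2 i
        - (christoffelL (twistedChart GB GF φ) u y
            (christoffelL (twistedChart GB GF φ) u x z)).2 i :=
  map_curvatureEnd h.differentiableAt_christoffelL (prF EB EF i)
    (h.eventually.mono hf) (h.eventually.mono hg)

/-- The base is totally geodesic, so its block is its own curvature. On `F i` the map U ↦ R(X,U)Z is
the scalar (H^φ + dφ⊗dφ)(X,Z), which is the Hessian of exp φ_i divided by exp φ_i. -/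
theorem trace_curvatureEnd_inB_inB (h : IsTwistedAt GB GF φ u) (X Z : EB) :
    LinearMap.trace ℝ _ (curvatureEnd (christoffelL (twistedChart GB GF φ)) u
        (inB EB EF X) (inB EB EF Z)).toLinearMap
      = LinearMap.trace ℝ _ (curvatureEnd (christoffelL GB) u.1 X Z).toLinearMap
        + ∑ i, (Module.finrank ℝ (EF i)) *
          (fderiv ℝ (fderiv ℝ (φ i)) (u.1, u.2 i) (X, 0) (Z, 0)
            - fderiv ℝ (φ i) (u.1, u.2 i) (christoffelL GB u.1 X Z, 0)
            + fderiv ℝ (φ i) (u.1, u.2 i) (X, 0) * fderiv ℝ (φ i) (u.1, u.2 i) (Z, 0)) := by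
  refine trace_blocks _ (fun Y => ?_)
    (fun i => ⟨(fderiv ℝ (fderiv ℝ (φ i)) (u.1, u.2 i) (X, 0) (Z, 0)
            - fderiv ℝ (φ i) (u.1, u.2 i) (christoffelL GB u.1 X Z, 0)
            + fderiv ℝ (φ i) (u.1, u.2 i) (X, 0) * fderiv ℝ (φ i) (u.1, u.2 i) (Z, 0)) •
            LinearMap.id, fun U => ?_, ?_⟩)
  · have := FiniteDimensional.complete ℝ EB
    rw [h.fst_curvatureEnd (f := fun u => christoffelL GB u.1 Y Z)
      (g := fun u => christoffelL GB u.1 X Z) (fun u hu => by rw [hu.christoffelL_inB_inB]; rfl)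
      (fun u hu => by rw [hu.christoffelL_inB_inB]; rfl)]
    rw [fderiv_base (f := fun x => christoffelL GB x Y Z)
      (christoffelL_const_differentiableAt h.base Y Z),
      fderiv_base (f := fun x => christoffelL GB x X Z)
      (christoffelL_const_differentiableAt h.base X Z)]
    simp only [h.christoffelL_inB_inB, fst_inB, ContinuousLinearMap.coe_coe]
    rw [curvatureEnd_apply h.base.differentiableAt_christoffelL]
  · rw [h.snd_curvatureEnd (f := fun u => fderiv ℝ (φ i) (u.1, u.2 i) (Z, 0) • U)
      (g := fun u => 0) (fun u hu => by rw [hu.christoffelL_inF_inB]; simp)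
      (fun u hu => by rw [hu.christoffelL_inB_inB]; simp)]
    rw [fderiv_slope (h.smooth i)]
    simp only [h.christoffelL_inB_inB, h.christoffelL_inF_inB, h.christoffelL_inB_inF]
    simp
    module
  · simp [mul_comm]

theorem second_fderiv_symm (h : IsTwistedAt GB GF φ u) (i : ι) (v w : EB × EF i) :
    fderiv ℝ (fderiv ℝ (φ i)) (u.1, u.2 i) v w = fderiv ℝ (fderiv ℝ (φ i)) (u.1, u.2 i) w v :=
  ((h.smooth i).isSymmSndFDerivAt (by simp)) v w

/-- Only the block of `F i` is nonzero: a multiple of the identity minus a rank one map of trace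
equal to the same scalar, hence the factor l_i - 1. -/
theorem trace_curvatureEnd_inB_inF (h : IsTwistedAt GB GF φ u) (X : EB) {i : ι} (V : EF i) :
    LinearMap.trace ℝ _ (curvatureEnd (christoffelL (twistedChart GB GF φ)) u
        (inB EB EF X) (inF EB EF i V)).toLinearMap
      = (Module.finrank ℝ (EF i) - 1) *
          fderiv ℝ (fderiv ℝ (φ i)) (u.1, u.2 i) (0, V) (X, 0) := by
  have key : ∀ U : EF i, (curvatureEnd (christoffelL (twistedChart GB GF φ)) u
      (inB EB EF X) (inF EB EF i V) (inF EB EF i U)).2 i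
      = fderiv ℝ (fderiv ℝ (φ i)) (u.1, u.2 i) (X, 0) (0, V) • U
        - GF i (u.2 i) U V • sharp (GF i (u.2 i))
          ((fderiv ℝ (fderiv ℝ (φ i)) (u.1, u.2 i) (X, 0)).comp
            (ContinuousLinearMap.inr ℝ EB (EF i))) := by
    intro U
    rw [h.snd_curvatureEnd (f := fun u => fibreChristoffel (GF i) (φ i) (u.1, u.2 i) U V)
      (g := fun u => fderiv ℝ (φ i) (u.1, u.2 i) (X, 0) • V)
      (fun u hu => by rw [hu.christoffelL_inF_inF]; simp)
      (fun u hu => by rw [hu.christoffelL_inB_inF]; simp)]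
    rw [fderiv_slope (h.smooth i), fderiv_pair
      (f := fun q => fibreChristoffel (GF i) (φ i) q U V)
      (differentiableAt_fibreChristoffel (h.fibre i) (h.smooth i) U V)]
    simp only [fst_inB, snd_inB, fst_inF, snd_inF, Pi.single_eq_same, Pi.zero_apply]
    rw [fderiv_fibreChristoffel_base (h.fibre i) (h.smooth i)]
    simp only [h.christoffelL_inB_inB, h.christoffelL_inF_inF, h.christoffelL_inB_inF, map_sub,
      map_smul, Prod.snd_sub, Prod.smul_snd, snd_inB, snd_inF, Pi.sub_apply,
      Pi.single_eq_same, Pi.smul_apply, Pi.zero_apply, smul_zero, sub_zero,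
      h.second_fderiv_symm i (0, U)]
    module
  rw [trace_blocks _ (LB := 0) (t := fun j => if j = i then (Module.finrank ℝ (EF i) - 1) *
          fderiv ℝ (fderiv ℝ (φ i)) (u.1, u.2 i) (0, V) (X, 0) else 0) (fun Y => ?_) (fun j => ?_)]
  · simp
  · rw [h.fst_curvatureEnd (f := fun u => 0) (g := fun u => 0)
      (fun u hu => by rw [hu.christoffelL_inB_inF]; simp)
      (fun u hu => by rw [hu.christoffelL_inB_inF]; simp)]
    simp [h.christoffelL_inB_inF]
  · by_cases hj : j = i
    · subst hj
      refine ⟨fderiv ℝ (fderiv ℝ (φ j)) (u.1, u.2 j) (X, 0) (0, V) • LinearMap.id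
        - ((GF j (u.2 j)).flip V).toLinearMap.smulRight (sharp (GF j (u.2 j))
          ((fderiv ℝ (fderiv ℝ (φ j)) (u.1, u.2 j) (X, 0)).comp
            (ContinuousLinearMap.inr ℝ EB (EF j)))), fun U => ?_, ?_⟩
      · rw [key]
        simp
      · simp [sharp_apply (h.fibre j).inv, h.second_fderiv_symm j (0, V)]
        ring
    · refine ⟨0, fun U => ?_, by simp [hj]⟩
      rw [h.snd_curvatureEnd (f := fun u => 0) (g := fun u => 0)
        (fun u hu => by rw [hu.christoffelL_inF_inF_of_ne hj]; simp)
        (fun u hu => by rw [hu.christoffelL_inB_inF]; simp [hj])]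
      simp [h.christoffelL_inB_inF, h.christoffelL_inF_inF_of_ne hj]

/-- In the block of `F i` the products of first derivatives cancel and U ↦ d²φ_i(V,Z)U - d²φ_i(U,Z)V
remains, again with trace factor l_i - 1. -/
theorem trace_curvatureEnd_inF_inB (h : IsTwistedAt GB GF φ u) (Z : EB) {i : ι} (V : EF i) :
    LinearMap.trace ℝ _ (curvatureEnd (christoffelL (twistedChart GB GF φ)) u
        (inF EB EF i V) (inB EB EF Z)).toLinearMap
      = (Module.finrank ℝ (EF i) - 1) *
          fderiv ℝ (fderiv ℝ (φ i)) (u.1, u.2 i) (0, V) (Z, 0) := by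
  rw [trace_blocks _ (LB := 0) (t := fun j => if j = i then (Module.finrank ℝ (EF i) - 1) *
          fderiv ℝ (fderiv ℝ (φ i)) (u.1, u.2 i) (0, V) (Z, 0) else 0) (fun Y => ?_) (fun j => ?_)]
  · simp
  · rw [h.fst_curvatureEnd (f := fun u => christoffelL GB u.1 Y Z) (g := fun u => 0)
      (fun u hu => by rw [hu.christoffelL_inB_inB]; simp)
      (fun u hu => by rw [hu.christoffelL_inF_inB]; simp)]
    rw [fderiv_base (f := fun x => christoffelL GB x Y Z)
      (christoffelL_const_differentiableAt h.base Y Z)]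
    simp [h.christoffelL_inF_inB, h.christoffelL_inB_inF, h.christoffelL_inB_inB]
  · by_cases hj : j = i
    · subst hj
      refine ⟨fderiv ℝ (fderiv ℝ (φ j)) (u.1, u.2 j) (0, V) (Z, 0) • LinearMap.id
        - (((fderiv ℝ (fderiv ℝ (φ j)) (u.1, u.2 j)).flip (Z, 0)).comp
            (ContinuousLinearMap.inr ℝ EB (EF j))).toLinearMap.smulRight V, fun U => ?_, ?_⟩
      · rw [h.snd_curvatureEnd (f := fun u => fderiv ℝ (φ j) (u.1, u.2 j) (Z, 0) • U)
          (g := fun u => fderiv ℝ (φ j) (u.1, u.2 j) (Z, 0) • V)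
          (fun u hu => by rw [hu.christoffelL_inF_inB]; simp)
          (fun u hu => by rw [hu.christoffelL_inF_inB]; simp)]
        rw [fderiv_slope (h.smooth j), fderiv_slope (h.smooth j)]
        rw [h.christoffelL_inF_inB, h.christoffelL_inF_inB, map_smul, map_smul, map_smul, map_smul,
          h.christoffelL_comm (inF EB EF j U)]
        simp
      · simp
        ring
    · refine ⟨0, fun U => ?_, by simp [hj]⟩
      rw [h.snd_curvatureEnd (f := fun u => fderiv ℝ (φ j) (u.1, u.2 j) (Z, 0) • U)
        (g := fun u => 0)
        (fun u hu => by rw [hu.christoffelL_inF_inB]; simp)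
        (fun u hu => by rw [hu.christoffelL_inF_inB]; simp [hj])]
      rw [fderiv_slope (h.smooth j)]
      have h0 : ((0, 0) : EB × EF j) = 0 := rfl
      simp [h0, h.christoffelL_inF_inB, h.christoffelL_inF_inF_of_ne hj,
        h.christoffelL_inF_inF_of_ne (Ne.symm hj), hj]

theorem trace_curvatureEnd_inF_inF_of_ne (h : IsTwistedAt GB GF φ u) {i j : ι} (hij : i ≠ j)
    (V : EF i) (W : EF j) :
    LinearMap.trace ℝ _ (curvatureEnd (christoffelL (twistedChart GB GF φ)) u
        (inF EB EF i V) (inF EB EF j W)).toLinearMap = 0 := by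
  rw [trace_blocks _ (LB := 0) (t := fun j => 0) (fun Y => ?_) (fun k => ⟨0, fun U => ?_, ?_⟩)]
  · simp
  · rw [h.fst_curvatureEnd (f := fun u => 0) (g := fun u => 0)
      (fun u hu => by rw [hu.christoffelL_inB_inF]; simp)
      (fun u hu => by rw [hu.christoffelL_inF_inF_of_ne hij]; simp)]
    simp [h.christoffelL_inB_inF, h.christoffelL_inF_inF_of_ne hij]
  · by_cases hk : k = j
    · subst hk
      rw [h.snd_curvatureEnd (f := fun u => fibreChristoffel (GF k) (φ k) (u.1, u.2 k) U W)
        (g := fun u => 0)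
        (fun u hu => by rw [hu.christoffelL_inF_inF]; simp)
        (fun u hu => by rw [hu.christoffelL_inF_inF_of_ne hij]; simp)]
      -- The symbols of `F k` depend only on the base point and the point of `F k`; the direction
      -- `V` in another fibre moves neither.
      rw [fderiv_pair (f := fun q => fibreChristoffel (GF k) (φ k) q U W)
        (differentiableAt_fibreChristoffel (h.fibre k) (h.smooth k) U W)]
      have h0 : ((0, 0) : EB × EF k) = 0 := rfl
      simp [h.christoffelL_inF_inF, h.christoffelL_inF_inF_of_ne hij, h.christoffelL_inF_inB,
        Ne.symm hij, h0]
    · rw [h.snd_curvatureEnd (f := fun u => 0) (g := fun u => 0)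
        (fun u hu => by rw [hu.christoffelL_inF_inF_of_ne hk]; simp)
        (fun u hu => by rw [hu.christoffelL_inF_inF_of_ne hij]; simp)]
      simp [h.christoffelL_inF_inF_of_ne hij, h.christoffelL_inF_inF_of_ne hk]
  · simp

/-- With H = g(V,W) and γ = grad φ_i, the base block is H(∇γ + dφ_i⊗γ), and another fibre `F s`
contributes H dφ_s(γ) times the identity. On `F i` itself the Gauss equation adds to the intrinsic
curvature a term of trace (l_i - 1) H dφ_i(γ). -/
theorem trace_curvatureEnd_inF_inF (h : IsTwistedAt GB GF φ u) {i : ι} (V W : EF i) :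
    LinearMap.trace ℝ _ (curvatureEnd (christoffelL (twistedChart GB GF φ)) u
        (inF EB EF i V) (inF EB EF i W)).toLinearMap
      = LinearMap.trace ℝ _ (curvatureEnd (christoffelL
          (fun y => Real.exp (2 * φ i (u.1, y)) • GF i y)) (u.2 i) V W).toLinearMap
        + Real.exp (2 * φ i (u.1, u.2 i)) * GF i (u.2 i) V W *
          (LinearMap.trace ℝ _
              (covDeriv GB (fun x => baseGrad GB (φ i) (x, u.2 i)) u.1).toLinearMap
            + ∑ s, Module.finrank ℝ (EF s) *
              fderiv ℝ (φ s) (u.1, u.2 s) (baseGrad GB (φ i) (u.1, u.2 i), 0)) := by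
  set H : ℝ := Real.exp (2 * φ i (u.1, u.2 i)) * GF i (u.2 i) V W with hH
  set γ : EB := baseGrad GB (φ i) (u.1, u.2 i) with hγ
  have hgr := differentiableAt_baseGrad (GB := GB) (q := (u.1, u.2 i)) h.base (h.smooth i)
  have hφd : DifferentiableAt ℝ (φ i) (u.1, u.2 i) := (h.smooth i).differentiableAt (by simp)
  -- The subtracted H dφ_i(γ) in the block of `F i` is made up by the trace of dφ_i⊗γ in the base
  -- block, so the final sum runs uniformly over all `s`.
  rw [trace_blocks _ (LB := H • ((covDeriv GB (fun x => baseGrad GB (φ i) (x, u.2 i)) u.1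
        + ((fderiv ℝ (φ i) (u.1, u.2 i)).comp
          (ContinuousLinearMap.inl ℝ EB (EF i))).smulRight γ).toLinearMap))
    (t := fun s => H * (Module.finrank ℝ (EF s) * fderiv ℝ (φ s) (u.1, u.2 s) (γ, 0))
      + if s = i then LinearMap.trace ℝ _ (curvatureEnd (christoffelL
          (fun y => Real.exp (2 * φ i (u.1, y)) • GF i y)) (u.2 i) V W).toLinearMap
        - H * fderiv ℝ (φ i) (u.1, u.2 i) (γ, 0) else 0) (fun Y => ?_) (fun s => ?_)]
  · rw [Finset.sum_add_distrib, ← Finset.mul_sum]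
    simp
    ring
  -- The factor exp(2 φ_i) yields two copies of dφ_i(Y); one of them is cancelled by the base
  -- component of Γ(V, Γ(Y,W)).
  · have hd : fderiv ℝ (fun u : EB × (∀ i, EF i) =>
        -((Real.exp (2 * φ i (u.1, u.2 i)) * GF i (u.2 i) V W) • baseGrad GB (φ i) (u.1, u.2 i)))
        u (inB EB EF Y)
        = -((2 * fderiv ℝ (φ i) (u.1, u.2 i) (Y, 0) * H) • γ
          + H • fderiv ℝ (fun x => baseGrad GB (φ i) (x, u.2 i)) u.1 Y) := by
      have h1 := hasFDerivAt_pair hφd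
      have h2 : HasFDerivAt (fun u : EB × (∀ i, EF i) => GF i (u.2 i)) _ u :=
        (h.fibre i).differentiableAt.hasFDerivAt.comp (f := prF EB EF i) u
          (prF EB EF i).hasFDerivAt
      have h3 := (h2.clm_apply (hasFDerivAt_const V u)).clm_apply (hasFDerivAt_const W u)
      have h4 := (((h1.const_mul 2).exp.mul h3).smul (hasFDerivAt_pair hgr)).neg
      have h5 := fderiv_partial_fst hgr
      simp only [] at h5
      rw [h5]
      have h6 := h4.fderiv
      simp only [Pi.neg_def, Pi.smul_def', Pi.mul_def] at h6
      rw [h6]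
      simp [← hγ, hH]
      module
    rw [h.fst_curvatureEnd (f := fun u => 0) (g := fun u : EB × (∀ i, EF i) =>
        -((Real.exp (2 * φ i (u.1, u.2 i)) * GF i (u.2 i) V W) • baseGrad GB (φ i) (u.1, u.2 i)))
      (fun u hu => by rw [hu.christoffelL_inB_inF]; simp)
      (fun u hu => by rw [hu.christoffelL_inF_inF]; simp), hd]
    simp [h.christoffelL_inB_inF, h.christoffelL_inF_inF, h.christoffelL_inB_inB, covDeriv,
      ← hγ]
    module
  · by_cases hs : s = i
    · subst hs
      refine ⟨(curvatureEnd (christoffelL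
          (fun y => Real.exp (2 * φ s (u.1, y)) • GF s y)) (u.2 s) V W).toLinearMap
        + (H * fderiv ℝ (φ s) (u.1, u.2 s) (γ, 0)) • LinearMap.id
        - ((Real.exp (2 * φ s (u.1, u.2 s)) * fderiv ℝ (φ s) (u.1, u.2 s) (γ, 0)) •
          ((GF s (u.2 s)).flip W).toLinearMap).smulRight V, fun U => ?_, ?_⟩
      · have hm := isMetricAt_fibre (q := (u.1, u.2 s)) (h.fibre s) (h.smooth s)
        have hc := christoffelL_fibre (q := (u.1, u.2 s)) (h.fibre s) (h.smooth s)
        have hdf := fun a b c => fderiv_fibreChristoffel_fibre (q := (u.1, u.2 s))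
          (h.fibre s) (h.smooth s) a b c
        have := FiniteDimensional.complete ℝ (EF s)
        simp only [] at hm hc hdf
        rw [h.snd_curvatureEnd (f := fun u => fibreChristoffel (GF s) (φ s) (u.1, u.2 s) U W)
          (g := fun u => fibreChristoffel (GF s) (φ s) (u.1, u.2 s) V W)
          (fun u hu => by rw [hu.christoffelL_inF_inF]; simp)
          (fun u hu => by rw [hu.christoffelL_inF_inF]; simp)]
        rw [fderiv_pair (f := fun q => fibreChristoffel (GF s) (φ s) q U W)
          (differentiableAt_fibreChristoffel (h.fibre s) (h.smooth s) U W),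
          fderiv_pair (f := fun q => fibreChristoffel (GF s) (φ s) q V W)
          (differentiableAt_fibreChristoffel (h.fibre s) (h.smooth s) V W)]
        simp only [LinearMap.sub_apply, LinearMap.add_apply, ContinuousLinearMap.coe_coe,
          curvatureEnd_apply hm.differentiableAt_christoffelL, hc, fst_inF, snd_inF,
          Pi.single_eq_same, hdf, h.christoffelL_inF_inF, map_sub, map_smul,
          h.christoffelL_inF_inB, ← hγ]
        simp [hH]
        module
      · simp [(h.fibre s).symm_self V W, hH]
        ring
    · refine ⟨(H * fderiv ℝ (φ s) (u.1, u.2 s) (γ, 0)) • LinearMap.id, fun U => ?_, ?_⟩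
      · rw [h.snd_curvatureEnd (f := fun u => 0) (g := fun u => 0)
          (fun u hu => by rw [hu.christoffelL_inF_inF_of_ne hs]; simp)
          (fun u hu => by rw [hu.christoffelL_inF_inF]; simp [hs])]
        simp [h.christoffelL_inF_inF_of_ne hs, h.christoffelL_inF_inF, h.christoffelL_inF_inB,
          ← hγ, ← hH, smul_smul]
      · simp [hs]
        ring

end IsTwistedAt

end TwistedCurvature

/-! ### Dependence on germs; Hessian and Laplacian of an exponential -/

section ChartFunctions

variable {E : Type*} [NormedAddCommGroup E] [NormedSpace ℝ E]
  {G G' : E → E →L[ℝ] E →L[ℝ] ℝ} {P P' : E → E} {u : E}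

theorem christoffelL_congr (h : G' =ᶠ[𝓝 u] G) : christoffelL G' =ᶠ[𝓝 u] christoffelL G := by
  filter_upwards [christoffel_congr h] with u' h
  ext v w
  rw [christoffelL_apply, christoffelL_apply, h]

theorem covDeriv_congr (h : G' =ᶠ[𝓝 u] G) (hP : P' =ᶠ[𝓝 u] P) :
    covDeriv G' P' u = covDeriv G P u := by
  rw [covDeriv, covDeriv, hP.fderiv_eq, hP.self_of_nhds, (christoffelL_congr h).self_of_nhds]

theorem curvatureEnd_congr {Γ Γ' : E → E →L[ℝ] E →L[ℝ] E} (h : Γ' =ᶠ[𝓝 u] Γ) :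
    curvatureEnd Γ' u = curvatureEnd Γ u := by
  funext x z
  rw [curvatureEnd, curvatureEnd, h.fderiv_eq, h.self_of_nhds]

/-- The closed Ricci formula involves only finitely many derivatives at `u`. This allows the
replacement of chart expressions that agree merely near the centre. -/
theorem ricci_quarterSymmetric_congr [FiniteDimensional ℝ E] (hG : IsMetricAt G u)
    (hP : DifferentiableAt ℝ P u) (h : G' =ᶠ[𝓝 u] G) (hP' : P' =ᶠ[𝓝 u] P) (l₁ l₂ : ℝ) :
    ricci G' (quarterSymmetric G' P' l₁ l₂) u = ricci G (quarterSymmetric G P l₁ l₂) u := by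
  funext x z
  rw [ricci_quarterSymmetric (hG.congr h) (hP.congr_of_eventuallyEq hP'),
    ricci_quarterSymmetric hG hP, covDeriv_congr h hP', curvatureEnd_congr (christoffelL_congr h),
    h.self_of_nhds, hP'.self_of_nhds]

theorem ricci_quarterSymmetric_zero [FiniteDimensional ℝ E] (hG : IsMetricAt G u) (l₁ l₂ : ℝ)
    (x z : E) :
    ricci G (quarterSymmetric G (fun _ => 0) l₁ l₂) u x z
      = LinearMap.trace ℝ E (curvatureEnd (christoffelL G) u x z).toLinearMap := by
  rw [ricci_quarterSymmetric hG (differentiableAt_const _)]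
  simp [covDeriv]

/-- `⟨∇_v grad ψ, w⟩` is the Hessian of `ψ`. -/
theorem apply_covDeriv_grad [FiniteDimensional ℝ E] (hG : IsMetricAt G u) {ψ : E → ℝ}
    (hψ : ContDiffAt ℝ 2 ψ u) (v w : E) :
    G u (covDeriv G (fun x => sharp (G x) (fderiv ℝ ψ x)) u v) w
      = fderiv ℝ (fderiv ℝ ψ) u v w - fderiv ℝ ψ u (christoffelL G u v w) := by
  have := FiniteDimensional.complete ℝ E
  have h1 : DifferentiableAt ℝ (fderiv ℝ ψ) u :=
    (hψ.fderiv_right (m := 1) (by norm_num)).differentiableAt (by simp)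
  have h2 : DifferentiableAt ℝ (fun x => sharp (G x) (fderiv ℝ ψ x)) u :=
    differentiableAt_sharp hG.differentiableAt hG.inv h1
  -- The defining identity of the gradient is differentiated; metric compatibility then assembles
  -- the left side into ∇ grad ψ plus dψ of a symbol.
  have h3 : (fun x => G x (sharp (G x) (fderiv ℝ ψ x)) w) =ᶠ[𝓝 u] fun x => fderiv ℝ ψ x w := by
    filter_upwards [hG.eventually] with x hx
    rw [sharp_apply hx.inv]
  have h4 := congrArg (fun A : E →L[ℝ] ℝ => A v) h3.fderiv_eq
  have h5 := (hG.differentiableAt.hasFDerivAt.clm_apply h2.hasFDerivAt).clm_apply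
    (hasFDerivAt_const w u)
  have h6 := h1.hasFDerivAt.clm_apply (hasFDerivAt_const w u)
  rw [h5.fderiv, h6.fderiv] at h4
  simp [hG.fderiv_eq_christoffel, sharp_apply hG.inv] at h4
  simp only [covDeriv, add_apply, map_add, ContinuousLinearMap.flip_apply, christoffelL_apply]
  linarith

/-- The Hessian of `exp ψ`. -/
theorem hessian_exp {ψ : E → ℝ} (hψ : ContDiffAt ℝ 2 ψ u) (v w : E) :
    hessian G (fun x => Real.exp (ψ x)) u v w
      = Real.exp (ψ u) * (fderiv ℝ (fderiv ℝ ψ) u v w - fderiv ℝ ψ u (christoffelL G u v w)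
        + fderiv ℝ ψ u v * fderiv ℝ ψ u w) := by
  have h1 : DifferentiableAt ℝ (fderiv ℝ ψ) u :=
    (hψ.fderiv_right (m := 1) (by norm_num)).differentiableAt (by simp)
  have h2 : ∀ᶠ x in 𝓝 u, fderiv ℝ (fun x => Real.exp (ψ x)) x = Real.exp (ψ x) • fderiv ℝ ψ x := by
    filter_upwards [hψ.eventually (by simp)] with x hx
    exact (hx.differentiableAt (by simp)).hasFDerivAt.exp.fderiv
  have h3 : (fun x => fderiv ℝ (fun x => Real.exp (ψ x)) x w)
      =ᶠ[𝓝 u] fun x => Real.exp (ψ x) * fderiv ℝ ψ x w := by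
    filter_upwards [h2] with x hx
    rw [hx]
    rfl
  have h4 := (hψ.differentiableAt (by simp)).hasFDerivAt.exp.mul
    (h1.hasFDerivAt.clm_apply (hasFDerivAt_const w u))
  have h5 := h4.fderiv
  simp only [Pi.mul_def] at h5
  rw [hessian, h3.fderiv_eq, h5, h2.self_of_nhds, leviCivita_const]
  simp
  ring

theorem metricTrace_hessian_exp [FiniteDimensional ℝ E] (hG : IsMetricAt G u) {ψ : E → ℝ}
    (hψ : ContDiffAt ℝ 2 ψ u) :
    metricTrace (G u) (fun v w => hessian G (fun x => Real.exp (ψ x)) u v w)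
      = Real.exp (ψ u) * (LinearMap.trace ℝ E
          (covDeriv G (fun x => sharp (G x) (fderiv ℝ ψ x)) u).toLinearMap
        + fderiv ℝ ψ u (sharp (G u) (fderiv ℝ ψ u))) := by
  have key : ∀ v w, hessian G (fun x => Real.exp (ψ x)) u v w = G u ((Real.exp (ψ u) •
      ((covDeriv G (fun x => sharp (G x) (fderiv ℝ ψ x)) u).toLinearMap
        + (fderiv ℝ ψ u).toLinearMap.smulRight (sharp (G u) (fderiv ℝ ψ u))) : E →ₗ[ℝ] E) v) w := by
    intro v w
    rw [hessian_exp hψ, ← apply_covDeriv_grad hG hψ]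
    simp [sharp_apply hG.inv, mul_add]
  simp only [key]
  rw [metricTrace_eq_trace hG.inv hG.symm_self]
  simp [mul_add]

end ChartFunctions

/-! ### Ricci tensor of the quarter-symmetric connection on the twisted chart -/

section TwistedRicci

variable {ι : Type*} [DecidableEq ι]
  {EB : Type*} [NormedAddCommGroup EB] [NormedSpace ℝ EB]
  {EF : ι → Type*} [∀ i, NormedAddCommGroup (EF i)] [∀ i, NormedSpace ℝ (EF i)]
  [Fintype ι] [FiniteDimensional ℝ EB] [∀ i, FiniteDimensional ℝ (EF i)]
  {GB : EB → EB →L[ℝ] EB →L[ℝ] ℝ} {GF : ∀ i, EF i → EF i →L[ℝ] EF i →L[ℝ] ℝ}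
  {φ : ∀ i, EB × EF i → ℝ} {u : EB × (∀ i, EF i)} {P : EB → EB}

theorem twistedChart_inB_inB (X Y : EB) :
    twistedChart GB GF φ u (inB EB EF X) (inB EB EF Y) = GB u.1 X Y := by
  simp [twistedChart_apply]

theorem twistedChart_inB_inF (X : EB) {i : ι} (V : EF i) :
    twistedChart GB GF φ u (inB EB EF X) (inF EB EF i V) = 0 := by
  simp [twistedChart_apply]

theorem twistedChart_inF_inB (X : EB) {i : ι} (V : EF i) :
    twistedChart GB GF φ u (inF EB EF i V) (inB EB EF X) = 0 := by
  simp [twistedChart_apply]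

theorem twistedChart_inF_inF {i : ι} (V W : EF i) :
    twistedChart GB GF φ u (inF EB EF i V) (inF EB EF i W)
      = Real.exp (2 * φ i (u.1, u.2 i)) * GF i (u.2 i) V W := by
  rw [twistedChart_apply, Finset.sum_eq_single i (fun j _ hj => by simp [hj]) (by simp)]
  simp

theorem twistedChart_inF_inF_of_ne {i j : ι} (hij : i ≠ j) (V : EF i) (W : EF j) :
    twistedChart GB GF φ u (inF EB EF i V) (inF EB EF j W) = 0 := by
  rw [twistedChart_apply, Finset.sum_eq_single i (fun j _ hj => by simp [hj]) (by simp)]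
  simp [hij]

theorem finrank_twisted : (Module.finrank ℝ (EB × (∀ i, EF i)) : ℝ)
    = Module.finrank ℝ EB + ∑ i, (Module.finrank ℝ (EF i) : ℝ) := by
  rw [Module.finrank_prod, Module.finrank_pi_fintype]
  push_cast
  rfl

namespace IsTwistedAt

theorem fderiv_lift (hP : DifferentiableAt ℝ P u.1) :
    DifferentiableAt ℝ (fun u : EB × (∀ i, EF i) => inB EB EF (P u.1)) u :=
  (inB EB EF).differentiableAt.comp u (hP.comp u differentiableAt_fst)

theorem covDeriv_lift_inB (h : IsTwistedAt GB GF φ u) (hP : DifferentiableAt ℝ P u.1) (X : EB) :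
    covDeriv (twistedChart GB GF φ) (fun u => inB EB EF (P u.1)) u (inB EB EF X)
      = inB EB EF (covDeriv GB P u.1 X) := by
  have h1 := (inB EB EF).hasFDerivAt.comp u (hP.hasFDerivAt.comp u
    (ContinuousLinearMap.fst ℝ EB (∀ i, EF i)).hasFDerivAt)
  have h2 : fderiv ℝ (fun u : EB × (∀ i, EF i) => inB EB EF (P u.1)) u = _ := h1.fderiv
  rw [covDeriv, h2]
  simp [covDeriv, h.christoffelL_inB_inB]

theorem covDeriv_lift_inF (h : IsTwistedAt GB GF φ u) (hP : DifferentiableAt ℝ P u.1) {i : ι}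
    (V : EF i) :
    covDeriv (twistedChart GB GF φ) (fun u => inB EB EF (P u.1)) u (inF EB EF i V)
      = inF EB EF i (fderiv ℝ (φ i) (u.1, u.2 i) (P u.1, 0) • V) := by
  have h1 := (inB EB EF).hasFDerivAt.comp u (hP.hasFDerivAt.comp u
    (ContinuousLinearMap.fst ℝ EB (∀ i, EF i)).hasFDerivAt)
  have h2 : fderiv ℝ (fun u : EB × (∀ i, EF i) => inB EB EF (P u.1)) u = _ := h1.fderiv
  rw [covDeriv, h2]
  simp [h.christoffelL_inF_inB]

/-- Along `F i` the covariant derivative of the lifted field is P(φ_i) times the identity, so this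
fibre adds l_i P(φ_i) to the divergence. -/
theorem trace_covDeriv_lift (h : IsTwistedAt GB GF φ u) (hP : DifferentiableAt ℝ P u.1) :
    LinearMap.trace ℝ _
        (covDeriv (twistedChart GB GF φ) (fun u => inB EB EF (P u.1)) u).toLinearMap
      = LinearMap.trace ℝ _ (covDeriv GB P u.1).toLinearMap
        + ∑ i, Module.finrank ℝ (EF i) * fderiv ℝ (φ i) (u.1, u.2 i) (P u.1, 0) := by
  refine trace_blocks _ (fun Y => by rw [h.covDeriv_lift_inB hP]; rfl) fun i =>
    ⟨fderiv ℝ (φ i) (u.1, u.2 i) (P u.1, 0) • LinearMap.id, fun U => ?_, ?_⟩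
  · rw [h.covDeriv_lift_inF hP]
    simp
  · simp [mul_comm]

theorem ricci_inB_inB (h : IsTwistedAt GB GF φ u) (hP : DifferentiableAt ℝ P u.1) (l₁ l₂ : ℝ)
    (X Z : EB) :
    ricci (twistedChart GB GF φ) (quarterSymmetric (twistedChart GB GF φ)
        (fun u => inB EB EF (P u.1)) l₁ l₂) u (inB EB EF X) (inB EB EF Z)
      = ricci GB (quarterSymmetric GB P l₁ l₂) u.1 X Z
        + ∑ i, (Module.finrank ℝ (EF i) : ℝ) *
          ((fderiv ℝ (fderiv ℝ (φ i)) (u.1, u.2 i) (X, 0) (Z, 0)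
            - fderiv ℝ (φ i) (u.1, u.2 i) (christoffelL GB u.1 X Z, 0)
            + fderiv ℝ (φ i) (u.1, u.2 i) (X, 0) * fderiv ℝ (φ i) (u.1, u.2 i) (Z, 0))
            + l₂ * fderiv ℝ (φ i) (u.1, u.2 i) (P u.1, 0) * GB u.1 X Z
            + l₁ * l₂ * GB u.1 (P u.1) (P u.1) * GB u.1 X Z
            + l₁ * GB u.1 Z (covDeriv GB P u.1 X)
            - l₁ ^ 2 * GB u.1 X (P u.1) * GB u.1 Z (P u.1)) := by
  rw [ricci_quarterSymmetric h.isMetricAt (fderiv_lift hP), ricci_quarterSymmetric h.base hP,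
    h.trace_covDeriv_lift hP, h.trace_curvatureEnd_inB_inB, h.covDeriv_lift_inB hP,
    finrank_twisted]
  simp only [twistedChart_inB_inB]
  -- The dimension of the product exceeds that of the base by Σ l_i; this surplus, which multiplies
  -- terms independent of `i`, is distributed over the sum.
  have key : ∀ (a b c : ℝ) (d e l : ι → ℝ), ∑ i, l i * (d i + l₂ * e i * a + b + c)
      = ∑ i, l i * d i + l₂ * a * (∑ i, l i * e i) + (∑ i, l i) * (b + c) := by
    intro a b c d e l
    rw [Finset.mul_sum, Finset.sum_mul, ← Finset.sum_add_distrib, ← Finset.sum_add_distrib]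
    exact Finset.sum_congr rfl fun i _ => by ring
  have key2 := key (GB u.1 X Z) (l₁ * l₂ * GB u.1 (P u.1) (P u.1) * GB u.1 X Z)
    (l₁ * GB u.1 Z (covDeriv GB P u.1 X) - l₁ ^ 2 * GB u.1 X (P u.1) * GB u.1 Z (P u.1))
    (fun i => fderiv ℝ (fderiv ℝ (φ i)) (u.1, u.2 i) (X, 0) (Z, 0)
            - fderiv ℝ (φ i) (u.1, u.2 i) (christoffelL GB u.1 X Z, 0)
            + fderiv ℝ (φ i) (u.1, u.2 i) (X, 0) * fderiv ℝ (φ i) (u.1, u.2 i) (Z, 0))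
    (fun i => fderiv ℝ (φ i) (u.1, u.2 i) (P u.1, 0)) (fun i => (Module.finrank ℝ (EF i) : ℝ))
  simp only [add_sub_assoc] at key2 ⊢
  rw [key2]
  ring

/-- All corrections by `P` vanish: base and fibre are orthogonal, π kills fibre vectors, and ∇_X P
stays in the base. -/
theorem ricci_inB_inF (h : IsTwistedAt GB GF φ u) (hP : DifferentiableAt ℝ P u.1) (l₁ l₂ : ℝ)
    (X : EB) {i : ι} (V : EF i) :
    ricci (twistedChart GB GF φ) (quarterSymmetric (twistedChart GB GF φ)
        (fun u => inB EB EF (P u.1)) l₁ l₂) u (inB EB EF X) (inF EB EF i V)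
      = (Module.finrank ℝ (EF i) - 1) *
          fderiv ℝ (fderiv ℝ (φ i)) (u.1, u.2 i) (0, V) (X, 0) := by
  rw [ricci_quarterSymmetric h.isMetricAt (fderiv_lift hP), h.trace_curvatureEnd_inB_inF,
    h.covDeriv_lift_inB hP]
  simp [twistedChart_inF_inB, twistedChart_inB_inF]

theorem ricci_inF_inB (h : IsTwistedAt GB GF φ u) (hP : DifferentiableAt ℝ P u.1) (l₁ l₂ : ℝ)
    (X : EB) {i : ι} (V : EF i) :
    ricci (twistedChart GB GF φ) (quarterSymmetric (twistedChart GB GF φ)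
        (fun u => inB EB EF (P u.1)) l₁ l₂) u (inF EB EF i V) (inB EB EF X)
      = (Module.finrank ℝ (EF i) - 1) *
          fderiv ℝ (fderiv ℝ (φ i)) (u.1, u.2 i) (0, V) (X, 0) := by
  rw [ricci_quarterSymmetric h.isMetricAt (fderiv_lift hP), h.trace_curvatureEnd_inF_inB,
    h.covDeriv_lift_inF hP]
  simp [twistedChart_inF_inB, twistedChart_inB_inF]

theorem ricci_inF_inF_of_ne (h : IsTwistedAt GB GF φ u) (hP : DifferentiableAt ℝ P u.1)
    (l₁ l₂ : ℝ) {i j : ι} (hij : i ≠ j) (V : EF i) (W : EF j) :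
    ricci (twistedChart GB GF φ) (quarterSymmetric (twistedChart GB GF φ)
        (fun u => inB EB EF (P u.1)) l₁ l₂) u (inF EB EF i V) (inF EB EF j W) = 0 := by
  rw [ricci_quarterSymmetric h.isMetricAt (fderiv_lift hP),
    h.trace_curvatureEnd_inF_inF_of_ne hij, h.covDeriv_lift_inF hP]
  simp [twistedChart_inF_inB, twistedChart_inF_inF_of_ne hij,
    twistedChart_inF_inF_of_ne (Ne.symm hij)]

/-- Here g(W, ∇_V P) = P(φ_i) g(V,W) and π(V) = π(W) = 0, so every correction is a multiple of
g(V,W). -/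
theorem ricci_inF_inF (h : IsTwistedAt GB GF φ u) (hP : DifferentiableAt ℝ P u.1)
    (l₁ l₂ : ℝ) {i : ι} (V W : EF i) :
    ricci (twistedChart GB GF φ) (quarterSymmetric (twistedChart GB GF φ)
        (fun u => inB EB EF (P u.1)) l₁ l₂) u (inF EB EF i V) (inF EB EF i W)
      = LinearMap.trace ℝ _ (curvatureEnd (christoffelL
          (fun y => Real.exp (2 * φ i (u.1, y)) • GF i y)) (u.2 i) V W).toLinearMap
        + (LinearMap.trace ℝ _
              (covDeriv GB (fun x => baseGrad GB (φ i) (x, u.2 i)) u.1).toLinearMap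
            + ∑ s, Module.finrank ℝ (EF s) *
              fderiv ℝ (φ s) (u.1, u.2 s) (baseGrad GB (φ i) (u.1, u.2 i), 0)
          + ((Module.finrank ℝ EB + ∑ i, (Module.finrank ℝ (EF i) : ℝ) - 1) * l₁ * l₂ - l₂ ^ 2)
            * GB u.1 (P u.1) (P u.1)
          + l₂ * LinearMap.trace ℝ _ (covDeriv GB P u.1).toLinearMap
          + l₂ * ∑ s, Module.finrank ℝ (EF s) * fderiv ℝ (φ s) (u.1, u.2 s) (P u.1, 0)
          + ((Module.finrank ℝ EB + ∑ i, (Module.finrank ℝ (EF i) : ℝ) - 1) * l₁ - l₂)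
            * fderiv ℝ (φ i) (u.1, u.2 i) (P u.1, 0))
          * (Real.exp (2 * φ i (u.1, u.2 i)) * GF i (u.2 i) V W) := by
  rw [ricci_quarterSymmetric h.isMetricAt (fderiv_lift hP), h.trace_curvatureEnd_inF_inF,
    h.trace_covDeriv_lift hP, h.covDeriv_lift_inF hP, finrank_twisted]
  simp only [twistedChart_inF_inB, twistedChart_inF_inF, twistedChart_inB_inB, map_smul,
    smul_eq_mul, (h.fibre i).symm_self W V]
  ring

end IsTwistedAt

end TwistedRicci

/-! ### Metrics and vector fields of a manifold in the preferred chart -/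

open Bundle

/-- A continuous linear map out of a finite-dimensional space is the tuple of its values on a basis.
-/
theorem contDiffAt_clm_apply {D E F : Type*} [NormedAddCommGroup D] [NormedSpace ℝ D]
    [NormedAddCommGroup E] [NormedSpace ℝ E] [NormedAddCommGroup F] [NormedSpace ℝ F]
    [FiniteDimensional ℝ E] {n : WithTop ℕ∞} {f : D → E →L[ℝ] F} {x : D}
    (h : ∀ v, ContDiffAt ℝ n (fun u => f u v) x) : ContDiffAt ℝ n f x := by
  let d := Module.finrank ℝ E
  have hd : d = Module.finrank ℝ (Fin d → ℝ) := (Module.finrank_fin_fun ℝ).symm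
  let e₁ := ContinuousLinearEquiv.ofFinrankEq hd
  let e₂ := (e₁.arrowCongr (1 : F ≃L[ℝ] F)).trans (ContinuousLinearEquiv.piRing (Fin d))
  rw [← Function.id_comp f, ← e₂.symm_comp_self]
  exact e₂.symm.contDiff.contDiffAt.comp x (contDiffAt_pi.mpr fun i => h _)

section ChartAtPoint

variable {E : Type*} [NormedAddCommGroup E] [NormedSpace ℝ E]
  {M : Type*} [TopologicalSpace M] [ChartedSpace E M] [IsManifold 𝓘(ℝ, E) ∞ M]

theorem extChartAt_target_mem (p : M) {u : E} (hu : u ∈ (extChartAt 𝓘(ℝ, E) p).target) :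
    (extChartAt 𝓘(ℝ, E) p).target ∈ 𝓝 u :=
  (isOpen_extChartAt_target p).mem_nhds hu

theorem mdifferentiableAt_chart_symm (p : M) {u : E} (hu : u ∈ (extChartAt 𝓘(ℝ, E) p).target) :
    MDifferentiableAt 𝓘(ℝ, E) 𝓘(ℝ, E) (extChartAt 𝓘(ℝ, E) p).symm u := by
  have : IsManifold 𝓘(ℝ, E) 1 M := IsManifold.of_le (n := ∞) (by simp)
  have h := mdifferentiableWithinAt_extChartAt_symm (I := 𝓘(ℝ, E)) hu
  simpa [mdifferentiableWithinAt_univ] using h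

theorem isInvertible_mfderiv_chart_symm (p : M) {u : E}
    (hu : u ∈ (extChartAt 𝓘(ℝ, E) p).target) :
    (mfderiv 𝓘(ℝ, E) 𝓘(ℝ, E) (extChartAt 𝓘(ℝ, E) p).symm u).IsInvertible := by
  have : IsManifold 𝓘(ℝ, E) 1 M := IsManifold.of_le (n := ∞) (by simp)
  have h := isInvertible_mfderivWithin_extChartAt_symm (I := 𝓘(ℝ, E)) hu
  simpa [mfderivWithin_univ] using h

theorem mfderiv_chart_symm_self (p : M) :
    mfderiv 𝓘(ℝ, E) 𝓘(ℝ, E) (extChartAt 𝓘(ℝ, E) p).symm (extChartAt 𝓘(ℝ, E) p p)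
      = ContinuousLinearMap.id ℝ E := by
  have : IsManifold 𝓘(ℝ, E) 1 M := IsManifold.of_le (n := ∞) (by simp)
  have h := mfderivWithin_range_extChartAt_symm (I := 𝓘(ℝ, E)) (x := p)
  rw [ModelWithCorners.range_eq_univ, mfderivWithin_univ] at h
  exact h

theorem metricInChart_apply (g : BilinField 𝓘(ℝ, E) M) (p : M) (u v w : E) :
    metricInChart g p u v w = g ((extChartAt 𝓘(ℝ, E) p).symm u)
      (mfderiv 𝓘(ℝ, E) 𝓘(ℝ, E) (extChartAt 𝓘(ℝ, E) p).symm u v)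
      (mfderiv 𝓘(ℝ, E) 𝓘(ℝ, E) (extChartAt 𝓘(ℝ, E) p).symm u w) := rfl

theorem metricInChart_self (g : BilinField 𝓘(ℝ, E) M) (p : M) :
    metricInChart g p (extChartAt 𝓘(ℝ, E) p p) = g p := by
  -- The inverse chart returns `p` only up to a propositional equality, on which the tangent space
  -- depends; the point and the derivative are generalised so that both can be substituted.
  have key : ∀ q : M, q = p → ∀ A : E →L[ℝ] E, A = ContinuousLinearMap.id ℝ E →
      ContinuousLinearMap.bilinearComp (E := E) (F := E) (g q) A A = g p := by
    rintro q rfl A rfl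
    rfl
  exact key _ (extChartAt_to_inv p) _ (mfderiv_chart_symm_self p)

theorem fieldInChart_self (Y : ∀ q : M, TangentSpace 𝓘(ℝ, E) q) (p : M) :
    fieldInChart Y p (extChartAt 𝓘(ℝ, E) p p) = Y p := by
  have key : ∀ q : M, q = p → ∀ A : E →L[ℝ] E, A = ContinuousLinearMap.id ℝ E →
      A.inverse (Y q) = Y p := by
    rintro q rfl A rfl
    simp
    rfl
  exact key _ (extChartAt_to_inv p) _ (mfderiv_chart_symm_self p)

theorem differentiableAt_fieldInChart [CompleteSpace E] {Y : ∀ q : M, TangentSpace 𝓘(ℝ, E) q}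
    (hY : ContMDiff 𝓘(ℝ, E) (𝓘(ℝ, E)).tangent ∞
      (fun x => (⟨x, Y x⟩ : TangentBundle 𝓘(ℝ, E) M))) (p : M) :
    DifferentiableAt ℝ (fieldInChart Y p) (extChartAt 𝓘(ℝ, E) p p) := by
  have : IsManifold 𝓘(ℝ, E) (1 + 1) M := IsManifold.of_le (n := ∞) (by norm_cast)
  have hs : ContMDiffAt 𝓘(ℝ, E) 𝓘(ℝ, E) ∞ (extChartAt 𝓘(ℝ, E) p).symm
      (extChartAt 𝓘(ℝ, E) p p) :=
    (contMDiffOn_extChartAt_symm p).contMDiffAt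
      (extChartAt_target_mem p (mem_extChartAt_target p))
  have h := ContMDiffAt.mpullback_vectorField_preimage (n := ∞) (m := 1)
    ((hY _).of_le (by simp)) hs (isInvertible_mfderiv_chart_symm p (mem_extChartAt_target p))
    (by norm_cast)
  exact (contMDiffAt_vectorSpace_iff_contDiffAt.1 h).differentiableAt (by simp)

theorem contDiffAt_metricInChart [FiniteDimensional ℝ E] (g : PseudoRiemannianMetric 𝓘(ℝ, E) M)
    (p : M) : ContDiffAt ℝ 2 (metricInChart g.val p) (extChartAt 𝓘(ℝ, E) p p) := by
  have : IsManifold 𝓘(ℝ, E) 1 M := IsManifold.of_le (n := ∞) (by simp)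
  have : IsManifold 𝓘(ℝ, E) 3 M := IsManifold.of_le (n := ∞) (by norm_cast)
  have hs : ContMDiffOn 𝓘(ℝ, E) 𝓘(ℝ, E) ∞ (extChartAt 𝓘(ℝ, E) p).symm
      (extChartAt 𝓘(ℝ, E) p).target := contMDiffOn_extChartAt_symm p
  have hnhds := extChartAt_target_mem p (mem_extChartAt_target (I := 𝓘(ℝ, E)) p)
  have hs' := (hs.contMDiffAt hnhds)
  -- Coordinate fields are values of the tangent map of the inverse chart on constant vectors. The
  -- tangent map costs one derivative, so C³ is used for C².
  have hv : ∀ v : E, ContMDiffAt 𝓘(ℝ, E) (𝓘(ℝ, E)).tangent 2 (fun u =>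
      TotalSpace.mk' E (E := (TangentSpace 𝓘(ℝ, E) : M → Type _)) ((extChartAt 𝓘(ℝ, E) p).symm u)
        (mfderiv 𝓘(ℝ, E) 𝓘(ℝ, E) (extChartAt 𝓘(ℝ, E) p).symm u v))
      (extChartAt 𝓘(ℝ, E) p p) := by
    intro v
    have h1 := (hs.of_le (m := 3) (by norm_cast)).contMDiffOn_tangentMapWithin (m := 2)
      (by norm_num) (isOpen_extChartAt_target p).uniqueMDiffOn
    have h2 : ContMDiffAt (𝓘(ℝ, E)).tangent (𝓘(ℝ, E)).tangent 2
        (tangentMapWithin 𝓘(ℝ, E) 𝓘(ℝ, E) (extChartAt 𝓘(ℝ, E) p).symm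
          (extChartAt 𝓘(ℝ, E) p).target) (⟨extChartAt 𝓘(ℝ, E) p p, v⟩ : TangentBundle 𝓘(ℝ, E) E) :=
      h1.contMDiffAt ((FiberBundle.continuous_proj E (TangentSpace 𝓘(ℝ, E))).continuousAt
        hnhds)
    have h3 : ContMDiff 𝓘(ℝ, E) (𝓘(ℝ, E)).tangent 2
        (fun u : E => (⟨u, v⟩ : TangentBundle 𝓘(ℝ, E) E)) :=
      contMDiff_vectorSpace_iff_contDiff.2 contDiff_const
    refine (h2.comp (extChartAt 𝓘(ℝ, E) p p) h3.contMDiffAt).congr_of_eventuallyEq ?_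
    filter_upwards [hnhds] with u hu
    simp only [Function.comp_apply, tangentMapWithin]
    rw [mfderivWithin_of_isOpen (isOpen_extChartAt_target p) hu]
  have hg : ContMDiffAt 𝓘(ℝ, E) ((𝓘(ℝ, E)).prod 𝓘(ℝ, E →L[ℝ] E →L[ℝ] ℝ)) 2
      (fun u ↦ Bundle.TotalSpace.mk' (E →L[ℝ] E →L[ℝ] ℝ)
        (E := fun p : M ↦ TangentSpace 𝓘(ℝ, E) p →L[ℝ] TangentSpace 𝓘(ℝ, E) p →L[ℝ] ℝ)
        ((extChartAt 𝓘(ℝ, E) p).symm u) (g.val ((extChartAt 𝓘(ℝ, E) p).symm u)))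
      (extChartAt 𝓘(ℝ, E) p p) :=
    ((g.contMDiff.of_le (m := 2) (by norm_cast)).contMDiffAt).comp _ (hs'.of_le (by norm_cast))
  have hvw : ∀ v w : E, ContDiffAt ℝ 2 (fun u => metricInChart g.val p u v w)
      (extChartAt 𝓘(ℝ, E) p p) := by
    intro v w
    have h : ContMDiffAt 𝓘(ℝ, E) ((𝓘(ℝ, E)).prod 𝓘(ℝ)) 2
        (fun u ↦ TotalSpace.mk' ℝ (E := Bundle.Trivial M ℝ) ((extChartAt 𝓘(ℝ, E) p).symm u)
          (metricInChart g.val p u v w)) (extChartAt 𝓘(ℝ, E) p p) :=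
      ContMDiffAt.clm_bundle_apply₂ (F₁ := E) (F₂ := E) hg (hv v) (hv w)
    rw [contMDiffAt_totalSpace] at h
    exact contMDiffAt_iff_contDiffAt.1 h.2
  exact contDiffAt_clm_apply fun v => contDiffAt_clm_apply fun w => hvw v w

theorem isMetricAt_metricInChart [FiniteDimensional ℝ E] (g : PseudoRiemannianMetric 𝓘(ℝ, E) M)
    (p : M) : IsMetricAt (metricInChart g.val p) (extChartAt 𝓘(ℝ, E) p p) := by
  refine ⟨Eventually.of_forall fun u v w => ?_, ?_, contDiffAt_metricInChart g p⟩
  · rw [metricInChart_apply, metricInChart_apply, g.symm]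
  · rw [metricInChart_self]
    exact isInvertible_of_nondegenerate (E := E) (G := g.val p) (g.nondegenerate p)

end ChartAtPoint

/-! ### Manifold derivatives read in the chart at the image point -/

section ChartDerivative

variable {E E' : Type*} [NormedAddCommGroup E] [NormedSpace ℝ E] [NormedAddCommGroup E']
  [NormedSpace ℝ E'] {H' : Type*} [TopologicalSpace H'] {J : ModelWithCorners ℝ E' H'}
  {M' : Type*} [TopologicalSpace M'] [ChartedSpace H' M']

theorem hasMFDerivAt_of_hasFDerivAt_chart {f : E → M'} {D : E →L[ℝ] E'} {u : E}
    (hc : ContinuousAt f u) (hd : HasFDerivAt (fun u' => extChartAt J (f u) (f u')) D u) :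
    HasMFDerivAt 𝓘(ℝ, E) J f u D := by
  have h : HasFDerivWithinAt (fun u' => extChartAt J (f u) (f u')) D (Set.range 𝓘(ℝ, E)) u :=
    hd.hasFDerivWithinAt
  exact ⟨hc, h⟩

theorem hasFDerivAt_chart_of_hasMFDerivAt {f : E → M'} {D : E →L[ℝ] E'} {u : E}
    (h : HasMFDerivAt 𝓘(ℝ, E) J f u D) :
    HasFDerivAt (fun u' => extChartAt J (f u) (f u')) D u := by
  have h : HasFDerivWithinAt (fun u' => extChartAt J (f u) (f u')) D (Set.range 𝓘(ℝ, E)) u :=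
    h.2
  rwa [ModelWithCorners.range_eq_univ, hasFDerivWithinAt_univ] at h

end ChartDerivative

/-! ### Product chart: the twisted metric and the lift of a field -/

section ProductChart

variable {ι : Type*} [Fintype ι]
  {EB : Type*} [NormedAddCommGroup EB] [NormedSpace ℝ EB]
  {B : Type*} [TopologicalSpace B] [ChartedSpace EB B] [IsManifold 𝓘(ℝ, EB) ∞ B]
  {EF : ι → Type*} [∀ i, NormedAddCommGroup (EF i)] [∀ i, NormedSpace ℝ (EF i)]
  {F : ι → Type*} [∀ i, TopologicalSpace (F i)] [∀ i, ChartedSpace (EF i) (F i)]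
  [∀ i, IsManifold 𝓘(ℝ, EF i) ∞ (F i)]

/-- The derivative of the inverse product chart, assembled from those of the factors. -/
def productChartDeriv (p : B × (∀ i, F i)) (u : EB × (∀ i, EF i)) :
    EB × (∀ i, EF i) →L[ℝ] EB × (∀ i, EF i) :=
  ContinuousLinearMap.prod
    (ContinuousLinearMap.comp (M₂ := EB) (M₃ := EB)
      (mfderiv 𝓘(ℝ, EB) 𝓘(ℝ, EB) (extChartAt 𝓘(ℝ, EB) p.1).symm u.1)
      (ContinuousLinearMap.fst ℝ EB (∀ i, EF i)))
    (ContinuousLinearMap.pi fun i => ContinuousLinearMap.comp (M₂ := EF i) (M₃ := EF i)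
      (mfderiv 𝓘(ℝ, EF i) 𝓘(ℝ, EF i) (extChartAt 𝓘(ℝ, EF i) (p.2 i)).symm (u.2 i))
      ((ContinuousLinearMap.proj i).comp (ContinuousLinearMap.snd ℝ EB (∀ i, EF i))))

/-- The preferred chart of the product is the product of the preferred charts, also at the image
point, so the chart expression splits into components. -/
theorem hasMFDerivAt_product_symm (p : B × (∀ i, F i)) {u : EB × (∀ i, EF i)}
    (hB : u.1 ∈ (extChartAt 𝓘(ℝ, EB) p.1).target)
    (hF : ∀ i, u.2 i ∈ (extChartAt 𝓘(ℝ, EF i) (p.2 i)).target) :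
    HasMFDerivAt 𝓘(ℝ, EB × (∀ i, EF i)) (productModel EB EF)
      (extChartAt (productModel EB EF) p).symm u (productChartDeriv p u) := by
  have h1 := (mdifferentiableAt_chart_symm p.1 hB).hasMFDerivAt
  have h2 := fun i => (mdifferentiableAt_chart_symm (p.2 i) (hF i)).hasMFDerivAt
  refine hasMFDerivAt_of_hasFDerivAt_chart ?_ ?_
  · have c1 : ContinuousAt (fun u : EB × (∀ i, EF i) => (extChartAt 𝓘(ℝ, EB) p.1).symm u.1) u :=
      h1.1.comp continuousAt_fst
    have c2 : ContinuousAt (fun u : EB × (∀ i, EF i) =>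
        fun i => (extChartAt 𝓘(ℝ, EF i) (p.2 i)).symm (u.2 i)) u :=
      continuousAt_pi.2 fun i => (h2 i).1.comp
        (f := fun u : EB × (∀ i, EF i) => u.2 i) (by fun_prop)
    exact c1.prodMk c2
  · have e1 := HasFDerivAt.comp (f := Prod.fst) u (hasFDerivAt_chart_of_hasMFDerivAt h1)
      (ContinuousLinearMap.fst ℝ EB (∀ i, EF i)).hasFDerivAt
    have e2 := fun i => HasFDerivAt.comp (f := fun u : EB × (∀ i, EF i) => u.2 i) u
      (hasFDerivAt_chart_of_hasMFDerivAt (h2 i))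
      ((ContinuousLinearMap.proj i).comp (ContinuousLinearMap.snd ℝ EB (∀ i, EF i))).hasFDerivAt
    exact e1.prodMk (hasFDerivAt_pi.2 e2)

theorem eventually_mem_target (p : B × (∀ i, F i)) :
    ∀ᶠ u : EB × (∀ i, EF i) in 𝓝 (extChartAt (productModel EB EF) p p),
      u.1 ∈ (extChartAt 𝓘(ℝ, EB) p.1).target ∧
      ∀ i, u.2 i ∈ (extChartAt 𝓘(ℝ, EF i) (p.2 i)).target := by
  refine Eventually.and (continuousAt_fst.eventually
    (extChartAt_target_mem p.1 (mem_extChartAt_target p.1))) (eventually_all.2 fun i => ?_)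
  have hc : ContinuousAt (fun u : EB × (∀ i, EF i) => u.2 i)
    (extChartAt (productModel EB EF) p p) := by fun_prop
  exact hc.eventually (extChartAt_target_mem (p.2 i) (mem_extChartAt_target (p.2 i)))

variable {gB : BilinField 𝓘(ℝ, EB) B} {gF : ∀ i, BilinField 𝓘(ℝ, EF i) (F i)}
  {b : ∀ i, B → F i → ℝ}

/-- The logarithm of a warping function, in charts. -/
def logInChart {V : Type*} [NormedAddCommGroup V] [NormedSpace ℝ V] {N : Type*}
    [TopologicalSpace N] [ChartedSpace V N] (f : B → N → ℝ) (x : B) (y : N) (q : EB × V) : ℝ :=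
  Real.log (f ((extChartAt 𝓘(ℝ, EB) x).symm q.1) ((extChartAt 𝓘(ℝ, V) y).symm q.2))

theorem exp_two_mul_log {t : ℝ} (ht : 0 < t) : Real.exp (2 * Real.log t) = t ^ 2 := by
  rw [mul_comm, Real.exp_mul, Real.exp_log ht]
  norm_cast

/-- The scalar product `gB ⊕ c₁² gF₁ ⊕ ⋯ ⊕ c_m² gF_m` on one tangent space. -/
def twistedForm (gB : EB →L[ℝ] EB →L[ℝ] ℝ) (gF : ∀ i, EF i →L[ℝ] EF i →L[ℝ] ℝ) (c : ι → ℝ) :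
    EB × (∀ i, EF i) →L[ℝ] EB × (∀ i, EF i) →L[ℝ] ℝ :=
  gB.bilinearComp (ContinuousLinearMap.fst ℝ EB (∀ i, EF i))
      (ContinuousLinearMap.fst ℝ EB (∀ i, EF i))
    + ∑ i, (c i) ^ 2 • (gF i).bilinearComp
        ((ContinuousLinearMap.proj i).comp (ContinuousLinearMap.snd ℝ EB (∀ i, EF i)))
        ((ContinuousLinearMap.proj i).comp (ContinuousLinearMap.snd ℝ EB (∀ i, EF i)))

theorem twistedForm_apply (gB : EB →L[ℝ] EB →L[ℝ] ℝ) (gF : ∀ i, EF i →L[ℝ] EF i →L[ℝ] ℝ)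
    (c : ι → ℝ) (v w : EB × (∀ i, EF i)) :
    twistedForm gB gF c v w = gB v.1 w.1 + ∑ i, c i ^ 2 * gF i (v.2 i) (w.2 i) := by
  simp [twistedForm]

theorem metricInChart_twistedMetric (hb : ∀ i x y, 0 < b i x y) (p : B × (∀ i, F i)) :
    metricInChart (twistedMetric gB gF b) p
      =ᶠ[𝓝 (extChartAt (productModel EB EF) p p)]
        twistedChart (metricInChart gB p.1) (fun i => metricInChart (gF i) (p.2 i))
          (fun i => logInChart (b i) p.1 (p.2 i)) := by
  filter_upwards [eventually_mem_target p] with u hu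
  have h := (hasMFDerivAt_product_symm p hu.1 hu.2).mfderiv
  -- The coefficients are restated through `twistedForm`, on plain model spaces, where the form can
  -- be evaluated without tangent space types.
  have h2 : metricInChart (twistedMetric gB gF b) p u
      = (twistedForm (EB := EB) (EF := EF) (gB ((extChartAt 𝓘(ℝ, EB) p.1).symm u.1))
        (fun i => gF i ((extChartAt 𝓘(ℝ, EF i) (p.2 i)).symm (u.2 i)))
        (fun i => b i ((extChartAt 𝓘(ℝ, EB) p.1).symm u.1)
          ((extChartAt 𝓘(ℝ, EF i) (p.2 i)).symm (u.2 i)))).bilinearComp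
        (productChartDeriv p u) (productChartDeriv p u) := by
    rw [← h]
    rfl
  rw [h2]
  refine ContinuousLinearMap.ext fun v => ContinuousLinearMap.ext fun w => ?_
  rw [twistedChart_apply, ContinuousLinearMap.bilinearComp_apply]
  refine (twistedForm_apply (EB := EB) (EF := EF) _ _ _ _ _).trans ?_
  simp only [logInChart, exp_two_mul_log (hb _ _ _)]
  rfl

/-- The derivative of the inverse chart is block diagonal with invertible blocks, so its inverse
acts on a base vector through the base block alone. -/
theorem fieldInChart_liftB [DecidableEq ι] (P : ∀ x : B, TangentSpace 𝓘(ℝ, EB) x)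
    (p : B × (∀ i, F i)) :
    fieldInChart (fun q : B × (∀ i, F i) => (liftB (P q.1) : TangentSpace (productModel EB EF) q)) p
      =ᶠ[𝓝 (extChartAt (productModel EB EF) p p)]
        fun u => inB EB EF (fieldInChart P p.1 u.1) := by
  filter_upwards [eventually_mem_target p] with u hu
  have h := (hasMFDerivAt_product_symm p hu.1 hu.2).mfderiv
  have h2 : fieldInChart (fun q : B × (∀ i, F i) =>
      (liftB (P q.1) : TangentSpace (productModel EB EF) q)) p u
      = (productChartDeriv p u).inverse
        (inB EB EF (P ((extChartAt 𝓘(ℝ, EB) p.1).symm u.1))) := by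
    rw [← h]
    rfl
  obtain ⟨eB, heB⟩ : ∃ e : EB ≃L[ℝ] EB, (e : EB →L[ℝ] EB)
      = mfderiv 𝓘(ℝ, EB) 𝓘(ℝ, EB) (extChartAt 𝓘(ℝ, EB) p.1).symm u.1 :=
    isInvertible_mfderiv_chart_symm p.1 hu.1
  have hF : ∀ i, ∃ e : EF i ≃L[ℝ] EF i, (e : EF i →L[ℝ] EF i)
      = mfderiv 𝓘(ℝ, EF i) 𝓘(ℝ, EF i) (extChartAt 𝓘(ℝ, EF i) (p.2 i)).symm (u.2 i) := fun i =>
    isInvertible_mfderiv_chart_symm (p.2 i) (hu.2 i)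
  choose eF heF using hF
  have h3 : ((eB.prodCongr (ContinuousLinearEquiv.piCongrRight eF) :
      (EB × (∀ i, EF i)) ≃L[ℝ] (EB × (∀ i, EF i))) : (EB × (∀ i, EF i)) →L[ℝ] (EB × (∀ i, EF i)))
      = productChartDeriv p u := by
    unfold productChartDeriv
    rw [← heB]
    simp only [← heF]
    rfl
  have h4 : fieldInChart P p.1 u.1
      = (eB : EB →L[ℝ] EB).inverse (P ((extChartAt 𝓘(ℝ, EB) p.1).symm u.1)) := by
    rw [heB]
    rfl
  rw [h2, h4, ← h3, ContinuousLinearMap.inverse_equiv, ContinuousLinearMap.inverse_equiv]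
  refine Prod.ext rfl (funext fun i => ?_)
  exact map_zero (eF i).symm

end ProductChart

/-! ### Differential and divergence on one manifold through its chart -/

section SingleManifold

variable {E : Type*} [NormedAddCommGroup E] [NormedSpace ℝ E] [FiniteDimensional ℝ E]
  {M : Type*} [TopologicalSpace M] [ChartedSpace E M] [IsManifold 𝓘(ℝ, E) ∞ M]

theorem mvfderiv_eq_of_hasFDerivAt {f : M → ℝ} {p : M} {D : E →L[ℝ] ℝ}
    (hD : HasFDerivAt (fun u => f ((extChartAt 𝓘(ℝ, E) p).symm u)) D (extChartAt 𝓘(ℝ, E) p p)) :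
    (mvfderiv 𝓘(ℝ, E) f p : E →L[ℝ] ℝ) = D := by
  have : IsManifold 𝓘(ℝ, E) 1 M := IsManifold.of_le (n := ∞) (by simp)
  have hf : MDifferentiableAt 𝓘(ℝ, E) 𝓘(ℝ, ℝ) f p := by
    rw [← mdifferentiableWithinAt_univ]
    exact DifferentiableWithinAt.mdifferentiableWithinAt_of_comp_extChartAt_symm
      hD.differentiableAt.differentiableWithinAt
  have key : ∀ D' : E →L[ℝ] ℝ, HasFDerivWithinAt (fun u => f ((extChartAt 𝓘(ℝ, E) p).symm u)) D'
      (Set.range 𝓘(ℝ, E)) (extChartAt 𝓘(ℝ, E) p p) → D' = D := by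
    intro D' h
    rw [ModelWithCorners.range_eq_univ, hasFDerivWithinAt_univ] at h
    exact h.unique hD
  exact key _ hf.hasMFDerivAt.2

theorem sharp_smul (G : E →L[ℝ] E →L[ℝ] ℝ) (c : ℝ) (η : E →L[ℝ] ℝ) :
    sharp G (c • η) = c • sharp G η :=
  map_smul _ _ _

theorem divAt_eq_trace (g : PseudoRiemannianMetric 𝓘(ℝ, E) M)
    (P : ∀ x : M, TangentSpace 𝓘(ℝ, E) x) (p : M) :
    divAt g.val P p = LinearMap.trace ℝ E
      (covDeriv (metricInChart g.val p) (fieldInChart P p)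
        (extChartAt 𝓘(ℝ, E) p p)).toLinearMap := by
  have hG := isMetricAt_metricInChart g p
  rw [← metricTrace_eq_trace hG.inv hG.symm_self, metricInChart_self]
  simp only [ContinuousLinearMap.coe_coe, covDeriv_apply]
  rfl

end SingleManifold

/-! ### Derivatives of a twisting function in terms of its logarithm -/

section Pair

variable {EB : Type*} [NormedAddCommGroup EB] [NormedSpace ℝ EB] [FiniteDimensional ℝ EB]
  {B : Type*} [TopologicalSpace B] [ChartedSpace EB B] [IsManifold 𝓘(ℝ, EB) ∞ B]
  {V : Type*} [NormedAddCommGroup V] [NormedSpace ℝ V] [FiniteDimensional ℝ V]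
  {N : Type*} [TopologicalSpace N] [ChartedSpace V N] [IsManifold 𝓘(ℝ, V) ∞ N]
  {f : B → N → ℝ} (hf : ContMDiff ((𝓘(ℝ, EB)).prod 𝓘(ℝ, V)) 𝓘(ℝ, ℝ) ∞
    (fun q : B × N => f q.1 q.2)) (hpos : ∀ x y, 0 < f x y) (x : B) (y : N)

include hf hpos in
theorem contDiffAt_logInChart : ContDiffAt ℝ 2 (logInChart f x y)
    (extChartAt 𝓘(ℝ, EB) x x, extChartAt 𝓘(ℝ, V) y y) := by
  have h1 : ContMDiffAt 𝓘(ℝ, EB × V) 𝓘(ℝ, EB) ∞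
      (fun q : EB × V => (extChartAt 𝓘(ℝ, EB) x).symm q.1)
      (extChartAt 𝓘(ℝ, EB) x x, extChartAt 𝓘(ℝ, V) y y) :=
    ((contMDiffOn_extChartAt_symm x).contMDiffAt
      (extChartAt_target_mem x (mem_extChartAt_target x))).comp
      (f := fun q : EB × V => q.1)
      (extChartAt 𝓘(ℝ, EB) x x, extChartAt 𝓘(ℝ, V) y y) contDiff_fst.contMDiff.contMDiffAt
  have h2 : ContMDiffAt 𝓘(ℝ, EB × V) 𝓘(ℝ, V) ∞
      (fun q : EB × V => (extChartAt 𝓘(ℝ, V) y).symm q.2)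
      (extChartAt 𝓘(ℝ, EB) x x, extChartAt 𝓘(ℝ, V) y y) :=
    ((contMDiffOn_extChartAt_symm y).contMDiffAt
      (extChartAt_target_mem y (mem_extChartAt_target y))).comp
      (f := fun q : EB × V => q.2)
      (extChartAt 𝓘(ℝ, EB) x x, extChartAt 𝓘(ℝ, V) y y) contDiff_snd.contMDiff.contMDiffAt
  have h3 := (hf.contMDiffAt.comp (extChartAt 𝓘(ℝ, EB) x x, extChartAt 𝓘(ℝ, V) y y)
    (h1.prodMk h2))
  have h4 := (contMDiffAt_iff_contDiffAt.1 h3).log (hpos _ _).ne'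
  exact h4.of_le (by norm_cast)

include hpos in
theorem inChart_eq_exp (u : EB) : f ((extChartAt 𝓘(ℝ, EB) x).symm u) y
    = Real.exp (logInChart f x y (u, extChartAt 𝓘(ℝ, V) y y)) := by
  rw [logInChart, Real.exp_log (hpos _ _), extChartAt_to_inv]

include hf hpos in
theorem contDiffAt_logInChart_left : ContDiffAt ℝ 2
    (fun u => logInChart f x y (u, extChartAt 𝓘(ℝ, V) y y)) (extChartAt 𝓘(ℝ, EB) x x) :=
  (contDiffAt_logInChart hf hpos x y).comp (f := fun u => (u, extChartAt 𝓘(ℝ, V) y y))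
    (extChartAt 𝓘(ℝ, EB) x x) (contDiffAt_id.prodMk contDiffAt_const)

include hf hpos in
theorem fderiv_logInChart_left :
    fderiv ℝ (fun u => logInChart f x y (u, extChartAt 𝓘(ℝ, V) y y)) (extChartAt 𝓘(ℝ, EB) x x)
      = (fderiv ℝ (logInChart f x y) (extChartAt 𝓘(ℝ, EB) x x, extChartAt 𝓘(ℝ, V) y y)).comp
        (ContinuousLinearMap.inl ℝ EB V) :=
  fderiv_partial_fst (q := (extChartAt 𝓘(ℝ, EB) x x, extChartAt 𝓘(ℝ, V) y y))
    ((contDiffAt_logInChart hf hpos x y).differentiableAt (by simp))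

include hf hpos in
theorem eventually_fderiv_logInChart_left :
    ∀ᶠ u in 𝓝 (extChartAt 𝓘(ℝ, EB) x x),
      fderiv ℝ (fun u => logInChart f x y (u, extChartAt 𝓘(ℝ, V) y y)) u
        = (fderiv ℝ (logInChart f x y) (u, extChartAt 𝓘(ℝ, V) y y)).comp
          (ContinuousLinearMap.inl ℝ EB V) := by
  have h1 : ∀ᶠ u in 𝓝 (extChartAt 𝓘(ℝ, EB) x x),
      ContDiffAt ℝ 2 (logInChart f x y) (u, extChartAt 𝓘(ℝ, V) y y) :=
    (Continuous.prodMk_left (extChartAt 𝓘(ℝ, V) y y)).continuousAt.eventually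
      ((contDiffAt_logInChart hf hpos x y).eventually (by simp))
  filter_upwards [h1] with u hu
  exact fderiv_partial_fst (q := (u, extChartAt 𝓘(ℝ, V) y y)) (hu.differentiableAt (by simp))

include hf hpos in
theorem second_fderiv_logInChart_left (X Y : EB) :
    fderiv ℝ (fderiv ℝ (fun u => logInChart f x y (u, extChartAt 𝓘(ℝ, V) y y)))
        (extChartAt 𝓘(ℝ, EB) x x) X Y
      = fderiv ℝ (fderiv ℝ (logInChart f x y))
        (extChartAt 𝓘(ℝ, EB) x x, extChartAt 𝓘(ℝ, V) y y) (X, 0) (Y, 0) := by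
  have he : fderiv ℝ (fun u => logInChart f x y (u, extChartAt 𝓘(ℝ, V) y y))
      =ᶠ[𝓝 (extChartAt 𝓘(ℝ, EB) x x)] _ := eventually_fderiv_logInChart_left hf hpos x y
  rw [he.fderiv_eq]
  have h1 : HasFDerivAt (fun u => fderiv ℝ (logInChart f x y) (u, extChartAt 𝓘(ℝ, V) y y)) _
      (extChartAt 𝓘(ℝ, EB) x x) :=
    (differentiableAt_fderiv (contDiffAt_logInChart hf hpos x y)).hasFDerivAt.comp
      (f := fun u => (u, extChartAt 𝓘(ℝ, V) y y)) (extChartAt 𝓘(ℝ, EB) x x)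
      (hasFDerivAt_prodMk_left _ _)
  rw [(h1.clm_comp (hasFDerivAt_const _ _)).fderiv]
  simp

include hpos in
theorem inChart_eq_exp_fun : (fun u => f ((extChartAt 𝓘(ℝ, EB) x).symm u) y)
    = fun u => Real.exp (logInChart f x y (u, extChartAt 𝓘(ℝ, V) y y)) :=
  funext (inChart_eq_exp hpos x y)

include hpos in
theorem exp_logInChart_self : Real.exp (logInChart f x y
    (extChartAt 𝓘(ℝ, EB) x x, extChartAt 𝓘(ℝ, V) y y)) = f x y := by
  rw [← inChart_eq_exp hpos, extChartAt_to_inv]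

include hf hpos in
theorem mvfderiv_left : (mvfderiv 𝓘(ℝ, EB) (fun x => f x y) x : EB →L[ℝ] ℝ)
    = f x y • (fderiv ℝ (logInChart f x y)
        (extChartAt 𝓘(ℝ, EB) x x, extChartAt 𝓘(ℝ, V) y y)).comp
          (ContinuousLinearMap.inl ℝ EB V) := by
  refine mvfderiv_eq_of_hasFDerivAt ?_
  rw [inChart_eq_exp_fun (V := V) hpos, ← fderiv_logInChart_left hf hpos]
  have h := ((contDiffAt_logInChart_left hf hpos x y).differentiableAt (by simp)).hasFDerivAt.exp
  rwa [exp_logInChart_self hpos] at h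

include hf hpos in
theorem hessianAt_left (gB : PseudoRiemannianMetric 𝓘(ℝ, EB) B) (X Y : EB) :
    hessianAt gB.val (fun x => f x y) x X Y
      = f x y * (fderiv ℝ (fderiv ℝ (logInChart f x y))
          (extChartAt 𝓘(ℝ, EB) x x, extChartAt 𝓘(ℝ, V) y y) (X, 0) (Y, 0)
        - fderiv ℝ (logInChart f x y) (extChartAt 𝓘(ℝ, EB) x x, extChartAt 𝓘(ℝ, V) y y)
          (christoffelL (metricInChart gB.val x) (extChartAt 𝓘(ℝ, EB) x x) X Y, 0)
        + fderiv ℝ (logInChart f x y) (extChartAt 𝓘(ℝ, EB) x x, extChartAt 𝓘(ℝ, V) y y) (X, 0)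
          * fderiv ℝ (logInChart f x y)
            (extChartAt 𝓘(ℝ, EB) x x, extChartAt 𝓘(ℝ, V) y y) (Y, 0)) := by
  change hessian _ (fun u => f ((extChartAt 𝓘(ℝ, EB) x).symm u) y) _ _ _ = _
  rw [inChart_eq_exp_fun (V := V) hpos, hessian_exp (contDiffAt_logInChart_left hf hpos x y),
    fderiv_logInChart_left hf hpos, second_fderiv_logInChart_left hf hpos,
    exp_logInChart_self hpos]
  rfl

include hf hpos in
theorem gradAt_left (gB : PseudoRiemannianMetric 𝓘(ℝ, EB) B) :
    gradAt gB.val (fun x => f x y) x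
      = f x y • baseGrad (metricInChart gB.val x) (logInChart f x y)
        (extChartAt 𝓘(ℝ, EB) x x, extChartAt 𝓘(ℝ, V) y y) := by
  change sharp (E := EB) (gB.val x) (mvfderiv 𝓘(ℝ, EB) (fun x => f x y) x : EB →L[ℝ] ℝ) = _
  refine (congrArg (sharp (E := EB) (gB.val x)) (mvfderiv_left hf hpos x y)).trans ?_
  unfold baseGrad
  rw [metricInChart_self]
  exact sharp_smul (E := EB) _ _ _

include hf hpos in
theorem laplacianAt_left (gB : PseudoRiemannianMetric 𝓘(ℝ, EB) B) :
    laplacianAt gB.val (fun x => f x y) x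
      = f x y * (LinearMap.trace ℝ EB (covDeriv (metricInChart gB.val x)
          (fun u => baseGrad (metricInChart gB.val x) (logInChart f x y)
            (u, extChartAt 𝓘(ℝ, V) y y)) (extChartAt 𝓘(ℝ, EB) x x)).toLinearMap
        + fderiv ℝ (logInChart f x y) (extChartAt 𝓘(ℝ, EB) x x, extChartAt 𝓘(ℝ, V) y y)
          (baseGrad (metricInChart gB.val x) (logInChart f x y)
            (extChartAt 𝓘(ℝ, EB) x x, extChartAt 𝓘(ℝ, V) y y), 0)) := by
  have h1 := metricTrace_hessian_exp (isMetricAt_metricInChart gB x)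
    (contDiffAt_logInChart_left hf hpos x y)
  have h2 : (fun u => sharp (metricInChart gB.val x u)
      (fderiv ℝ (fun u => logInChart f x y (u, extChartAt 𝓘(ℝ, V) y y)) u))
      =ᶠ[𝓝 (extChartAt 𝓘(ℝ, EB) x x)] fun u => baseGrad (metricInChart gB.val x)
        (logInChart f x y) (u, extChartAt 𝓘(ℝ, V) y y) := by
    filter_upwards [eventually_fderiv_logInChart_left hf hpos x y] with u hu
    rw [hu]
    rfl
  rw [covDeriv_congr EventuallyEq.rfl h2, fderiv_logInChart_left hf hpos,
    exp_logInChart_self hpos] at h1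
  refine Eq.trans ?_ h1
  rw [metricInChart_self, ← inChart_eq_exp_fun (V := V) hpos]
  rfl

include hf hpos in
-- Both derivatives can be taken in the charts centred at `x` and `y`, where the iterated derivative
-- is a mixed second derivative of the logarithm.
theorem mvfderiv_mvfderiv_log (X : EB) (W : V) :
    (mvfderiv 𝓘(ℝ, V) (fun y =>
        (mvfderiv 𝓘(ℝ, EB) (fun x => Real.log (f x y)) x : EB →L[ℝ] ℝ) X) y : V →L[ℝ] ℝ) W
      = fderiv ℝ (fderiv ℝ (logInChart f x y))
        (extChartAt 𝓘(ℝ, EB) x x, extChartAt 𝓘(ℝ, V) y y) (0, W) (X, 0) := by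
  have : IsManifold 𝓘(ℝ, V) 1 N := IsManifold.of_le (n := ∞) (by simp)
  -- The outer derivative needs the inner one at fibre points other than `y`. The fibre chart at
  -- `y'` serves only to prove differentiability and then disappears from the formula.
  have h1 : ∀ y', (mvfderiv 𝓘(ℝ, EB) (fun x => Real.log (f x y')) x : EB →L[ℝ] ℝ)
      = fderiv ℝ (fun u => Real.log (f ((extChartAt 𝓘(ℝ, EB) x).symm u) y'))
        (extChartAt 𝓘(ℝ, EB) x x) := by
    intro y'
    have hd : DifferentiableAt ℝ (fun u => Real.log (f ((extChartAt 𝓘(ℝ, EB) x).symm u) y'))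
        (extChartAt 𝓘(ℝ, EB) x x) := by
      have h := (contDiffAt_logInChart_left hf hpos x y').differentiableAt (by simp)
      simpa only [logInChart, extChartAt_to_inv] using h
    exact mvfderiv_eq_of_hasFDerivAt (f := fun x => Real.log (f x y')) hd.hasFDerivAt
  have h2 : HasFDerivAt (fun v => fderiv ℝ (logInChart f x y) (extChartAt 𝓘(ℝ, EB) x x, v) (X, 0))
      (((fderiv ℝ (fderiv ℝ (logInChart f x y))
        (extChartAt 𝓘(ℝ, EB) x x, extChartAt 𝓘(ℝ, V) y y)).flip (X, 0)).comp
          (ContinuousLinearMap.inr ℝ EB V)) (extChartAt 𝓘(ℝ, V) y y) := by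
    have h := (differentiableAt_fderiv (contDiffAt_logInChart hf hpos x y)).hasFDerivAt.comp
      (f := fun v => (extChartAt 𝓘(ℝ, EB) x x, v)) (extChartAt 𝓘(ℝ, V) y y)
      (hasFDerivAt_prodMk_right _ _)
    refine (h.clm_apply (hasFDerivAt_const (X, (0 : V)) _)).congr_fderiv ?_
    ext v
    simp
  have h3 : (fun v => (mvfderiv 𝓘(ℝ, EB)
        (fun x => Real.log (f x ((extChartAt 𝓘(ℝ, V) y).symm v))) x : EB →L[ℝ] ℝ) X)
      =ᶠ[𝓝 (extChartAt 𝓘(ℝ, V) y y)]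
        fun v => fderiv ℝ (logInChart f x y) (extChartAt 𝓘(ℝ, EB) x x, v) (X, 0) := by
    have h : ∀ᶠ v in 𝓝 (extChartAt 𝓘(ℝ, V) y y),
        ContDiffAt ℝ 2 (logInChart f x y) (extChartAt 𝓘(ℝ, EB) x x, v) :=
      (Continuous.prodMk_right (extChartAt 𝓘(ℝ, EB) x x)).continuousAt.eventually
        ((contDiffAt_logInChart hf hpos x y).eventually (by simp))
    filter_upwards [h] with v hv
    rw [h1]
    exact congrArg (fun A : EB →L[ℝ] ℝ => A X)
      (fderiv_partial_fst (q := (extChartAt 𝓘(ℝ, EB) x x, v)) (hv.differentiableAt (by simp)))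
  have h4 := h2.congr_of_eventuallyEq h3
  exact congrArg (fun A : V →L[ℝ] ℝ => A W) (mvfderiv_eq_of_hasFDerivAt (f := fun y =>
    (mvfderiv 𝓘(ℝ, EB) (fun x => Real.log (f x y)) x : EB →L[ℝ] ℝ) X) h4)

end Pair

/-! ### The induced connection on a fibre -/

section Fibre

variable {EB : Type*} [NormedAddCommGroup EB] [NormedSpace ℝ EB]
  {B : Type*} [TopologicalSpace B] [ChartedSpace EB B]
  {ι : Type*} [Fintype ι] {EF : ι → Type*} [∀ i, NormedAddCommGroup (EF i)]
  [∀ i, NormedSpace ℝ (EF i)] {F : ι → Type*} [∀ i, TopologicalSpace (F i)]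
  [∀ i, ChartedSpace (EF i) (F i)] {i : ι}

theorem metricInChart_fibreMetric (gF : BilinField 𝓘(ℝ, EF i) (F i)) {f : B → F i → ℝ}
    (hpos : ∀ x y, 0 < f x y) (x : B) (y : F i) :
    metricInChart (fibreMetric (EF := EF) (F := F) gF f x) y = fun u =>
      Real.exp (2 * logInChart f x y (extChartAt 𝓘(ℝ, EB) x x, u)) • metricInChart gF y u := by
  funext u
  simp only [logInChart, exp_two_mul_log (hpos _ _), extChartAt_to_inv]
  rfl

theorem quarterRicci_fibreMetric [FiniteDimensional ℝ EB] [IsManifold 𝓘(ℝ, EB) ∞ B]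
    [FiniteDimensional ℝ (EF i)] [IsManifold 𝓘(ℝ, EF i) ∞ (F i)]
    (gF : PseudoRiemannianMetric 𝓘(ℝ, EF i) (F i)) {f : B → F i → ℝ}
    (hf : ContMDiff ((𝓘(ℝ, EB)).prod 𝓘(ℝ, EF i)) 𝓘(ℝ, ℝ) ∞ (fun q : B × F i => f q.1 q.2))
    (hpos : ∀ x y, 0 < f x y) (x : B) (y : F i) (l₁ l₂ : ℝ) (v w : EF i) :
    quarterRicci (fibreMetric (EF := EF) (F := F) gF.val f x) (fun _ => 0) l₁ l₂ y v w
      = LinearMap.trace ℝ (EF i) (curvatureEnd (christoffelL (fun u =>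
          Real.exp (2 * logInChart f x y (extChartAt 𝓘(ℝ, EB) x x, u)) • metricInChart gF.val y u))
        (extChartAt 𝓘(ℝ, EF i) y y) v w).toLinearMap := by
  have h0 : fieldInChart (fun q : F i => (0 : TangentSpace 𝓘(ℝ, EF i) q)) y = fun _ => 0 := by
    funext u
    exact map_zero _
  have hM := isMetricAt_fibre (q := (extChartAt 𝓘(ℝ, EB) x x, extChartAt 𝓘(ℝ, EF i) y y))
    (isMetricAt_metricInChart gF y) (contDiffAt_logInChart hf hpos x y)
  change ricci (metricInChart (fibreMetric (EF := EF) (F := F) gF.val f x) y)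
    (quarterSymmetric (metricInChart (fibreMetric (EF := EF) (F := F) gF.val f x) y)
      (fieldInChart (fun q : F i => (0 : TangentSpace 𝓘(ℝ, EF i) q)) y) l₁ l₂) _ v w = _
  rw [h0, metricInChart_fibreMetric (EB := EB) gF.val hpos]
  exact ricci_quarterSymmetric_zero hM l₁ l₂ v w

/-- A constant factor leaves the Christoffel symbols unchanged, and Ricci, as the trace of an
endomorphism built from them, does not see the scale of the metric. -/
theorem quarterRicci_fibreMetric_of_const [FiniteDimensional ℝ EB] [IsManifold 𝓘(ℝ, EB) ∞ B]
    [FiniteDimensional ℝ (EF i)] [IsManifold 𝓘(ℝ, EF i) ∞ (F i)]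
    (gF : PseudoRiemannianMetric 𝓘(ℝ, EF i) (F i)) {f : B → F i → ℝ}
    (hf : ContMDiff ((𝓘(ℝ, EB)).prod 𝓘(ℝ, EF i)) 𝓘(ℝ, ℝ) ∞ (fun q : B × F i => f q.1 q.2))
    (hpos : ∀ x y, 0 < f x y) (x : B) (y : F i) (hc : ∀ y y', f x y = f x y') (l₁ l₂ : ℝ)
    (v w : EF i) :
    quarterRicci (fibreMetric (EF := EF) (F := F) gF.val f x) (fun _ => 0) l₁ l₂ y v w
      = leviCivitaRicci gF.val y v w := by
  have := FiniteDimensional.complete ℝ (EF i)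
  have hG := isMetricAt_metricInChart gF y
  refine (quarterRicci_fibreMetric gF hf hpos x y l₁ l₂ v w).trans
    (Eq.trans ?_ (ricci_leviCivita hG v w).symm)
  have h : (fun u => Real.exp (2 * logInChart f x y (extChartAt 𝓘(ℝ, EB) x x, u))
      • metricInChart gF.val y u)
      = fun u => Real.exp (2 * (fun _ => Real.log (f x y)) u) • metricInChart gF.val y u := by
    funext u
    simp only [logInChart, extChartAt_to_inv]
    rw [hc _ y]
  rw [h]
  refine congrArg (fun A : EF i →L[ℝ] EF i => LinearMap.trace ℝ (EF i) A.toLinearMap)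
    (congrFun (congrFun (curvatureEnd_congr ?_) v) w)
  filter_upwards [hG.eventually] with u hu
  ext v w
  rw [christoffelL_apply, christoffelL_apply, hu.christoffel_conformal contDiffAt_const]
  simp [sharp]

end Fibre

/-! ### Translation of the invariants of the product manifold into chart quantities -/

section TwistedManifold

variable {ι : Type*} [Fintype ι] [DecidableEq ι]
  {EB : Type*} [NormedAddCommGroup EB] [NormedSpace ℝ EB] [FiniteDimensional ℝ EB]
  {B : Type*} [TopologicalSpace B] [ChartedSpace EB B] [IsManifold 𝓘(ℝ, EB) ∞ B]
  {EF : ι → Type*} [∀ i, NormedAddCommGroup (EF i)] [∀ i, NormedSpace ℝ (EF i)]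
  [∀ i, FiniteDimensional ℝ (EF i)]
  {F : ι → Type*} [∀ i, TopologicalSpace (F i)] [∀ i, ChartedSpace (EF i) (F i)]
  [∀ i, IsManifold 𝓘(ℝ, EF i) ∞ (F i)]
  {gB : PseudoRiemannianMetric 𝓘(ℝ, EB) B}
  {gF : ∀ i, PseudoRiemannianMetric 𝓘(ℝ, EF i) (F i)}
  {b : ∀ i, B → F i → ℝ}
  (hb : ∀ i, ContMDiff ((𝓘(ℝ, EB)).prod 𝓘(ℝ, EF i)) 𝓘(ℝ, ℝ) ∞
    (fun q : B × F i => b i q.1 q.2))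
  (hpos : ∀ i x y, 0 < b i x y)
  {P : ∀ x : B, TangentSpace 𝓘(ℝ, EB) x}
  (hP : ContMDiff 𝓘(ℝ, EB) (𝓘(ℝ, EB)).tangent ∞
    (fun x => (⟨x, P x⟩ : TangentBundle 𝓘(ℝ, EB) B)))
  (l₁ l₂ : ℝ) (p : B × (∀ i, F i))

include hb hpos in
theorem isTwistedAt_charts : IsTwistedAt (metricInChart gB.val p.1)
    (fun i => metricInChart (gF i).val (p.2 i)) (fun i => logInChart (b i) p.1 (p.2 i))
    (extChartAt (productModel EB EF) p p) :=
  ⟨isMetricAt_metricInChart gB p.1, fun i => isMetricAt_metricInChart (gF i) (p.2 i),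
    fun i => contDiffAt_logInChart (hb i) (hpos i) p.1 (p.2 i)⟩

theorem twistedMetric_liftB_liftB (X Y : EB) :
    twistedMetric gB.val (fun i => (gF i).val) b p (liftB X) (liftB Y) = gB.val p.1 X Y := by
  refine (twistedForm_apply (EB := EB) (EF := EF) _ _ _ _ _).trans ?_
  refine (congrArg (gB.val p.1 X Y + ·) (Finset.sum_eq_zero fun i _ => ?_)).trans (add_zero _)
  exact (congrArg (_ * ·) (map_zero _)).trans (mul_zero _)

theorem twistedMetric_liftF_liftF {i : ι} (V W : EF i) :
    twistedMetric gB.val (fun i => (gF i).val) b p (liftF V) (liftF W)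
      = b i p.1 (p.2 i) ^ 2 * (gF i).val (p.2 i) V W := by
  have h : ∀ (GB : EB →L[ℝ] EB →L[ℝ] ℝ) (GF : ∀ i, EF i →L[ℝ] EF i →L[ℝ] ℝ) (c : ι → ℝ),
      twistedForm GB GF c (inF EB EF i V) (inF EB EF i W) = c i ^ 2 * GF i V W := by
    intro GB GF c
    rw [twistedForm_apply, Finset.sum_eq_single i (fun j _ hj => by simp [hj]) (by simp)]
    simp
  exact h _ _ _

include hb hpos hP in
theorem quarterRicci_twistedMetric :
    quarterRicci (twistedMetric gB.val (fun i => (gF i).val) b)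
        (fun q : B × (∀ i, F i) => (liftB (P q.1) : TangentSpace (productModel EB EF) q)) l₁ l₂ p
      = ricci (twistedChart (metricInChart gB.val p.1)
          (fun i => metricInChart (gF i).val (p.2 i)) (fun i => logInChart (b i) p.1 (p.2 i)))
        (quarterSymmetric (twistedChart (metricInChart gB.val p.1)
          (fun i => metricInChart (gF i).val (p.2 i)) (fun i => logInChart (b i) p.1 (p.2 i)))
          (fun u => inB EB EF (fieldInChart P p.1 u.1)) l₁ l₂)
        (extChartAt (productModel EB EF) p p) := by
  have := FiniteDimensional.complete ℝ EB
  refine ricci_quarterSymmetric_congr (isTwistedAt_charts hb hpos p).isMetricAt ?_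
    (metricInChart_twistedMetric hpos p) (fieldInChart_liftB P p) l₁ l₂
  exact (inB EB EF).differentiableAt.comp (extChartAt (productModel EB EF) p p)
    ((differentiableAt_fieldInChart hP p.1).comp (f := Prod.fst)
      (extChartAt (productModel EB EF) p p) differentiableAt_fst)

include hb hpos hP in
theorem leviCivitaAt_twistedMetric_liftB (X : EB) :
    leviCivitaAt (twistedMetric gB.val (fun i => (gF i).val) b) p (liftB X)
        (fun q : B × (∀ i, F i) => (liftB (P q.1) : TangentSpace (productModel EB EF) q))
      = liftB (covDeriv (metricInChart gB.val p.1) (fieldInChart P p.1)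
          (extChartAt 𝓘(ℝ, EB) p.1 p.1) X) := by
  have := FiniteDimensional.complete ℝ EB
  refine (covDeriv_apply (E := EB × (∀ i, EF i)) _ _ _ _).symm.trans ?_
  refine (congrArg (fun A : EB × (∀ i, EF i) →L[ℝ] EB × (∀ i, EF i) => A (inB EB EF X))
    (covDeriv_congr (metricInChart_twistedMetric hpos p) (fieldInChart_liftB P p))).trans ?_
  exact (isTwistedAt_charts hb hpos p).covDeriv_lift_inB (differentiableAt_fieldInChart hP p.1) X

include hb hpos in
theorem hessianAt_div (i : ι) (X Y : EB) :
    hessianAt gB.val (fun x => b i x (p.2 i)) p.1 X Y / b i p.1 (p.2 i)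
      = fderiv ℝ (fderiv ℝ (logInChart (b i) p.1 (p.2 i)))
          (extChartAt 𝓘(ℝ, EB) p.1 p.1, extChartAt 𝓘(ℝ, EF i) (p.2 i) (p.2 i)) (X, 0) (Y, 0)
        - fderiv ℝ (logInChart (b i) p.1 (p.2 i))
          (extChartAt 𝓘(ℝ, EB) p.1 p.1, extChartAt 𝓘(ℝ, EF i) (p.2 i) (p.2 i))
          (christoffelL (metricInChart gB.val p.1) (extChartAt 𝓘(ℝ, EB) p.1 p.1) X Y, 0)
        + fderiv ℝ (logInChart (b i) p.1 (p.2 i))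
            (extChartAt 𝓘(ℝ, EB) p.1 p.1, extChartAt 𝓘(ℝ, EF i) (p.2 i) (p.2 i)) (X, 0)
          * fderiv ℝ (logInChart (b i) p.1 (p.2 i))
            (extChartAt 𝓘(ℝ, EB) p.1 p.1, extChartAt 𝓘(ℝ, EF i) (p.2 i) (p.2 i)) (Y, 0) := by
  rw [hessianAt_left (hb i) (hpos i) p.1 (p.2 i), mul_div_cancel_left₀ _ (hpos i _ _).ne']

include hb hpos in
theorem mvfderiv_div (i : ι) (X : EB) :
    (mvfderiv 𝓘(ℝ, EB) (fun x => b i x (p.2 i)) p.1 : EB →L[ℝ] ℝ) X / b i p.1 (p.2 i)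
      = fderiv ℝ (logInChart (b i) p.1 (p.2 i))
          (extChartAt 𝓘(ℝ, EB) p.1 p.1, extChartAt 𝓘(ℝ, EF i) (p.2 i) (p.2 i)) (X, 0) := by
  rw [mvfderiv_left (hb i) (hpos i) p.1 (p.2 i)]
  exact mul_div_cancel_left₀ _ (hpos i _ _).ne'

include hb hpos in
-- Since grad b = b grad φ in both slots, the two values of `b` cancel the denominator, and the
-- second gradient pairs as the differential of φ_s.
theorem gradAt_gradAt_div (i s : ι) :
    gB.val p.1 (gradAt gB.val (fun x => b i x (p.2 i)) p.1)
        (gradAt gB.val (fun x => b s x (p.2 s)) p.1) / (b i p.1 (p.2 i) * b s p.1 (p.2 s))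
      = fderiv ℝ (logInChart (b s) p.1 (p.2 s))
          (extChartAt 𝓘(ℝ, EB) p.1 p.1, extChartAt 𝓘(ℝ, EF s) (p.2 s) (p.2 s))
          (baseGrad (metricInChart gB.val p.1) (logInChart (b i) p.1 (p.2 i))
            (extChartAt 𝓘(ℝ, EB) p.1 p.1, extChartAt 𝓘(ℝ, EF i) (p.2 i) (p.2 i)), 0) := by
  have key : ∀ (A : EB →L[ℝ] EB →L[ℝ] ℝ) (hA : A.IsInvertible) (hs : ∀ v w, A v w = A w v)
      (c d : ℝ) (_ : c ≠ 0) (_ : d ≠ 0) (v : EB) (η : EB →L[ℝ] ℝ),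
      A (c • v) (d • sharp A η) / (c * d) = η v := by
    intro A hA hs c d hc hd v η
    rw [map_smul, map_smul, smul_apply, hs, sharp_apply hA, smul_eq_mul, smul_eq_mul]
    field_simp
  have hG := isMetricAt_metricInChart gB p.1
  have h := key (metricInChart gB.val p.1 (extChartAt 𝓘(ℝ, EB) p.1 p.1)) hG.inv hG.symm_self
    _ _ (hpos i p.1 (p.2 i)).ne' (hpos s p.1 (p.2 s)).ne'
    (baseGrad (metricInChart gB.val p.1) (logInChart (b i) p.1 (p.2 i))
      (extChartAt 𝓘(ℝ, EB) p.1 p.1, extChartAt 𝓘(ℝ, EF i) (p.2 i) (p.2 i)))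
    ((fderiv ℝ (logInChart (b s) p.1 (p.2 s))
      (extChartAt 𝓘(ℝ, EB) p.1 p.1, extChartAt 𝓘(ℝ, EF s) (p.2 s) (p.2 s))).comp
        (ContinuousLinearMap.inl ℝ EB (EF s)))
  rw [gradAt_left (hb i) (hpos i) p.1 (p.2 i), gradAt_left (hb s) (hpos s) p.1 (p.2 s)]
  rw [metricInChart_self] at h
  refine Eq.trans ?_ h
  unfold baseGrad
  rw [metricInChart_self]
  rfl

include hb hpos in
theorem laplacianAt_div (i : ι) :
    laplacianAt gB.val (fun x => b i x (p.2 i)) p.1 / b i p.1 (p.2 i)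
      = LinearMap.trace ℝ EB (covDeriv (metricInChart gB.val p.1)
          (fun u => baseGrad (metricInChart gB.val p.1) (logInChart (b i) p.1 (p.2 i))
            (u, extChartAt 𝓘(ℝ, EF i) (p.2 i) (p.2 i)))
          (extChartAt 𝓘(ℝ, EB) p.1 p.1)).toLinearMap
        + fderiv ℝ (logInChart (b i) p.1 (p.2 i))
          (extChartAt 𝓘(ℝ, EB) p.1 p.1, extChartAt 𝓘(ℝ, EF i) (p.2 i) (p.2 i))
          (baseGrad (metricInChart gB.val p.1) (logInChart (b i) p.1 (p.2 i))
            (extChartAt 𝓘(ℝ, EB) p.1 p.1, extChartAt 𝓘(ℝ, EF i) (p.2 i) (p.2 i)), 0) := by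
  rw [laplacianAt_left (hb i) (hpos i) p.1 (p.2 i), mul_div_cancel_left₀ _ (hpos i _ _).ne']

end TwistedManifold

/-! ### The Ricci formulas on the manifold -/

section TwistedManifold

variable {ι : Type*} [Fintype ι] [DecidableEq ι]
  {EB : Type*} [NormedAddCommGroup EB] [NormedSpace ℝ EB] [FiniteDimensional ℝ EB]
  {B : Type*} [TopologicalSpace B] [ChartedSpace EB B] [IsManifold 𝓘(ℝ, EB) ∞ B]
  {EF : ι → Type*} [∀ i, NormedAddCommGroup (EF i)] [∀ i, NormedSpace ℝ (EF i)]
  [∀ i, FiniteDimensional ℝ (EF i)]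
  {F : ι → Type*} [∀ i, TopologicalSpace (F i)] [∀ i, ChartedSpace (EF i) (F i)]
  [∀ i, IsManifold 𝓘(ℝ, EF i) ∞ (F i)]
  {gB : PseudoRiemannianMetric 𝓘(ℝ, EB) B}
  {gF : ∀ i, PseudoRiemannianMetric 𝓘(ℝ, EF i) (F i)}
  {b : ∀ i, B → F i → ℝ}
  (hb : ∀ i, ContMDiff ((𝓘(ℝ, EB)).prod 𝓘(ℝ, EF i)) 𝓘(ℝ, ℝ) ∞
    (fun q : B × F i => b i q.1 q.2))
  (hpos : ∀ i x y, 0 < b i x y)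
  {P : ∀ x : B, TangentSpace 𝓘(ℝ, EB) x}
  (hP : ContMDiff 𝓘(ℝ, EB) (𝓘(ℝ, EB)).tangent ∞
    (fun x => (⟨x, P x⟩ : TangentBundle 𝓘(ℝ, EB) B)))
  (l₁ l₂ : ℝ) (p : B × (∀ i, F i))

include hb hpos hP in
theorem quarterRicci_liftB_liftB (X Y : EB) :
    quarterRicci (twistedMetric gB.val (fun i => (gF i).val) b)
        (fun q : B × (∀ i, F i) => (liftB (P q.1) : TangentSpace (productModel EB EF) q)) l₁ l₂ p
        (liftB X) (liftB Y)
      = quarterRicci gB.val P l₁ l₂ p.1 X Y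
        + ∑ i, (Module.finrank ℝ (EF i) : ℝ) *
          (hessianAt gB.val (fun x => b i x (p.2 i)) p.1 X Y / b i p.1 (p.2 i)
          + l₂ * ((mvfderiv 𝓘(ℝ, EB) (fun x => b i x (p.2 i)) p.1 : EB →L[ℝ] ℝ) (P p.1)
              / b i p.1 (p.2 i))
            * twistedMetric gB.val (fun i => (gF i).val) b p (liftB X) (liftB Y)
          + l₁ * l₂ * twistedMetric gB.val (fun i => (gF i).val) b p (liftB (P p.1)) (liftB (P p.1))
            * twistedMetric gB.val (fun i => (gF i).val) b p (liftB X) (liftB Y)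
          + l₁ * twistedMetric gB.val (fun i => (gF i).val) b p (liftB Y)
            (leviCivitaAt (twistedMetric gB.val (fun i => (gF i).val) b) p (liftB X)
              (fun q : B × (∀ i, F i) => (liftB (P q.1) : TangentSpace (productModel EB EF) q)))
          - l₁ ^ 2 * twistedMetric gB.val (fun i => (gF i).val) b p (liftB X) (liftB (P p.1))
            * twistedMetric gB.val (fun i => (gF i).val) b p (liftB Y) (liftB (P p.1))) := by
  have := FiniteDimensional.complete ℝ EB
  have hm : metricInChart gB.val p.1 (extChartAt (productModel EB EF) p p).1 = gB.val p.1 :=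
    metricInChart_self gB.val p.1
  have hf : fieldInChart P p.1 (extChartAt (productModel EB EF) p p).1 = P p.1 :=
    fieldInChart_self P p.1
  rw [quarterRicci_twistedMetric hb hpos hP, leviCivitaAt_twistedMetric_liftB hb hpos hP]
  refine ((isTwistedAt_charts hb hpos p).ricci_inB_inB
    (differentiableAt_fieldInChart hP p.1) l₁ l₂ X Y).trans ?_
  rw [hf, hm]
  refine congrArg (quarterRicci gB.val P l₁ l₂ p.1 X Y + ·)
    (Finset.sum_congr rfl fun i _ => congrArg (_ * ·) ?_)
  rw [hessianAt_div hb hpos p i X Y, mvfderiv_div hb hpos p i (P p.1),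
    twistedMetric_liftB_liftB (EB := EB) p X Y,
    twistedMetric_liftB_liftB (EB := EB) p (P p.1) (P p.1),
    twistedMetric_liftB_liftB (EB := EB) p X (P p.1),
    twistedMetric_liftB_liftB (EB := EB) p Y (P p.1)]
  refine (congrArg (fun t => _ + l₁ * t - _)
    (twistedMetric_liftB_liftB (EB := EB) p Y _).symm)

include hb hpos hP in
theorem quarterRicci_liftB_liftF (i : ι) (X : EB) (V : EF i) :
    quarterRicci (twistedMetric gB.val (fun i => (gF i).val) b)
        (fun q : B × (∀ i, F i) => (liftB (P q.1) : TangentSpace (productModel EB EF) q)) l₁ l₂ p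
        (liftB X) (liftF V)
      = (Module.finrank ℝ (EF i) - 1) * (mvfderiv 𝓘(ℝ, EF i) (fun y =>
        (mvfderiv 𝓘(ℝ, EB) (fun x => Real.log (b i x y)) p.1 : EB →L[ℝ] ℝ) X) (p.2 i)
          : EF i →L[ℝ] ℝ) V := by
  have := FiniteDimensional.complete ℝ EB
  rw [quarterRicci_twistedMetric hb hpos hP,
    mvfderiv_mvfderiv_log (hb i) (hpos i) p.1 (p.2 i) X V]
  exact (isTwistedAt_charts hb hpos p).ricci_inB_inF
    (differentiableAt_fieldInChart hP p.1) l₁ l₂ X V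

include hb hpos hP in
theorem quarterRicci_liftF_liftB (i : ι) (X : EB) (V : EF i) :
    quarterRicci (twistedMetric gB.val (fun i => (gF i).val) b)
        (fun q : B × (∀ i, F i) => (liftB (P q.1) : TangentSpace (productModel EB EF) q)) l₁ l₂ p
        (liftF V) (liftB X)
      = (Module.finrank ℝ (EF i) - 1) * (mvfderiv 𝓘(ℝ, EF i) (fun y =>
        (mvfderiv 𝓘(ℝ, EB) (fun x => Real.log (b i x y)) p.1 : EB →L[ℝ] ℝ) X) (p.2 i)
          : EF i →L[ℝ] ℝ) V := by
  have := FiniteDimensional.complete ℝ EB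
  rw [quarterRicci_twistedMetric hb hpos hP,
    mvfderiv_mvfderiv_log (hb i) (hpos i) p.1 (p.2 i) X V]
  exact (isTwistedAt_charts hb hpos p).ricci_inF_inB
    (differentiableAt_fieldInChart hP p.1) l₁ l₂ X V

include hb hpos hP in
theorem quarterRicci_liftF_liftF_of_ne {i j : ι} (hij : i ≠ j) (V : EF i) (W : EF j) :
    quarterRicci (twistedMetric gB.val (fun i => (gF i).val) b)
        (fun q : B × (∀ i, F i) => (liftB (P q.1) : TangentSpace (productModel EB EF) q)) l₁ l₂ p
        (liftF V) (liftF W) = 0 := by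
  have := FiniteDimensional.complete ℝ EB
  rw [quarterRicci_twistedMetric hb hpos hP]
  exact (isTwistedAt_charts hb hpos p).ricci_inF_inF_of_ne (differentiableAt_fieldInChart hP p.1)
    l₁ l₂ hij V W

include hb hpos hP in
theorem quarterRicci_liftF_liftF (i : ι) (V W : EF i) :
    quarterRicci (twistedMetric gB.val (fun i => (gF i).val) b)
        (fun q : B × (∀ i, F i) => (liftB (P q.1) : TangentSpace (productModel EB EF) q)) l₁ l₂ p
        (liftF V) (liftF W)
      = quarterRicci (fibreMetric (EF := EF) (F := F) (gF i).val (b i) p.1) (fun _ => 0) l₁ l₂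
          (p.2 i) V W
        + (laplacianAt gB.val (fun x => b i x (p.2 i)) p.1 / b i p.1 (p.2 i)
          + (Module.finrank ℝ (EF i) - 1) *
            (gB.val p.1 (gradAt gB.val (fun x => b i x (p.2 i)) p.1)
              (gradAt gB.val (fun x => b i x (p.2 i)) p.1) / b i p.1 (p.2 i) ^ 2)
          + ∑ s ∈ Finset.univ.erase i, Module.finrank ℝ (EF s) *
            (gB.val p.1 (gradAt gB.val (fun x => b i x (p.2 i)) p.1)
              (gradAt gB.val (fun x => b s x (p.2 s)) p.1) / (b i p.1 (p.2 i) * b s p.1 (p.2 s)))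
          + ((Module.finrank ℝ EB + ∑ i, (Module.finrank ℝ (EF i) : ℝ) - 1) * l₁ * l₂ - l₂ ^ 2)
            * twistedMetric gB.val (fun i => (gF i).val) b p (liftB (P p.1)) (liftB (P p.1))
          + l₂ * divAt gB.val P p.1
          + l₂ * ∑ s ∈ Finset.univ.erase i, Module.finrank ℝ (EF s) *
            ((mvfderiv 𝓘(ℝ, EB) (fun x => b s x (p.2 s)) p.1 : EB →L[ℝ] ℝ) (P p.1)
              / b s p.1 (p.2 s))
          + ((Module.finrank ℝ EB + ∑ i, (Module.finrank ℝ (EF i) : ℝ) - 1) * l₁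
              + (Module.finrank ℝ (EF i) - 1) * l₂)
            * ((mvfderiv 𝓘(ℝ, EB) (fun x => b i x (p.2 i)) p.1 : EB →L[ℝ] ℝ) (P p.1)
              / b i p.1 (p.2 i)))
          * twistedMetric gB.val (fun i => (gF i).val) b p (liftF V) (liftF W) := by
  have := FiniteDimensional.complete ℝ EB
  have hm : metricInChart gB.val p.1 (extChartAt (productModel EB EF) p p).1 = gB.val p.1 :=
    metricInChart_self gB.val p.1
  have hmF : metricInChart (gF i).val (p.2 i) ((extChartAt (productModel EB EF) p p).2 i)
      = (gF i).val (p.2 i) := metricInChart_self (gF i).val (p.2 i)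
  have hf : fieldInChart P p.1 (extChartAt (productModel EB EF) p p).1 = P p.1 :=
    fieldInChart_self P p.1
  have he : Real.exp (2 * logInChart (b i) p.1 (p.2 i)
      ((extChartAt (productModel EB EF) p p).1, (extChartAt (productModel EB EF) p p).2 i))
      = b i p.1 (p.2 i) ^ 2 := by
    rw [two_mul, Real.exp_add, sq]
    have h := exp_logInChart_self (EB := EB) (V := EF i) (hpos i) p.1 (p.2 i)
    exact congrArg₂ (· * ·) h h
  rw [quarterRicci_twistedMetric hb hpos hP]
  refine ((isTwistedAt_charts hb hpos p).ricci_inF_inF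
    (differentiableAt_fieldInChart hP p.1) l₁ l₂ V W).trans ?_
  rw [hf, hm, hmF, he]
  refine congrArg₂ (· + ·)
    (quarterRicci_fibreMetric (gF i) (hb i) (hpos i) p.1 (p.2 i) l₁ l₂ V W).symm
    (congrArg₂ (· * ·) ?_ (twistedMetric_liftF_liftF p V W).symm)
  rw [laplacianAt_div hb hpos, divAt_eq_trace,
    twistedMetric_liftB_liftB (EB := EB) p (P p.1) (P p.1),
    sq (b i p.1 (p.2 i))]
  simp only [gradAt_gradAt_div hb hpos, mvfderiv_div hb hpos p _ (P p.1)]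
  -- The index `i` is taken out of both sums. Of l_i A_i, one A_i completes Δb_i/b_i and l_i - 1
  -- copies remain; λ₂ l_i C_i merges with -λ₂ C_i into the coefficient (l_i - 1)λ₂ of P b_i/b_i.
  have key : ∀ (l A C : ι → ℝ) (T D G N : ℝ),
      T + ∑ s, l s * A s + ((N - 1) * l₁ * l₂ - l₂ ^ 2) * G + l₂ * D + l₂ * ∑ s, l s * C s
          + ((N - 1) * l₁ - l₂) * C i
        = T + A i + (l i - 1) * A i + ∑ s ∈ Finset.univ.erase i, l s * A s
          + ((N - 1) * l₁ * l₂ - l₂ ^ 2) * G + l₂ * D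
          + l₂ * ∑ s ∈ Finset.univ.erase i, l s * C s
          + ((N - 1) * l₁ + (l i - 1) * l₂) * C i := by
    intro l A C T D G N
    rw [← Finset.add_sum_erase _ (fun s => l s * A s) (Finset.mem_univ i),
      ← Finset.add_sum_erase _ (fun s => l s * C s) (Finset.mem_univ i)]
    ring
  exact key (fun s => (Module.finrank ℝ (EF s) : ℝ)) _ _ _ _ _ _

end TwistedManifold

end QuarterSymmetric

end

/-! ### The theorem -/

open QuarterSymmetric in
theorem proposition4p5
    {ι : Type*} [Fintype ι] [DecidableEq ι]
    {EB : Type*} [NormedAddCommGroup EB] [NormedSpace ℝ EB] [FiniteDimensional ℝ EB]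
    {B : Type*} [TopologicalSpace B] [ChartedSpace EB B] [IsManifold 𝓘(ℝ, EB) ∞ B]
    {EF : ι → Type*} [∀ i, NormedAddCommGroup (EF i)] [∀ i, NormedSpace ℝ (EF i)]
    [∀ i, FiniteDimensional ℝ (EF i)]
    {F : ι → Type*} [∀ i, TopologicalSpace (F i)] [∀ i, ChartedSpace (EF i) (F i)]
    [∀ i, IsManifold 𝓘(ℝ, EF i) ∞ (F i)]
    (gB : PseudoRiemannianMetric 𝓘(ℝ, EB) B)
    (gF : ∀ i, PseudoRiemannianMetric 𝓘(ℝ, EF i) (F i))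
    (b : ∀ i, B → F i → ℝ)
    (hb : ∀ i, ContMDiff ((𝓘(ℝ, EB)).prod 𝓘(ℝ, EF i)) 𝓘(ℝ, ℝ) ∞
      (fun q : B × F i => b i q.1 q.2))
    (hb_pos : ∀ i x y, 0 < b i x y)
    (P : ∀ x : B, TangentSpace 𝓘(ℝ, EB) x)
    (hP : ContMDiff 𝓘(ℝ, EB) (𝓘(ℝ, EB)).tangent ∞
      (fun x => (⟨x, P x⟩ : TangentBundle 𝓘(ℝ, EB) B)))
    (l₁ l₂ : ℝ) (p : B × (∀ i, F i)) :
    -- the metric of the product and the lift of `P`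
    let g : BilinField (productModel EB EF) (B × (∀ i, F i)) :=
      twistedMetric gB.val (fun i => (gF i).val) b
    let Pl : ∀ q : B × (∀ i, F i), TangentSpace (productModel EB EF) q := fun q => liftB (P q.1)
    -- the 1-form `π`, at `p`
    let π : TangentSpace (productModel EB EF) p → ℝ := fun v => g p v (Pl p)
    -- the Ricci tensor of `∇̄`, at `p`
    let Ric := quarterRicci g Pl l₁ l₂ p
    -- the Ricci tensor of the connection induced by `∇̄` on the fibre `F i` through `p`, at `p.2 i`;
    -- the component of `P` tangent to the fibre is `0`
    let RicF := fun i =>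
      quarterRicci (fibreMetric (gF i).val (b i) p.1) (fun _ => 0) l₁ l₂ (p.2 i)
    -- the dimensions of the fibres and of the product
    let l : ι → ℝ := fun i => (Module.finrank ℝ (EF i) : ℝ)
    let N : ℝ := (Module.finrank ℝ EB : ℝ) + ∑ i, l i
    -- `b i` as a function on `B`, its value at `p` and its gradient on `B`
    let bB : ι → B → ℝ := fun i x => b i x (p.2 i)
    let β : ι → ℝ := fun i => b i p.1 (p.2 i)
    let grad : ∀ _ : ι, TangentSpace 𝓘(ℝ, EB) p.1 := fun i => gradAt gB.val (bB i) p.1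
    -- `P b_i` and `V X (ln b_i)`
    let Pb : ι → ℝ := fun i => mvfderiv 𝓘(ℝ, EB) (bB i) p.1 (P p.1)
    let VXlnb : ∀ i, TangentSpace 𝓘(ℝ, EF i) (p.2 i) → TangentSpace 𝓘(ℝ, EB) p.1 → ℝ :=
      fun i V X => mvfderiv 𝓘(ℝ, EF i)
        (fun y => mvfderiv 𝓘(ℝ, EB) (fun x => Real.log (b i x y)) p.1 X) (p.2 i) V
    -- base and base
    (∀ X Y : TangentSpace 𝓘(ℝ, EB) p.1,
      Ric (liftB X) (liftB Y) = quarterRicci gB.val P l₁ l₂ p.1 X Y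
        + ∑ i, l i * (hessianAt gB.val (bB i) p.1 X Y / β i
          + l₂ * (Pb i / β i) * g p (liftB X) (liftB Y)
          + l₁ * l₂ * π (Pl p) * g p (liftB X) (liftB Y)
          + l₁ * g p (liftB Y) (leviCivitaAt g p (liftB X) Pl)
          - l₁ ^ 2 * π (liftB X) * π (liftB Y))) ∧
    -- base and fibre
    (∀ (i : ι) (X : TangentSpace 𝓘(ℝ, EB) p.1) (V : TangentSpace 𝓘(ℝ, EF i) (p.2 i)),
      Ric (liftB X) (liftF V) = (l i - 1) * VXlnb i V X ∧
      Ric (liftF V) (liftB X) = (l i - 1) * VXlnb i V X) ∧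
    -- different fibres
    (∀ (i j : ι) (V : TangentSpace 𝓘(ℝ, EF i) (p.2 i)) (W : TangentSpace 𝓘(ℝ, EF j) (p.2 j)),
      i ≠ j → Ric (liftF V) (liftF W) = 0) ∧
    -- one fibre
    (∀ (i : ι) (V W : TangentSpace 𝓘(ℝ, EF i) (p.2 i)),
      Ric (liftF V) (liftF W) = RicF i V W
        + (laplacianAt gB.val (bB i) p.1 / β i
          + (l i - 1) * (gB.val p.1 (grad i) (grad i) / β i ^ 2)
          + ∑ s ∈ Finset.univ.erase i, l s * (gB.val p.1 (grad i) (grad s) / (β i * β s))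
          + ((N - 1) * l₁ * l₂ - l₂ ^ 2) * π (Pl p)
          + l₂ * divAt gB.val P p.1
          + l₂ * ∑ s ∈ Finset.univ.erase i, l s * (Pb s / β s)
          + ((N - 1) * l₁ + (l i - 1) * l₂) * (Pb i / β i)) * g p (liftF V) (liftF W)) ∧
    -- if `b i` is constant on the fibre through `p`, `RicF i` is the Ricci tensor of `g_{F_i}`
    (∀ i : ι, (∀ y y' : F i, b i p.1 y = b i p.1 y') →
      ∀ V W : TangentSpace 𝓘(ℝ, EF i) (p.2 i),
        RicF i V W = leviCivitaRicci (gF i).val (p.2 i) V W) :=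
  ⟨fun X Y => quarterRicci_liftB_liftB hb hb_pos hP l₁ l₂ p X Y,
    fun i X V => ⟨quarterRicci_liftB_liftF hb hb_pos hP l₁ l₂ p i X V,
      quarterRicci_liftF_liftB hb hb_pos hP l₁ l₂ p i X V⟩,
    fun _ _ V W hij => quarterRicci_liftF_liftF_of_ne hb hb_pos hP l₁ l₂ p hij V W,
    fun i V W => quarterRicci_liftF_liftF hb hb_pos hP l₁ l₂ p i V W,
    fun i hc V W => quarterRicci_fibreMetric_of_const (gF i) (hb i) (hb_pos i) p.1 (p.2 i) hc
      l₁ l₂ V W⟩
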